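/- **Proposition 4.1.** Let $\hat k:\mathbb R\to\mathbb R$ be an integrable function with $0\le\hat k(y)\le1$ for all $y\in\mathbb R$ and $\hat k(y)<1$ whenever $|y|$ is large enough (i.e. for all $|y|>R$, for some $R$). Let $$k(x)=\frac1{2\pi}\int_{-\infty}^{+\infty}e^{-ixy}\,\hat k(y)\,dy,\qquad x\in\mathbb R,$$ be its inverse Fourier transform, and consider the translation-invariant kernel $K(x,y)=k(x-y)$ on $\mathbb R$ with Lebesgue measure $dx$. Put $\rho_n(x_1,\dots,x_n)=\det[K(x_a,x_b)]_{a,b=1}^n$, and call a Borel set $A\subset\mathbb R$ a *test set* if $\rho_1(x)=K(x,x)$ is integrable on $A$. Then: (*) for every $n$ and all $x_1,\dots,x_n\in\mathbb R$, the number $\rho_n(x_1,\dots,x_n)$ is real and nonnegative; (**) for every test set $A$, the integral operator $K_A$ on $L^2(A,dx)$ with kernel $K|_{A\times A}$ is a well-defined bounded operator with $\|K_A\|<1$; and there is a fermion point process on $\mathbb R$ with kernel $K$: a probability measure on the space of locally finite subsets $S$ of $\mathbb R$ (with the $\sigma$-algebra generated by the counts $S\mapsto|S\cap A|$, $A$ Borel)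 whose correlation functions with respect to Lebesgue measure are the $\rho_n$, that is, for every $n$ and every Borel set $B\subset\mathbb R^n$, $$\mathbb E\,\#\{(x_1,\dots,x_n)\in B:\ x_1,\dots,x_n\in S\text{ pairwise distinct}\}=\int_B\rho_n(x_1,\dots,x_n)\,dx_1\cdots dx_n .$$ -/

import Mathlib

open MeasureTheory
open scoped NNReal ENNReal

/-- A configuration in `X`: a subset having finitely many points in every compact set. -/
def Configuration (X : Type*) [TopologicalSpace X] : Type _ :=
  {S : Set X // ∀ C : Set X, IsCompact C → (S ∩ C).Finite}

/-- The σ-algebra on configurations generated by the numbers of points in Borel sets. -/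
noncomputable instance Configuration.instMeasurableSpace (X : Type*) [TopologicalSpace X] [MeasurableSpace X] :
    MeasurableSpace (Configuration X) :=
  ⨆ (A : Set X) (_ : MeasurableSet A),
    MeasurableSpace.comap (fun S : Configuration X => (S.1 ∩ A).encard) ⊤

/-- The number of `n`-tuples of pairwise distinct points of the configuration `S`
which belong to `B ⊆ Xⁿ`. -/
noncomputable def Configuration.tupleCount {X : Type*} [TopologicalSpace X] {n : ℕ}
    (B : Set (Fin n → X)) (S : Configuration X) : ℝ≥0∞ :=
  ((({x : Fin n → X | x ∈ B ∧ Function.Injective x ∧ ∀ i, x i ∈ S.1}).encard : ℕ∞) : ℝ≥0∞)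

/-- `ρ` is the `n`-th correlation function, relative to the reference measure `μ`, of the point
process with law `P`: the mean number of `n`-tuples of distinct points of the random configuration
in a Borel set `B ⊆ Xⁿ` is the integral of `ρ` over `B`. -/
def IsCorrelationFunction {X : Type*} [TopologicalSpace X] [MeasurableSpace X]
    (P : Measure (Configuration X)) (μ : Measure X) (n : ℕ) (ρ : (Fin n → X) → ℝ≥0) : Prop :=
  Measurable ρ ∧ ∀ B : Set (Fin n → X), MeasurableSet B →
    ∫⁻ S, Configuration.tupleCount B S ∂P =
      ∫⁻ x in B, (ρ x : ℝ≥0∞) ∂(Measure.pi fun _ : Fin n => μ)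

/-- The determinants `det [K(x_a, x_b)]`, `1 ≤ a, b ≤ n`. -/
noncomputable def kernelDet {X : Type*} (K : X → X → ℂ) {n : ℕ} (x : Fin n → X) : ℂ :=
  Matrix.det (Matrix.of fun a b : Fin n => K (x a) (x b))

/-- The point process with law `P` is a fermion (determinantal) point process with kernel `K`
relative to `μ`: all its correlation functions are given by the determinantal formula. -/
def IsFermionProcess {X : Type*} [TopologicalSpace X] [MeasurableSpace X]
    (P : Measure (Configuration X)) (μ : Measure X) (K : X → X → ℂ) : Prop :=
  IsProbabilityMeasure P ∧ ∃ ρ : (n : ℕ) → (Fin n → X) → ℝ≥0,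
    (∀ n, IsCorrelationFunction P μ n (ρ n)) ∧
      ∀ (n : ℕ) (x : Fin n → X), ((ρ n x : ℝ) : ℂ) = kernelDet K x

/-- A test set: a Borel set on which `ρ₁(x) = det [K(x, x)]` is integrable. -/
def IsTestSet {X : Type*} [MeasurableSpace X] (μ : Measure X) (K : X → X → ℂ) (A : Set X) : Prop :=
  MeasurableSet A ∧ IntegrableOn (fun x => kernelDet K (fun _ : Fin 1 => x)) A μ

/-- `T` is the integral operator `K_A` in `L²(A, μ)` with kernel `K` restricted to `A × A`. -/
def IsIntegralOperatorOn {X : Type*} [MeasurableSpace X] (μ : Measure X) (K : X → X → ℂ)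
    (A : Set X) (T : Lp ℂ 2 (μ.restrict A) →L[ℂ] Lp ℂ 2 (μ.restrict A)) : Prop :=
  ∀ f : Lp ℂ 2 (μ.restrict A), ∀ᵐ x ∂(μ.restrict A),
    IntegrableOn (fun y => K x y * f y) A μ ∧ T f x = ∫ y in A, K x y * f y ∂μ

/-- Condition (*): the functions `det [K(x_a, x_b)]` are (real and) nonnegative. -/
def MacchiNonneg {X : Type*} (K : X → X → ℂ) : Prop :=
  ∀ (n : ℕ) (x : Fin n → X), (kernelDet K x).im = 0 ∧ 0 ≤ (kernelDet K x).re

/-- Condition (**): for every test set `A` the integral operator `K_A` is a (well-defined) bounded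
operator in `L²(A, μ)` of norm strictly less than `1`. -/
def MacchiNormLtOne {X : Type*} [MeasurableSpace X] (μ : Measure X) (K : X → X → ℂ) : Prop :=
  ∀ A : Set X, IsTestSet μ K A →
    ∃ T : Lp ℂ 2 (μ.restrict A) →L[ℂ] Lp ℂ 2 (μ.restrict A),
      IsIntegralOperatorOn μ K A T ∧ ‖T‖ < 1

/-! Everything rests on one identity: the quadratic form of the kernel at points x_a is (1/2π) ∫ |Σ
c_b exp(i x_b t)|² k̂(t) dt (`sum_fourierKernel`). Since k̂ ≥ 0, all Gram matrices are positive
semidefinite, which is (*).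

For (**), K is constant on the diagonal, so unless k̂ = 0 almost everywhere a test set A has finite
measure. Then K_A is the compression to L²(A) of multiplication by k̂ on the Fourier side, a
norm-convergent integral of rank-one operators, hence compact and self-adjoint. If its norm were at
least 1, there would be an eigenvector f with |eigenvalue| ≥ 1. Plancherel then forces the Fourier
transform of f, extended by 0 outside A, to vanish almost everywhere where k̂ < 1, so f is
band-limited and is given almost everywhere by an entire function. That function vanishes on a set
of positive measure in the complement of A, so f = 0 (`norm_compressedMultiplier_lt_one`).

For the process, write E_g f(s) = Σ 1/k! ∫ f(s ∪ {x_1, …, x_k}) Π g(x_i) dx (`sumIntegral`), on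
functionals f of finite point sets of at most exponential growth. These operators satisfy E_g E_h =
E_{g+h} and E_0 = id (`Tame.sumIntegral_sumIntegral`, `sumIntegral_zero`). With ρ(s) the
determinants, the density of having exactly the points s in a window W must be J_W = E_{-1_W} ρ
(`janossy`). The composition law gives at once that the J_W are consistent as W grows and that
E_{1_W} J_W = ρ. What has to be proved is J_W ≥ 0 (`janossy_nonneg`).

No Fredholm determinants are needed for this. Round points down to the lattice (1/n)ℤ, cut k̂ off to
(-πn, πn] and shrink it by a factor below 1. Two points in one cell then give equal rows, so
E_{-1_W} ρ collapses to a finite alternating sum of principal minors, which is the determinant of a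
block matrix with lower right block P = 1 - M/n, M being the Gram matrix at the lattice points of W.
By orthogonality of characters, the symbol 1 on (-πn, πn] corresponds to M/n = 1, so the shrunken
symbol makes P positive definite, and a Schur complement gives the sign
(`sumIntegral_lattice_nonneg`). Letting n → ∞ preserves it.

Finally the line is cut into shells [-(m+1), m+1) \ [-m, m). The ratios of consecutive J are
transition densities, the Ionescu-Tulcea theorem yields a random sequence of finite point families,
one per shell (`exists_measure_of_densities`), and Campbell's formula (`sumIntegral_tupleNum_mul`)
turns E_{1_W} J_W = ρ into the correlation functions of their union. -/

namespace FermionProcess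

/-! ### Finite families, multisets and measurable functionals of them -/

/-- The multiset of values of a finite family. -/
def values {ι α : Type*} [Fintype ι] (x : ι → α) : Multiset α := Finset.univ.val.map x

section values

variable {ι κ α : Type*} [Fintype ι] [Fintype κ]

lemma card_values (x : ι → α) : (values x).card = Fintype.card ι := by
  simp [values]

lemma mem_values {x : ι → α} {a : α} : a ∈ values x ↔ ∃ i, x i = a := by simp [values]

lemma values_sumElim (x : ι → α) (y : κ → α) :
    values (Sum.elim x y) = values x + values y := by
  simp [values, ← Finset.univ_disjSum_univ, Finset.disjSum, Multiset.disjSum, Multiset.map_map]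

lemma values_comp_equiv (e : ι ≃ κ) (x : κ → α) : values (x ∘ e) = values x := by
  simp only [values]
  rw [← Multiset.map_map, ← Finset.map_univ_equiv e]
  rfl

lemma values_get (l : List α) : values l.get = (l : Multiset α) := by
  simp [values, Fin.univ_def]

lemma exists_values_eq (s : Multiset α) : ∃ (n : ℕ) (x : Fin n → α), values x = s := by
  induction s using Quotient.inductionOn with
  | h l => exact ⟨l.length, l.get, values_get l⟩

/-- Both families have equally many indices over each value, and bijections between the fibres glue
together. Hence any quantity invariant under reindexing, such as a Gram determinant, is a functional
of multisets. -/
lemma exists_equiv_of_values_eq {x : ι → α} {y : κ → α} (h : values x = values y) :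
    ∃ e : ι ≃ κ, y ∘ e = x := by
  classical
  have hc (c : α) : Nonempty ({a // x a = c} ≃ {b // y b = c}) := by
    refine ⟨Fintype.equivOfCardEq ?_⟩
    have := congrArg (Multiset.count c) h
    simp only [values, Multiset.count_map] at this
    rw [Fintype.card_subtype, Fintype.card_subtype]
    simp only [Finset.card, Finset.filter_val]
    simpa [eq_comm] using this
  refine ⟨Equiv.ofFiberEquiv fun c => (hc c).some, ?_⟩
  funext i
  exact Equiv.ofFiberEquiv_map _ i

lemma values_empty [IsEmpty ι] (x : ι → α) : values x = 0 := by simp [values]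

lemma nodup_values {x : ι → α} : (values x).Nodup ↔ Function.Injective x := by
  constructor
  · intro h i j hij
    exact Multiset.inj_on_of_nodup_map h i (Finset.mem_univ i) j (Finset.mem_univ j) hij
  · intro h
    exact (Multiset.nodup_map_iff_of_injective h).2 Finset.univ.nodup

end values

/-- A functional of finite multisets of real numbers which is measurable on families of any
given length. -/
def MeasurableOnFamilies {β : Type*} [MeasurableSpace β] (f : Multiset ℝ → β) : Prop :=
  ∀ k, Measurable fun x : Fin k → ℝ => f (values x)

namespace MeasurableOnFamilies

variable {β : Type*} [MeasurableSpace β] {f : Multiset ℝ → β}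

lemma comp_values (hf : MeasurableOnFamilies f) {Ω ι : Type*} [MeasurableSpace Ω] [Fintype ι]
    {p : Ω → ι → ℝ} (hp : Measurable p) : Measurable fun ω => f (values (p ω)) := by
  have e := (Fintype.equivFin ι).symm
  have : (fun ω => f (values (p ω))) = fun ω => f (values (fun i => p ω (e i))) := by
    funext ω
    exact congrArg f (values_comp_equiv e (p ω)).symm
  rw [this]
  refine (hf _).comp (measurable_pi_lambda _ fun i => ?_)
  exact (measurable_pi_apply _).comp hp

lemma comp_values_add (hf : MeasurableOnFamilies f) {Ω ι κ : Type*} [MeasurableSpace Ω]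
    [Fintype ι] [Fintype κ] {p : Ω → ι → ℝ} {q : Ω → κ → ℝ} (hp : Measurable p)
    (hq : Measurable q) : Measurable fun ω => f (values (p ω) + values (q ω)) := by
  simp_rw [← values_sumElim]
  refine hf.comp_values (measurable_pi_lambda _ fun i => ?_)
  cases i with
  | inl i => exact (measurable_pi_apply i).comp hp
  | inr i => exact (measurable_pi_apply i).comp hq

lemma comp_add (hf : MeasurableOnFamilies f) {Ω ι : Type*} [MeasurableSpace Ω]
    [Fintype ι] {p : Ω → ι → ℝ} (hp : Measurable p) (s : Multiset ℝ) :
    Measurable fun ω => f (s + values (p ω)) := by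
  obtain ⟨n, x, rfl⟩ := exists_values_eq s
  exact hf.comp_values_add measurable_const hp

lemma add_left (hf : MeasurableOnFamilies f) (s : Multiset ℝ) :
    MeasurableOnFamilies fun t => f (s + t) := fun _ => hf.comp_add measurable_id s

end MeasurableOnFamilies

/-! ### Functionals of exponential growth and the operator `sumIntegral` -/

/-- A measurable functional of finite multisets growing at most exponentially in the
cardinality. -/
structure Tame (f : Multiset ℝ → ℝ) : Prop where
  measurable : MeasurableOnFamilies f
  growth : ∃ M C : ℝ, 0 ≤ M ∧ 0 ≤ C ∧ ∀ s, |f s| ≤ M * C ^ s.card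

/-- `sumIntegral g f s = ∑ₖ 1/k! ∫ f (s ∪ {x₁, …, xₖ}) g(x₁) ⋯ g(xₖ) dx₁ ⋯ dxₖ`. -/
noncomputable def sumIntegral (g : ℝ → ℝ) (f : Multiset ℝ → ℝ) (s : Multiset ℝ) : ℝ :=
  ∑' k : ℕ, (k.factorial : ℝ)⁻¹ * ∫ x : Fin k → ℝ, (∏ i, g (x i)) * f (s + values x)

section sumIntegral

variable {g h : ℝ → ℝ} {f : Multiset ℝ → ℝ}

lemma integrable_prod_mul {ι : Type} [Fintype ι] (hg : Integrable g) {F : (ι → ℝ) → ℝ}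
    (hF : Measurable F) {M : ℝ} (hM : ∀ x, |F x| ≤ M) :
    Integrable fun x : ι → ℝ => (∏ i, g (x i)) * F x :=
  (Integrable.fintype_prod (f := fun _ : ι => g) fun _ => hg).mul_bdd
    (c := M) hF.aestronglyMeasurable (Filter.Eventually.of_forall hM)

lemma integral_abs_prod_mul_le {ι : Type} [Fintype ι] (hg : Integrable g) {F : (ι → ℝ) → ℝ}
    (hF : Measurable F) {M : ℝ} (hM : ∀ x, |F x| ≤ M) :
    ∫ x : ι → ℝ, |(∏ i, g (x i)) * F x| ≤ (∫ t, |g t|) ^ Fintype.card ι * M := by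
  rw [← integral_fintype_prod_volume_eq_pow (fun t => |g t|), ← integral_mul_const]
  refine integral_mono (integrable_prod_mul hg hF hM).abs ?_ fun x => ?_
  · exact (Integrable.fintype_prod (f := fun _ : ι => fun t => |g t|) fun _ => hg.abs).mul_const M
  · simp only [abs_mul, Finset.abs_prod]
    exact mul_le_mul_of_nonneg_left (hM x) (Finset.prod_nonneg fun _ _ => abs_nonneg _)

lemma Tame.bound_add (hf : Tame f) : ∃ M C : ℝ, 0 ≤ M ∧ 0 ≤ C ∧ (∀ s, |f s| ≤ M * C ^ s.card) ∧
    ∀ (ι : Type) [Fintype ι] (s : Multiset ℝ) (x : ι → ℝ),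
      |f (s + values x)| ≤ M * C ^ s.card * C ^ Fintype.card ι := by
  obtain ⟨M, C, hM, hC, h⟩ := hf.growth
  refine ⟨M, C, hM, hC, h, fun ι _ s x => (h _).trans_eq ?_⟩
  rw [Multiset.card_add, card_values, pow_add, mul_assoc]

lemma Tame.integrable (hf : Tame f) (hg : Integrable g) (s : Multiset ℝ) (ι : Type) [Fintype ι] :
    Integrable fun x : ι → ℝ => (∏ i, g (x i)) * f (s + values x) := by
  obtain ⟨M, C, hM, hC, -, h⟩ := hf.bound_add
  exact integrable_prod_mul hg (hf.measurable.comp_add measurable_id s) (h ι s)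

/-- Exponential growth of `f` against the factor 1/k! leaves an exponential series. This is the
majorant for the convergence of `sumIntegral`, for its growth and for its limits. -/
lemma abs_term_le {M C : ℝ} (hf : MeasurableOnFamilies f) (hg : Integrable g)
    (h : ∀ (k : ℕ) (s : Multiset ℝ) (x : Fin k → ℝ),
      |f (s + values x)| ≤ M * C ^ s.card * C ^ k) (s : Multiset ℝ) (k : ℕ) :
    |(k.factorial : ℝ)⁻¹ * ∫ x : Fin k → ℝ, (∏ i, g (x i)) * f (s + values x)| ≤
      M * C ^ s.card * ((C * ∫ t, |g t|) ^ k / k.factorial) := by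
  rw [abs_mul, abs_of_nonneg (by positivity : (0 : ℝ) ≤ (k.factorial : ℝ)⁻¹)]
  have h1 := (abs_integral_le_integral_abs).trans
    (integral_abs_prod_mul_le hg (hf.comp_add measurable_id s) (h k s))
  rw [Fintype.card_fin] at h1
  calc _ ≤ (k.factorial : ℝ)⁻¹ * ((∫ t, |g t|) ^ k * (M * C ^ s.card * C ^ k)) := by
        gcongr
        exact h1
    _ = _ := by rw [mul_pow]; ring

lemma Tame.summable (hf : Tame f) (hg : Integrable g) (s : Multiset ℝ) :
    Summable fun k : ℕ => (k.factorial : ℝ)⁻¹ *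
      ∫ x : Fin k → ℝ, (∏ i, g (x i)) * f (s + values x) := by
  obtain ⟨M, C, hM, hC, -, h⟩ := hf.bound_add
  refine Summable.of_norm_bounded (((Real.summable_pow_div_factorial
    (C * ∫ t, |g t|))).mul_left (M * C ^ s.card)) fun k => ?_
  exact abs_term_le hf.measurable hg (fun k s x => by simpa using h (Fin k) s x) s k

lemma Tame.measurable_integral (hf : Tame f) (hg : Integrable g) (n k : ℕ) :
    Measurable fun x : Fin n → ℝ =>
      ∫ y : Fin k → ℝ, (∏ i, g (y i)) * f (values x + values y) := by
  -- An integrable `g` need not be measurable; a strongly measurable version changes the integrand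
  -- only on a null set of `y`.
  obtain ⟨g', hg', hgg'⟩ := hg.aestronglyMeasurable
  have : (fun x : Fin n → ℝ => ∫ y : Fin k → ℝ, (∏ i, g (y i)) * f (values x + values y)) =
      fun x => ∫ y : Fin k → ℝ, (∏ i, g' (y i)) * f (values x + values y) := by
    funext x
    refine integral_congr_ae ?_
    have : ∀ᵐ y : Fin k → ℝ, ∀ i, g (y i) = g' (y i) := by
      rw [ae_all_iff]
      intro i
      exact (Measure.quasiMeasurePreserving_eval (fun _ : Fin k => (volume : Measure ℝ)) i).ae
        (p := fun t => g t = g' t) hgg'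
    filter_upwards [this] with y hy
    simp [hy]
  rw [this]
  refine StronglyMeasurable.measurable (StronglyMeasurable.integral_prod_right'
    (f := fun p : (Fin n → ℝ) × (Fin k → ℝ) => (∏ i, g' (p.2 i)) * f (values p.1 + values p.2))
    (Measurable.stronglyMeasurable ?_))
  refine Measurable.mul ?_ (hf.measurable.comp_values_add measurable_fst measurable_snd)
  refine Finset.measurable_prod _ fun i _ => ?_
  exact hg'.measurable.comp ((measurable_pi_apply i).comp measurable_snd)

lemma Tame.sumIntegral (hf : Tame f) (hg : Integrable g) : Tame (sumIntegral g f) := by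
  refine ⟨fun n => ?_, ?_⟩
  · have h (k : ℕ) := (hf.measurable_integral hg n k).const_mul (k.factorial : ℝ)⁻¹
    refine measurable_of_tendsto_metrizable (f := fun (N : ℕ) x => ∑ k ∈ Finset.range N,
      (k.factorial : ℝ)⁻¹ * ∫ y : Fin k → ℝ, (∏ i, g (y i)) * f (values x + values y))
      (fun N => Finset.measurable_sum _ fun k _ => h k) ?_
    rw [tendsto_pi_nhds]
    exact fun x => (hf.summable hg (values x)).hasSum.tendsto_sum_nat
  · obtain ⟨M, C, hM, hC, -, h⟩ := hf.bound_add
    refine ⟨M * Real.exp (C * ∫ t, |g t|), C, by positivity, hC, fun s => ?_⟩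
    have h1 := abs_term_le hf.measurable hg (fun k s x => by simpa using h (Fin k) s x) s
    have h2 : HasSum (fun k : ℕ => M * C ^ s.card * ((C * ∫ t, |g t|) ^ k / k.factorial))
        (M * C ^ s.card * Real.exp (C * ∫ t, |g t|)) := by
      refine HasSum.mul_left _ ?_
      rw [Real.exp_eq_exp_ℝ]
      exact NormedSpace.expSeries_div_hasSum_exp _
    have := tsum_of_norm_bounded h2 (fun k => (Real.norm_eq_abs _).trans_le (h1 k))
    rw [Real.norm_eq_abs] at this
    refine this.trans_eq ?_
    ring

/-- Splitting the coordinates along `ι ⊕ κ ≃ τ` preserves Lebesgue measure. -/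
lemma measurePreserving_sumElim_equiv {ι κ τ : Type} [Fintype ι] [Fintype κ] [Fintype τ]
    (e : ι ⊕ κ ≃ τ) : ∃ Φ : (ι → ℝ) × (κ → ℝ) ≃ᵐ (τ → ℝ),
      (∀ p, Φ p = Sum.elim p.1 p.2 ∘ e.symm) ∧ MeasurePreserving Φ volume volume := by
  refine ⟨(MeasurableEquiv.sumPiEquivProdPi (fun _ : ι ⊕ κ => ℝ)).symm.trans
    (MeasurableEquiv.piCongrLeft (fun _ : τ => ℝ) e), ?_, ?_⟩
  · rintro ⟨x, y⟩
    funext t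
    obtain ⟨i, rfl⟩ := e.surjective t
    simp only [MeasurableEquiv.trans_apply, Function.comp_apply, Equiv.symm_apply_apply]
    erw [Equiv.piCongrLeft_apply_apply]
    cases i <;> rfl
  · exact (volume_measurePreserving_piCongrLeft (fun _ : τ => ℝ) e).comp
      (volume_measurePreserving_sumPiEquivProdPi_symm (fun _ : ι ⊕ κ => ℝ))

lemma integral_eq_integral_prod_of_equiv {ι κ τ : Type} [Fintype ι] [Fintype κ] [Fintype τ]
    (e : ι ⊕ κ ≃ τ) (F : (τ → ℝ) → ℝ) :
    ∫ z, F z = ∫ p : (ι → ℝ) × (κ → ℝ), F (Sum.elim p.1 p.2 ∘ e.symm) := by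
  obtain ⟨Φ, hΦ, hmp⟩ := measurePreserving_sumElim_equiv e
  rw [← hmp.integral_comp Φ.measurableEmbedding]
  simp only [hΦ]

end sumIntegral

end FermionProcess

namespace FermionProcess

/-! ### Superposition: composing two operators `sumIntegral` adds their weights -/

section sumIntegral

variable {g h : ℝ → ℝ} {f : Multiset ℝ → ℝ}

/-- The joint contribution of `a` points weighted by `g` and `b` points weighted by `h`. -/
noncomputable def doubleIntegral (g h : ℝ → ℝ) (f : Multiset ℝ → ℝ) (s : Multiset ℝ)
    (a b : ℕ) : ℝ :=
  ∫ p : (Fin a → ℝ) × (Fin b → ℝ),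
    ((∏ i, g (p.1 i)) * ∏ i, h (p.2 i)) * f (s + (values p.1 + values p.2))

lemma Tame.integrable_prod (hf : Tame f) (hg : Integrable g) (hh : Integrable h)
    (s : Multiset ℝ) (a b : ℕ) : Integrable fun p : (Fin a → ℝ) × (Fin b → ℝ) =>
      ((∏ i, g (p.1 i)) * ∏ i, h (p.2 i)) * f (s + (values p.1 + values p.2)) := by
  obtain ⟨M, C, hM, hC, hfb, -⟩ := hf.bound_add
  refine Integrable.mul_bdd (c := M * C ^ s.card * C ^ (a + b))
    ((Integrable.fintype_prod (f := fun _ : Fin a => g) fun _ => hg).mul_prod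
      (Integrable.fintype_prod (f := fun _ : Fin b => h) fun _ => hh)) ?_ ?_
  · exact ((hf.measurable.add_left s).comp_values_add measurable_fst
      measurable_snd).aestronglyMeasurable
  · refine Filter.Eventually.of_forall fun p => (hfb _).trans_eq ?_
    simp only [Multiset.card_add, card_values, Fintype.card_fin, pow_add]
    ring

lemma Tame.exists_integral_abs_le (hf : Tame f) (hg : Integrable g) (hh : Integrable h)
    (s : Multiset ℝ) : ∃ M C : ℝ, 0 ≤ M ∧ 0 ≤ C ∧ ∀ a b : ℕ,
      ∫ p : (Fin a → ℝ) × (Fin b → ℝ),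
        |((∏ i, g (p.1 i)) * ∏ i, h (p.2 i)) * f (s + (values p.1 + values p.2))| ≤
      M * ((C * ∫ t, |g t|) ^ a * (C * ∫ t, |h t|) ^ b) := by
  obtain ⟨M, C, hM, hC, hfb, -⟩ := hf.bound_add
  refine ⟨M * C ^ s.card, C, by positivity, hC, fun a b => ?_⟩
  have h1 : ∫ p : (Fin a → ℝ) × (Fin b → ℝ),
      ((∏ i, |g (p.1 i)|) * ∏ i, |h (p.2 i)|) * (M * C ^ s.card * C ^ (a + b)) =
      (∫ t, |g t|) ^ a * (∫ t, |h t|) ^ b * (M * C ^ s.card * C ^ (a + b)) := by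
    rw [integral_mul_const, Measure.volume_eq_prod,
      integral_prod_mul (fun x : Fin a → ℝ => ∏ i, |g (x i)|) (fun y : Fin b → ℝ => ∏ i, |h (y i)|),
      integral_fintype_prod_volume_eq_pow (fun t => |g t|),
      integral_fintype_prod_volume_eq_pow (fun t => |h t|)]
    simp
  calc _ ≤ ∫ p : (Fin a → ℝ) × (Fin b → ℝ),
      ((∏ i, |g (p.1 i)|) * ∏ i, |h (p.2 i)|) * (M * C ^ s.card * C ^ (a + b)) := by
        refine integral_mono (hf.integrable_prod hg hh s a b).abs ?_ fun p => ?_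
        · exact ((Integrable.fintype_prod (f := fun _ : Fin a => fun t => |g t|)
            fun _ => hg.abs).mul_prod (Integrable.fintype_prod
              (f := fun _ : Fin b => fun t => |h t|) fun _ => hh.abs)).mul_const _
        · simp only [abs_mul, Finset.abs_prod]
          refine mul_le_mul_of_nonneg_left ((hfb _).trans_eq ?_) (by positivity)
          simp only [Multiset.card_add, card_values, Fintype.card_fin, pow_add]
          ring
    _ = _ := by rw [h1, mul_pow, mul_pow, pow_add]; ring

lemma Tame.summable_doubleIntegral (hf : Tame f) (hg : Integrable g) (hh : Integrable h)
    (s : Multiset ℝ) : Summable fun p : ℕ × ℕ =>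
      (p.1.factorial : ℝ)⁻¹ * (p.2.factorial : ℝ)⁻¹ * doubleIntegral g h f s p.1 p.2 := by
  obtain ⟨M, C, hM, hC, hb⟩ := hf.exists_integral_abs_le hg hh s
  have hs := ((Real.summable_pow_div_factorial (C * ∫ t, |g t|)).mul_of_nonneg
    (Real.summable_pow_div_factorial (C * ∫ t, |h t|)) (fun k => by positivity)
    (fun k => by positivity)).mul_left M
  refine Summable.of_norm_bounded hs fun p => ?_
  rw [Real.norm_eq_abs, abs_mul, abs_of_nonneg (by positivity :
    (0 : ℝ) ≤ (p.1.factorial : ℝ)⁻¹ * (p.2.factorial : ℝ)⁻¹)]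
  calc _ ≤ (p.1.factorial : ℝ)⁻¹ * (p.2.factorial : ℝ)⁻¹ *
      (M * ((C * ∫ t, |g t|) ^ p.1 * (C * ∫ t, |h t|) ^ p.2)) :=
        mul_le_mul_of_nonneg_left (abs_integral_le_integral_abs.trans (hb p.1 p.2)) (by positivity)
    _ = _ := by ring

lemma Tame.integral_mul_sumIntegral (hf : Tame f) (hg : Integrable g) (hh : Integrable h)
    (s : Multiset ℝ) (a : ℕ) :
    ∫ x : Fin a → ℝ, (∏ i, g (x i)) * FermionProcess.sumIntegral h f (s + values x) =
      ∑' b : ℕ, (b.factorial : ℝ)⁻¹ * doubleIntegral g h f s a b := by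
  obtain ⟨M, C, hM, hC, hb⟩ := hf.exists_integral_abs_le hg hh s
  set F : ℕ → (Fin a → ℝ) → ℝ := fun b x => (b.factorial : ℝ)⁻¹ *
    ∫ y : Fin b → ℝ, ((∏ i, g (x i)) * ∏ i, h (y i)) * f (s + (values x + values y)) with hF
  have hint (b : ℕ) : Integrable (F b) :=
    (hf.integrable_prod hg hh s a b).integral_prod_left.const_mul _
  have hval (b : ℕ) : ∫ x, F b x = (b.factorial : ℝ)⁻¹ * doubleIntegral g h f s a b := by
    rw [integral_const_mul, doubleIntegral, Measure.volume_eq_prod, integral_prod]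
    exact hf.integrable_prod hg hh s a b
  have hsum : Summable fun b => ∫ x, ‖F b x‖ := by
    refine Summable.of_nonneg_of_le (fun b => integral_nonneg fun _ => norm_nonneg _) (fun b => ?_)
      ((Real.summable_pow_div_factorial (C * ∫ t, |h t|)).mul_left (M * (C * ∫ t, |g t|) ^ a))
    calc ∫ x, ‖F b x‖ ≤ ∫ x : Fin a → ℝ, (b.factorial : ℝ)⁻¹ * ∫ y : Fin b → ℝ,
        |((∏ i, g (x i)) * ∏ i, h (y i)) * f (s + (values x + values y))| := by
          refine integral_mono (hint b).norm
            ((hf.integrable_prod hg hh s a b).abs.integral_prod_left.const_mul _) fun x => ?_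
          simp only [hF, Real.norm_eq_abs, abs_mul]
          rw [abs_of_nonneg (by positivity : (0 : ℝ) ≤ (b.factorial : ℝ)⁻¹)]
          refine mul_le_mul_of_nonneg_left ?_ (by positivity)
          refine abs_integral_le_integral_abs.trans_eq ?_
          simp only [abs_mul]
      _ = (b.factorial : ℝ)⁻¹ * ∫ p : (Fin a → ℝ) × (Fin b → ℝ),
        |((∏ i, g (p.1 i)) * ∏ i, h (p.2 i)) * f (s + (values p.1 + values p.2))| := by
          rw [integral_const_mul, Measure.volume_eq_prod, integral_prod]
          exact (hf.integrable_prod hg hh s a b).abs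
      _ ≤ (b.factorial : ℝ)⁻¹ * (M * ((C * ∫ t, |g t|) ^ a * (C * ∫ t, |h t|) ^ b)) := by
          gcongr
          exact hb a b
      _ = _ := by ring
  rw [← funext hval, integral_tsum_of_summable_integral_norm hint hsum]
  refine integral_congr_ae (Filter.Eventually.of_forall fun x => ?_)
  simp only [FermionProcess.sumIntegral, hF]
  rw [← tsum_mul_left]
  congr 1
  funext b
  rw [mul_left_comm, ← integral_const_mul]
  congr 2
  funext y
  rw [mul_assoc, add_assoc]

/-- Binomial theorem: expand the product of g + h over the set `S` of points that carry `g`. By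
symmetry of `f` a term depends only on the size of `S`, and n choose a, divided by n!, is 1/(a! b!).
-/
lemma Tame.integral_prod_add (hf : Tame f) (hg : Integrable g) (hh : Integrable h)
    (s : Multiset ℝ) (n : ℕ) :
    (n.factorial : ℝ)⁻¹ * ∫ x : Fin n → ℝ, (∏ i, (g + h) (x i)) * f (s + values x) =
      ∑ p ∈ Finset.HasAntidiagonal.antidiagonal n,
        (p.1.factorial : ℝ)⁻¹ * (p.2.factorial : ℝ)⁻¹ * doubleIntegral g h f s p.1 p.2 := by
  have hT (S : Finset (Fin n)) : Integrable (fun x : Fin n → ℝ =>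
        ((∏ i ∈ S, g (x i)) * ∏ i ∈ Finset.univ \ S, h (x i)) * f (s + values x)) ∧
      ∫ x : Fin n → ℝ,
        ((∏ i ∈ S, g (x i)) * ∏ i ∈ Finset.univ \ S, h (x i)) * f (s + values x) =
      doubleIntegral g h f s S.card (n - S.card) := by
    have hc : Sᶜ.card = n - S.card := by rw [Finset.card_compl, Fintype.card_fin]
    set e := finSumEquivOfFinset (rfl : S.card = S.card) hc with he
    have key (p : (Fin S.card → ℝ) × (Fin (n - S.card) → ℝ)) :
        ((∏ i ∈ S, g ((Sum.elim p.1 p.2 ∘ e.symm) i)) *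
          ∏ i ∈ Finset.univ \ S, h ((Sum.elim p.1 p.2 ∘ e.symm) i)) *
          f (s + values (Sum.elim p.1 p.2 ∘ e.symm)) =
        ((∏ i, g (p.1 i)) * ∏ i, h (p.2 i)) * f (s + (values p.1 + values p.2)) := by
      rw [values_comp_equiv, values_sumElim]
      congr 2
      · symm
        refine Finset.prod_bij (fun i _ => e (Sum.inl i)) ?_ ?_ ?_ ?_
        · intro i _
          simp [he]
        · intro i _ j _ hij
          simpa using hij
        · intro b hb
          obtain ⟨x, rfl⟩ := e.surjective b
          cases x with
          | inl i => exact ⟨i, Finset.mem_univ _, rfl⟩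
          | inr i =>
            exfalso
            rw [he, finSumEquivOfFinset_inr] at hb
            have := Finset.orderEmbOfFin_mem Sᶜ hc i
            rw [Finset.mem_compl] at this
            exact this hb
        · intro i _
          simp
      · symm
        refine Finset.prod_bij (fun i _ => e (Sum.inr i)) ?_ ?_ ?_ ?_
        · intro i _
          have := Finset.orderEmbOfFin_mem Sᶜ hc i
          rw [Finset.mem_compl] at this
          simpa [he] using this
        · intro i _ j _ hij
          simpa using hij
        · intro b hb
          obtain ⟨x, rfl⟩ := e.surjective b
          cases x with
          | inr i => exact ⟨i, Finset.mem_univ _, rfl⟩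
          | inl i =>
            exfalso
            rw [he, finSumEquivOfFinset_inl] at hb
            simp at hb
        · intro i _
          simp
    constructor
    · obtain ⟨Φ, hΦ, hmp⟩ := measurePreserving_sumElim_equiv e
      rw [← hmp.integrable_comp_emb Φ.measurableEmbedding]
      refine (hf.integrable_prod hg hh s S.card (n - S.card)).congr
        (Filter.Eventually.of_forall fun p => ?_)
      simp only [Function.comp_def, hΦ]
      exact (key p).symm
    · rw [integral_eq_integral_prod_of_equiv e, doubleIntegral]
      exact integral_congr_ae (Filter.Eventually.of_forall key)
  simp only [Pi.add_apply, Finset.prod_add, Finset.sum_mul]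
  rw [integral_finsetSum _ fun S _ => (hT S).1]
  simp_rw [fun S => (hT S).2]
  rw [Finset.sum_powerset_apply_card (fun a => doubleIntegral g h f s a (n - a)),
    Finset.card_univ, Fintype.card_fin,
    Finset.Nat.sum_antidiagonal_eq_sum_range_succ (fun a b =>
      (a.factorial : ℝ)⁻¹ * (b.factorial : ℝ)⁻¹ * doubleIntegral g h f s a b), Finset.mul_sum]
  refine Finset.sum_congr rfl fun a ha => ?_
  have ha' : a ≤ n := Nat.lt_succ_iff.1 (Finset.mem_range.1 ha)
  rw [nsmul_eq_mul, Nat.cast_choose ℝ ha']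
  field_simp

/-- Superposition: adding points weighted by `h` and then points weighted by `g` amounts to
adding points weighted by `g + h`. -/
theorem Tame.sumIntegral_sumIntegral (hf : Tame f) (hg : Integrable g) (hh : Integrable h)
    (s : Multiset ℝ) :
    FermionProcess.sumIntegral g (FermionProcess.sumIntegral h f) s =
      FermionProcess.sumIntegral (g + h) f s := by
  have hS := hf.summable_doubleIntegral hg hh s
  rw [FermionProcess.sumIntegral]
  simp_rw [hf.integral_mul_sumIntegral hg hh s, ← tsum_mul_left, ← mul_assoc]
  -- The absolutely convergent double series is resummed along the antidiagonals a + b = n.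
  rw [← hS.tsum_prod, ← Finset.HasAntidiagonal.sigmaAntidiagonalEquivProd.tsum_eq,
    Summable.tsum_sigma']
  · rw [FermionProcess.sumIntegral]
    congr 1
    funext n
    rw [hf.integral_prod_add hg hh s n, tsum_fintype,
      ← Finset.sum_coe_sort (Finset.HasAntidiagonal.antidiagonal n)]
    rfl
  · exact fun n => (hasSum_fintype _).summable
  · exact (Finset.HasAntidiagonal.sigmaAntidiagonalEquivProd.summable_iff (f := fun p : ℕ × ℕ =>
      (p.1.factorial : ℝ)⁻¹ * (p.2.factorial : ℝ)⁻¹ * doubleIntegral g h f s p.1 p.2)).2 hS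

lemma sumIntegral_zero (f : Multiset ℝ → ℝ) (s : Multiset ℝ) : sumIntegral 0 f s = f s := by
  rw [sumIntegral, tsum_eq_single 0]
  · simp [values_empty, Measure.real, volume_pi]
  · intro k hk
    have : NeZero k := ⟨hk⟩
    simp [Finset.prod_const, hk]

end sumIntegral

end FermionProcess

namespace FermionProcess

/-- The number of `n`-tuples of distinct points of `s` belonging to `B`. -/
noncomputable def tupleNum {n : ℕ} (B : Set (Fin n → ℝ)) (s : Multiset ℝ) : ℕ :=
  {x : Fin n → ℝ | x ∈ B ∧ Function.Injective x ∧ ∀ i, x i ∈ s}.ncard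

/-! ### Campbell's formula -/

section Campbell

variable {n : ℕ} {B : Set (Fin n → ℝ)} {j : Multiset ℝ → ℝ}

lemma finite_tuples (B : Set (Fin n → ℝ)) (s : Multiset ℝ) :
    {x : Fin n → ℝ | x ∈ B ∧ Function.Injective x ∧ ∀ i, x i ∈ s}.Finite := by
  classical
  refine (Set.Finite.pi' (t := fun _ : Fin n => {a : ℝ | a ∈ s}) fun _ => ?_).subset
    fun x hx => hx.2.2
  exact s.toFinset.finite_toSet.subset fun a ha => by simpa using ha

lemma tupleNum_values {k : ℕ} {z : Fin k → ℝ} (hz : Function.Injective z) :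
    (tupleNum B (values z) : ℝ) = ∑ i : Fin n ↪ Fin k, B.indicator 1 (z ∘ i) := by
  classical
  have : {x : Fin n → ℝ | x ∈ B ∧ Function.Injective x ∧ ∀ i, x i ∈ values z} =
      (fun i : Fin n ↪ Fin k => z ∘ i) '' {i | z ∘ i ∈ B} := by
    ext x
    constructor
    · rintro ⟨hB, hx, hm⟩
      choose i hi using fun a => mem_values.1 (hm a)
      have hxi : z ∘ i = x := funext hi
      refine ⟨⟨i, fun a b hab => hx ?_⟩, ?_, hxi⟩
      · rw [← hi a, ← hi b, hab]
      · exact (hxi.symm ▸ hB : z ∘ i ∈ B)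
    · rintro ⟨i, hi, rfl⟩
      exact ⟨hi, hz.comp i.injective, fun a => mem_values.2 ⟨i a, rfl⟩⟩
  have hinj : Function.Injective fun i : Fin n ↪ Fin k => z ∘ i := by
    intro i i' h
    ext a
    exact congrArg Fin.val (hz (congrFun h a))
  rw [tupleNum, this, Set.ncard_image_of_injective _ hinj, Set.ncard_eq_toFinset_card']
  simp [Set.indicator_apply, Finset.sum_boole]

lemma tupleNum_le (s : Multiset ℝ) : tupleNum B s ≤ s.card ^ n := by
  classical
  have h : {x : Fin n → ℝ | x ∈ B ∧ Function.Injective x ∧ ∀ i, x i ∈ s} ⊆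
      (Fintype.piFinset fun _ : Fin n => s.toFinset : Finset (Fin n → ℝ)) := by
    intro x hx
    simpa using hx.2.2
  calc tupleNum B s ≤ (Fintype.piFinset fun _ : Fin n => s.toFinset).card := by
        rw [← Set.ncard_coe_finset]
        exact Set.ncard_le_ncard h (Finset.finite_toSet _)
    _ = s.toFinset.card ^ n := by simp
    _ ≤ s.card ^ n := Nat.pow_le_pow_left (Multiset.toFinset_card_le s) n

/-- At families with repeated points the count over embeddings is wrong, but there `j` vanishes. The
product is therefore a finite sum of visibly measurable terms. -/
lemma tupleNum_mul (hj : ∀ s, ¬ s.Nodup → j s = 0) {k : ℕ} (z : Fin k → ℝ) :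
    tupleNum B (values z) * j (values z) =
      ∑ i : Fin n ↪ Fin k, B.indicator 1 (z ∘ i) * j (values z) := by
  by_cases hz : Function.Injective z
  · rw [tupleNum_values hz, Finset.sum_mul]
  · simp [hj _ (mt nodup_values.1 hz)]

lemma Tame.tupleNum_mul (hj : Tame j) (hj0 : ∀ s, ¬ s.Nodup → j s = 0) (hB : MeasurableSet B) :
    Tame fun s => tupleNum B s * j s := by
  refine ⟨fun k => ?_, ?_⟩
  · simp only [FermionProcess.tupleNum_mul hj0]
    refine Finset.measurable_sum _ fun i _ => Measurable.mul ?_ (hj.measurable k)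
    refine (measurable_one.indicator hB).comp (measurable_pi_lambda _ fun a => ?_)
    exact measurable_pi_apply _
  · obtain ⟨M, C, hM, hC, h⟩ := hj.growth
    refine ⟨n.factorial * M, Real.exp 1 * C, by positivity, by positivity, fun s => ?_⟩
    -- The polynomial bound by the n-th power of the cardinality is absorbed through x^n ≤ n!
    -- exp(x), which keeps the growth exponential.
    have h1 : (tupleNum B s : ℝ) ≤ n.factorial * Real.exp 1 ^ s.card := by
      have h2 : (tupleNum B s : ℝ) ≤ (s.card : ℝ) ^ n := by exact_mod_cast tupleNum_le s
      have h3 := Real.pow_div_factorial_le_exp (s.card : ℝ) (Nat.cast_nonneg _) n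
      rw [div_le_iff₀ (by positivity)] at h3
      rw [← Real.exp_nat_mul, mul_one]
      linarith
    rw [abs_mul, Nat.abs_cast, mul_pow]
    calc (tupleNum B s : ℝ) * |j s| ≤ (n.factorial * Real.exp 1 ^ s.card) * (M * C ^ s.card) :=
          mul_le_mul h1 (h s) (abs_nonneg _) (by positivity)
      _ = _ := by ring

lemma exists_equiv_extending {k : ℕ} (i : Fin n ↪ Fin k) :
    ∃ e : Fin n ⊕ Fin (k - n) ≃ Fin k, ∀ a, e (Sum.inl a) = i a := by
  classical
  have hc : Fintype.card (Fin (k - n)) = Fintype.card ↥(Set.range i)ᶜ := by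
    rw [Fintype.card_compl_set, Set.card_range_of_injective i.injective]
    simp
  refine ⟨(Equiv.sumCongr (Equiv.ofInjective i i.injective) (Fintype.equivOfCardEq hc)).trans
    (Equiv.Set.sumCompl (Set.range i)), fun a => ?_⟩
  simp

variable {A : Set ℝ}

lemma integrable_indicator_one (hA : MeasurableSet A) (hv : volume A ≠ ∞) :
    Integrable (A.indicator (1 : ℝ → ℝ)) :=
  (integrable_indicator_iff hA).2 (integrableOn_const hv)

/-- The contribution of `m` additional points of `A` to the integral of `j` over `B`. -/
noncomputable def boxIntegral (A : Set ℝ) (B : Set (Fin n → ℝ)) (j : Multiset ℝ → ℝ) (m : ℕ) : ℝ :=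
  ∫ p : (Fin n → ℝ) × (Fin m → ℝ), (B.indicator 1 p.1 * ∏ i, A.indicator 1 (p.2 i)) *
    j (values p.1 + values p.2)

lemma Tame.integrable_box (hj : Tame j) (hB : MeasurableSet B) (hBv : volume B ≠ ∞)
    (hA : MeasurableSet A) (hv : volume A ≠ ∞) (m : ℕ) :
    Integrable fun p : (Fin n → ℝ) × (Fin m → ℝ) =>
      (B.indicator 1 p.1 * ∏ i, A.indicator 1 (p.2 i)) * j (values p.1 + values p.2) := by
  obtain ⟨M, C, hM, hC, hfb, -⟩ := hj.bound_add
  refine Integrable.mul_bdd (c := M * C ^ (n + m))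
    (((integrable_indicator_iff hB).2 (integrableOn_const hBv)).mul_prod
      (Integrable.fintype_prod (f := fun _ : Fin m => A.indicator (1 : ℝ → ℝ))
        fun _ => integrable_indicator_one hA hv)) ?_ ?_
  · exact (hj.measurable.comp_values_add measurable_fst measurable_snd).aestronglyMeasurable
  · refine Filter.Eventually.of_forall fun p => (hfb _).trans_eq ?_
    simp [Multiset.card_add, card_values]

/-- Since `j` is symmetric, it does not matter which n of the k points form the tuple; and as tuples
of `B` lie in `A`, their own indicator factors may be dropped. -/
lemma integral_embedding_eq (hBA : ∀ x ∈ B, ∀ i, x i ∈ A) {k : ℕ} (i : Fin n ↪ Fin k) :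
    ∫ z : Fin k → ℝ, (∏ a, A.indicator 1 (z a)) * (B.indicator 1 (z ∘ i) * j (values z)) =
      boxIntegral A B j (k - n) := by
  obtain ⟨e, he⟩ := exists_equiv_extending i
  rw [integral_eq_integral_prod_of_equiv e, boxIntegral]
  refine integral_congr_ae (Filter.Eventually.of_forall fun p => ?_)
  simp only
  have h1 : (Sum.elim p.1 p.2 ∘ e.symm) ∘ i = p.1 := by
    funext a
    simp [← he a]
  rw [values_comp_equiv, values_sumElim, h1,
    ← e.prod_comp (fun a => A.indicator (1 : ℝ → ℝ) ((Sum.elim p.1 p.2 ∘ e.symm) a)),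
    Fintype.prod_sum_type]
  simp only [Function.comp_apply, Equiv.symm_apply_apply, Sum.elim_inl, Sum.elim_inr]
  by_cases hp : p.1 ∈ B
  · have : ∀ a, A.indicator (1 : ℝ → ℝ) (p.1 a) = 1 := fun a => by simp [hBA _ hp a]
    simp [this, hp]
  · simp [hp]

lemma integrable_embedding (hj : Tame j) (hB : MeasurableSet B)
    (hA : MeasurableSet A) (hv : volume A ≠ ∞) {k : ℕ} (i : Fin n ↪ Fin k) :
    Integrable fun z : Fin k → ℝ =>
      (∏ a, A.indicator 1 (z a)) * (B.indicator 1 (z ∘ i) * j (values z)) := by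
  obtain ⟨M, C, hM, hC, h⟩ := hj.growth
  refine integrable_prod_mul (integrable_indicator_one hA hv) ?_ (M := M * C ^ k) fun z => ?_
  · refine Measurable.mul ?_ (hj.measurable k)
    refine (measurable_one.indicator hB).comp (measurable_pi_lambda _ fun a => ?_)
    exact measurable_pi_apply _
  · have hz := h (values z)
    rw [card_values, Fintype.card_fin] at hz
    by_cases hp : z ∘ i ∈ B
    · simpa [hp] using hz
    · simp only [hp, not_false_eq_true, Set.indicator_of_notMem, zero_mul, abs_zero]
      positivity

/-- Campbell's formula: the mean number of tuples of distinct points in `B`, for the point process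
on `A` with (symmetric) Janossy densities `j`. -/
theorem sumIntegral_tupleNum_mul (hj : Tame j) (hj0 : ∀ s, ¬ s.Nodup → j s = 0)
    (hB : MeasurableSet B) (hA : MeasurableSet A) (hv : volume A ≠ ∞)
    (hBA : ∀ x ∈ B, ∀ i, x i ∈ A) :
    sumIntegral (A.indicator 1) (fun s => tupleNum B s * j s) 0 =
      ∫ x in B, sumIntegral (A.indicator 1) j (values x) := by
  have hgi := integrable_indicator_one hA hv
  have hBv : volume B ≠ ∞ := by
    refine ne_top_of_le_ne_top ?_ (measure_mono (t := Set.univ.pi fun _ : Fin n => A)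
      fun x hx => Set.mem_univ_pi.2 (hBA x hx))
    rw [volume_pi_pi]
    exact ENNReal.prod_ne_top fun _ _ => hv
  have hterm (k : ℕ) : (k.factorial : ℝ)⁻¹ * ∫ z : Fin k → ℝ, (∏ i, A.indicator 1 (z i)) *
      (fun s => tupleNum B s * j s) (0 + values z) =
      (k.factorial : ℝ)⁻¹ * (k.descFactorial n * boxIntegral A B j (k - n)) := by
    congr 1
    simp only [zero_add, FermionProcess.tupleNum_mul hj0, Finset.mul_sum]
    rw [integral_finsetSum _ fun i _ => integrable_embedding hj hB hA hv i]
    simp_rw [integral_embedding_eq hBA]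
    simp [Fintype.card_embedding_eq]
  have hleft : sumIntegral (A.indicator 1) (fun s => tupleNum B s * j s) 0 =
      ∑' m : ℕ, (m.factorial : ℝ)⁻¹ * boxIntegral A B j m := by
    rw [sumIntegral]
    simp_rw [hterm]
    -- Only k = m + n contributes, since there are no embeddings for k < n, and the number k!/m! of
    -- embeddings turns 1/k! into 1/m!.
    rw [← (add_left_injective n).tsum_eq]
    · congr 1
      funext m
      have h1 : (((m + n).descFactorial n : ℕ) : ℝ) * m.factorial = (m + n).factorial := by
        have := Nat.factorial_mul_descFactorial (Nat.le_add_left n m)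
        rw [Nat.add_sub_cancel] at this
        rw [mul_comm]
        exact_mod_cast this
      have h2 : ((m + n).factorial : ℝ) ≠ 0 := by positivity
      have h3 : (m.factorial : ℝ) ≠ 0 := by positivity
      simp only [Nat.add_sub_cancel]
      rw [← h1] at h2 ⊢
      field_simp
    · intro k hk
      simp only [Set.mem_range]
      by_contra hcon
      have hkn : k < n := by
        by_contra hkn
        exact hcon ⟨k - n, by omega⟩
      simp [Nat.descFactorial_eq_zero_iff_lt.2 hkn] at hk
  rw [hleft]
  obtain ⟨M, C, hM, hC, -, hb⟩ := hj.bound_add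
  set F : ℕ → (Fin n → ℝ) → ℝ := fun m x => (m.factorial : ℝ)⁻¹ *
    ∫ y : Fin m → ℝ, (∏ i, A.indicator 1 (y i)) * j (values x + values y) with hF
  have : IsFiniteMeasure (volume.restrict B) := ⟨by simpa using hBv.lt_top⟩
  have hFb (m : ℕ) (x : Fin n → ℝ) : ‖F m x‖ ≤
      M * C ^ n * ((C * ∫ t, |A.indicator (1 : ℝ → ℝ) t|) ^ m / m.factorial) := by
    have := abs_term_le hj.measurable hgi (fun k s x => by simpa using hb (Fin k) s x) (values x) m
    rwa [card_values, Fintype.card_fin] at this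
  have hFm (m : ℕ) : Measurable (F m) := (hj.measurable_integral hgi n m).const_mul _
  have hint (m : ℕ) : Integrable (F m) (volume.restrict B) :=
    Integrable.of_bound (hFm m).aestronglyMeasurable _ (Filter.Eventually.of_forall (hFb m))
  have hval (m : ℕ) : ∫ x in B, F m x = (m.factorial : ℝ)⁻¹ * boxIntegral A B j m := by
    rw [integral_const_mul, boxIntegral, Measure.volume_eq_prod, integral_prod,
      ← integral_indicator hB]
    · congr 2
      funext x
      by_cases hx : x ∈ B <;> simp [hx]
    · exact hj.integrable_box hB hBv hA hv m
  rw [← funext hval, integral_tsum_of_summable_integral_norm hint]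
  · rfl
  · refine Summable.of_nonneg_of_le (fun m => integral_nonneg fun _ => norm_nonneg _) (fun m => ?_)
      (((Real.summable_pow_div_factorial (C * ∫ t, |A.indicator (1 : ℝ → ℝ) t|)).mul_left
        (M * C ^ n)).mul_left ((volume.restrict B).real Set.univ))
    calc ∫ x in B, ‖F m x‖ ≤ ∫ x in B,
        M * C ^ n * ((C * ∫ t, |A.indicator (1 : ℝ → ℝ) t|) ^ m / m.factorial) :=
          integral_mono (hint m).norm (integrable_const _) (hFb m)
      _ = _ := by rw [integral_const, smul_eq_mul]

end Campbell

end FermionProcess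

namespace FermionProcess

open scoped ComplexOrder

/-! ### Determinants of positive semidefinite kernels -/

/-- The Gram matrix of a kernel at the points of a family. -/
def gram (κ : ℝ → ℝ → ℂ) {ι : Type*} (x : ι → ℝ) : Matrix ι ι ℂ :=
  Matrix.of fun a b => κ (x a) (x b)

/-- The (real parts of the) determinants `det [κ(x_a, x_b)]` as a functional of multisets. -/
noncomputable def detFunctional (κ : ℝ → ℝ → ℂ) (s : Multiset ℝ) : ℝ :=
  (gram κ s.toList.get).det.re

/-- A positive semidefinite kernel. -/
def IsPosKernel (κ : ℝ → ℝ → ℂ) : Prop :=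
  ∀ (ι : Type) [Fintype ι] (x : ι → ℝ), (gram κ x).PosSemidef

section det

variable {κ : ℝ → ℝ → ℂ}

/-- The enumeration chosen by `toList` is irrelevant: permuting rows and columns simultaneously does
not change a determinant. -/
lemma detFunctional_values {ι : Type*} [Fintype ι] [DecidableEq ι] (x : ι → ℝ) :
    detFunctional κ (values x) = (gram κ x).det.re := by
  have h : values x = values (values x).toList.get := by
    rw [values_get, Multiset.coe_toList]
  obtain ⟨e, he⟩ := exists_equiv_of_values_eq h
  rw [detFunctional, ← Matrix.det_submatrix_equiv_self e]
  congr 2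
  ext a b
  simp [gram, ← he]

lemma detFunctional_eq_zero {s : Multiset ℝ} {ι : Type*} [Fintype ι] [DecidableEq ι] {x : ι → ℝ}
    (hx : values x = s) {a b : ι} (hab : a ≠ b) (h : ∀ y, κ (x a) y = κ (x b) y) :
    detFunctional κ s = 0 := by
  rw [← hx, detFunctional_values, Matrix.det_zero_of_row_eq hab]
  · simp
  · funext c
    exact h _

lemma detFunctional_of_not_nodup {s : Multiset ℝ} (hs : ¬ s.Nodup) : detFunctional κ s = 0 := by
  obtain ⟨n, x, rfl⟩ := exists_values_eq s
  rw [nodup_values] at hs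
  simp only [Function.Injective, not_forall] at hs
  obtain ⟨a, b, hab, hne⟩ := hs
  exact detFunctional_eq_zero rfl hne fun y => by rw [hab]

lemma detFunctional_zero : detFunctional κ 0 = 1 := by
  have : (0 : Multiset ℝ) = values (Fin.elim0 : Fin 0 → ℝ) := (values_empty _).symm
  rw [this, detFunctional_values]
  simp

lemma measurableOnFamilies_detFunctional (hκ : Measurable (Function.uncurry κ)) :
    MeasurableOnFamilies (detFunctional κ) := by
  intro k
  simp only [detFunctional_values, Matrix.det_apply]
  refine Complex.measurable_re.comp (Finset.measurable_sum _ fun σ _ => ?_)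
  refine Measurable.const_smul (Finset.measurable_prod _ fun i _ => ?_) _
  have h : Measurable fun x : Fin k → ℝ => (x (σ i), x i) := by fun_prop
  exact hκ.comp h

lemma IsPosKernel.det_nonneg (hκ : IsPosKernel κ) {ι : Type} [Fintype ι] [DecidableEq ι]
    (x : ι → ℝ) : 0 ≤ (gram κ x).det :=
  (hκ ι x).det_nonneg

lemma IsPosKernel.detFunctional_nonneg (hκ : IsPosKernel κ) (s : Multiset ℝ) :
    0 ≤ detFunctional κ s :=
  (Complex.le_def.1 (hκ.det_nonneg _)).1

/-- For a positive kernel with constant diagonal, the arithmetic-geometric mean inequality for the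
eigenvalues bounds the determinants. -/
lemma IsPosKernel.detFunctional_le (hκ : IsPosKernel κ) {C : ℝ} (hd : ∀ x, (κ x x).re ≤ C)
    (s : Multiset ℝ) : detFunctional κ s ≤ C ^ s.card := by
  obtain ⟨n, x, rfl⟩ := exists_values_eq s
  rw [card_values, Fintype.card_fin, detFunctional_values]
  rcases Nat.eq_zero_or_pos n with rfl | hn
  · simp
  have hn' : (0 : ℝ) < n := by exact_mod_cast hn
  have hp := hκ (Fin n) x
  have hev := hp.eigenvalues_nonneg
  have hdet : (gram κ x).det.re = ∏ i, hp.1.eigenvalues i := by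
    rw [hp.1.det_eq_prod_eigenvalues, ← Complex.ofReal_re (∏ i, hp.1.eigenvalues i)]
    push_cast
    rfl
  have htr : ∑ i, hp.1.eigenvalues i ≤ n * C := by
    have h := hp.1.trace_eq_sum_eigenvalues
    have h2 : ∑ i, hp.1.eigenvalues i = ∑ i, (κ (x i) (x i)).re := by
      have := congrArg Complex.re h
      simp only [Matrix.trace, Matrix.diag, Complex.re_sum, gram, Matrix.of_apply] at this
      rw [this]
      rfl
    rw [h2]
    calc ∑ i, (κ (x i) (x i)).re ≤ ∑ _i : Fin n, C := Finset.sum_le_sum fun i _ => hd _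
      _ = n * C := by simp
  have hgm := Real.geom_mean_le_arith_mean_weighted Finset.univ (fun _ : Fin n => (n : ℝ)⁻¹)
    hp.1.eigenvalues (fun _ _ => by positivity) (by simp [hn'.ne']) (fun i _ => hev i)
  rw [hdet]
  have h1 : ∏ i, hp.1.eigenvalues i ^ ((n : ℝ)⁻¹) ≤ C := by
    refine hgm.trans ?_
    rw [← Finset.mul_sum, inv_mul_le_iff₀ hn']
    exact htr
  calc ∏ i, hp.1.eigenvalues i = (∏ i, hp.1.eigenvalues i ^ ((n : ℝ)⁻¹)) ^ n := by
        rw [← Finset.prod_pow]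
        refine Finset.prod_congr rfl fun i _ => ?_
        rw [← Real.rpow_natCast, ← Real.rpow_mul (hev i), inv_mul_cancel₀ hn'.ne', Real.rpow_one]
    _ ≤ C ^ n := pow_le_pow_left₀ (Finset.prod_nonneg fun i _ => Real.rpow_nonneg (hev i) _) h1 n

lemma IsPosKernel.tame (hκ : IsPosKernel κ) (hm : Measurable (Function.uncurry κ)) {C : ℝ}
    (hC : 0 ≤ C) (hd : ∀ x, (κ x x).re ≤ C) : Tame (detFunctional κ) :=
  ⟨measurableOnFamilies_detFunctional hm, 1, C, zero_le_one, hC, fun s => by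
    rw [abs_of_nonneg (hκ.detFunctional_nonneg s), one_mul]
    exact hκ.detFunctional_le hd s⟩

end det

/-! ### Kernels given by a Fourier integral -/

/-- The kernel `(1/2π) ∫ exp(-i (q(x) - q(y)) t) w(t) dt`. -/
noncomputable def fourierKernel (q w : ℝ → ℝ) (x y : ℝ) : ℂ :=
  (1 / (2 * (Real.pi : ℂ))) *
    ∫ t : ℝ, Complex.exp (-(Complex.I * ((q x - q y : ℝ) : ℂ) * t)) * (w t : ℂ)

section fourierKernel

variable {q w : ℝ → ℝ}

lemma norm_exp_I_mul (a t : ℝ) : ‖Complex.exp (Complex.I * (a : ℂ) * t)‖ = 1 := by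
  have : Complex.I * (a : ℂ) * t = ((a * t : ℝ) : ℂ) * Complex.I := by push_cast; ring
  rw [this, Complex.norm_exp_ofReal_mul_I]

lemma norm_exp_neg_I_mul (a t : ℝ) : ‖Complex.exp (-(Complex.I * (a : ℂ) * t))‖ = 1 := by
  rw [Complex.exp_neg, norm_inv, norm_exp_I_mul, inv_one]

lemma integrable_exp_mul (hw : Integrable w) (a : ℝ) :
    Integrable fun t : ℝ => Complex.exp (-(Complex.I * (a : ℂ) * t)) * (w t : ℂ) :=
  hw.ofReal.bdd_mul (c := 1) (by fun_prop)
    (Filter.Eventually.of_forall fun t => (norm_exp_neg_I_mul a t).le)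

/-- The phase factorises over the two points, so the form is the integral of a squared modulus
against `w`. It is thus monotone in `w`, which gives positivity here and the comparison with the
identity on a lattice later. -/
lemma sum_fourierKernel (hw : Integrable w) {ι : Type*} [Fintype ι] (x : ι → ℝ) (c : ι → ℂ) :
    ∑ a, ∑ b, star (c a) * fourierKernel q w (x a) (x b) * c b =
      ((1 / (2 * Real.pi) * ∫ t : ℝ,
        ‖∑ b, c b * Complex.exp (Complex.I * (q (x b) : ℂ) * t)‖ ^ 2 * w t : ℝ) : ℂ) := by
  have h1 (t : ℝ) : ((‖∑ b, c b * Complex.exp (Complex.I * (q (x b) : ℂ) * t)‖ ^ 2 * w t : ℝ) : ℂ)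
      = ∑ a, ∑ b, (star (c a) * c b) *
        (Complex.exp (-(Complex.I * ((q (x a) - q (x b) : ℝ) : ℂ) * t)) * (w t : ℂ)) := by
    rw [Complex.ofReal_mul, Complex.ofReal_pow, ← Complex.conj_mul', map_sum, Finset.sum_mul_sum,
      Finset.sum_mul]
    refine Finset.sum_congr rfl fun a _ => ?_
    rw [Finset.sum_mul]
    refine Finset.sum_congr rfl fun b _ => ?_
    rw [map_mul, ← Complex.exp_conj]
    have : Complex.exp (-(Complex.I * ((q (x a) - q (x b) : ℝ) : ℂ) * t)) =
        Complex.exp ((starRingEnd ℂ) (Complex.I * (q (x a) : ℂ) * t)) *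
          Complex.exp (Complex.I * (q (x b) : ℂ) * t) := by
      rw [← Complex.exp_add]
      congr 1
      simp only [map_mul, Complex.conj_I, Complex.conj_ofReal]
      push_cast
      ring
    rw [this]
    simp only [Complex.star_def]
    ring
  rw [Complex.ofReal_mul, ← integral_complex_ofReal]
  simp_rw [h1]
  rw [integral_finsetSum _ fun a _ => integrable_finsetSum _ fun b _ =>
    (integrable_exp_mul hw _).const_mul _, Finset.mul_sum]
  refine Finset.sum_congr rfl fun a _ => ?_
  rw [integral_finsetSum _ fun b _ => (integrable_exp_mul hw _).const_mul _, Finset.mul_sum]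
  refine Finset.sum_congr rfl fun b _ => ?_
  rw [integral_const_mul, fourierKernel]
  push_cast
  ring

lemma fourierKernel_conj (x y : ℝ) :
    star (fourierKernel q w x y) = fourierKernel q w y x := by
  rw [fourierKernel, fourierKernel, star_mul', Complex.star_def, ← integral_conj]
  congr 1
  · simp [Complex.conj_ofNat]
  · congr 1
    funext t
    rw [map_mul, Complex.conj_ofReal, ← Complex.exp_conj]
    congr 2
    simp only [map_neg, map_mul, Complex.conj_I, Complex.conj_ofReal]
    push_cast
    ring

lemma gram_dotProduct (κ : ℝ → ℝ → ℂ) {ι : Type*} [Fintype ι] (x : ι → ℝ) (c : ι → ℂ) :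
    star c ⬝ᵥ ((gram κ x).mulVec c) = ∑ a, ∑ b, star (c a) * κ (x a) (x b) * c b := by
  simp only [dotProduct, Matrix.mulVec, gram, Matrix.of_apply, Pi.star_apply, Finset.mul_sum,
    mul_assoc]

lemma gram_fourierKernel_isHermitian {ι : Type*} (x : ι → ℝ) :
    (gram (fourierKernel q w) x).IsHermitian := by
  ext a b
  simp only [Matrix.conjTranspose_apply, gram, Matrix.of_apply]
  exact fourierKernel_conj _ _

lemma isPosKernel_fourierKernel (hw : Integrable w) (hw0 : ∀ t, 0 ≤ w t) :
    IsPosKernel (fourierKernel q w) := by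
  intro ι _ x
  refine Matrix.PosSemidef.of_dotProduct_mulVec_nonneg (gram_fourierKernel_isHermitian x)
    fun c => ?_
  rw [gram_dotProduct, sum_fourierKernel hw]
  have : 0 ≤ 1 / (2 * Real.pi) * ∫ t : ℝ,
      ‖∑ b, c b * Complex.exp (Complex.I * (q (x b) : ℂ) * t)‖ ^ 2 * w t :=
    mul_nonneg (by positivity) (integral_nonneg fun t => mul_nonneg (by positivity) (hw0 t))
  exact_mod_cast this

lemma fourierKernel_self (x : ℝ) :
    fourierKernel q w x x = ((1 / (2 * Real.pi) * ∫ t, w t : ℝ) : ℂ) := by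
  simp only [fourierKernel, sub_self, Complex.ofReal_zero, mul_zero, zero_mul, neg_zero,
    Complex.exp_zero, one_mul]
  rw [integral_complex_ofReal]
  push_cast
  ring

lemma measurable_fourierKernel (hq : Measurable q) (hw : Integrable w) :
    Measurable (Function.uncurry (fourierKernel q w)) := by
  have hc : Continuous fun a : ℝ =>
      ∫ t : ℝ, Complex.exp (-(Complex.I * (a : ℂ) * t)) * (w t : ℂ) := by
    refine continuous_of_dominated (bound := fun t => |w t|)
      (fun a => (integrable_exp_mul hw a).aestronglyMeasurable) ?_ hw.abs ?_
    · refine fun a => Filter.Eventually.of_forall fun t => ?_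
      rw [norm_mul, norm_exp_neg_I_mul, one_mul, Complex.norm_real, Real.norm_eq_abs]
    · exact Filter.Eventually.of_forall fun t => by fun_prop
  exact (hc.measurable.comp ((hq.comp measurable_fst).sub (hq.comp measurable_snd))).const_mul _

end fourierKernel

end FermionProcess

namespace FermionProcess

open scoped ComplexOrder

/-! ### Alternating sums of principal minors and a Schur complement -/

section blocks

variable {α G : Type} [Fintype α] [Fintype G] [DecidableEq α] [DecidableEq G]

/-- Rows of `1 - hD` in the lower blocks expand into principal minors. -/
lemma det_fromBlocks_sub (M : Matrix (α ⊕ G) (α ⊕ G) ℂ) (c : ℂ) :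
    (Matrix.fromBlocks M.toBlocks₁₁ M.toBlocks₁₂ (c • M.toBlocks₂₁)
      (1 + c • M.toBlocks₂₂)).det =
    ∑ Z : Finset G, c ^ Z.card *
      (M.submatrix (Sum.map id ((↑) : Z → G)) (Sum.map id ((↑) : Z → G))).det := by
  -- Each lower row is a row of c M plus a unit vector. Multilinearity in these rows yields a sum
  -- over the set of lower indices at which the row of c M is taken.
  set m : α ⊕ G → α ⊕ G → ℂ := fun i => c • M i with hm
  set m' : α ⊕ G → α ⊕ G → ℂ := Sum.elim (fun a => M (Sum.inl a)) (fun g => Pi.single (Sum.inr g) 1)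
    with hm'
  set t : Finset (α ⊕ G) := Finset.univ.map Function.Embedding.inr with ht
  have h1 : Matrix.fromBlocks M.toBlocks₁₁ M.toBlocks₁₂ (c • M.toBlocks₂₁)
      (1 + c • M.toBlocks₂₂) = t.piecewise (m + m') m' := by
    ext i j
    rcases i with a | g
    · have : Sum.inl a ∉ t := by simp [ht]
      rw [Finset.piecewise_eq_of_notMem _ _ _ this]
      rcases j with b | g' <;> simp [hm', Matrix.toBlocks₁₁, Matrix.toBlocks₁₂]
    · have : Sum.inr g ∈ t := by simp [ht]
      rw [Finset.piecewise_eq_of_mem _ _ _ this]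
      rcases j with b | g'
      · simp [hm, hm', Matrix.toBlocks₂₁]
      · simp [hm, hm', Matrix.toBlocks₂₂, Matrix.one_apply, Pi.single_apply, add_comm, eq_comm]
  have h2 : (Matrix.fromBlocks M.toBlocks₁₁ M.toBlocks₁₂ (c • M.toBlocks₂₁)
      (1 + c • M.toBlocks₂₂)).det =
      (Matrix.detRowAlternating (n := α ⊕ G) (R := ℂ)).toMultilinearMap
        (t.piecewise (m + m') m') := by rw [h1]; rfl
  rw [h2, MultilinearMap.map_piecewise_add]
  have hpow : t.powerset =
      Finset.univ.map (Finset.mapEmbedding (Function.Embedding.inr : G ↪ α ⊕ G)).toEmbedding := by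
    ext s
    simp [ht, Finset.subset_map_iff, eq_comm]
  rw [hpow, Finset.sum_map]
  refine Finset.sum_congr rfl fun Z _ => ?_
  simp only [RelEmbedding.coe_toEmbedding, Finset.mapEmbedding_apply]
  set s : Finset (α ⊕ G) := Z.map Function.Embedding.inr with hs
  let N : Matrix (α ⊕ G) (α ⊕ G) ℂ := Matrix.of (s.piecewise m m')
  change N.det = _
  -- With the indices outside `Z` moved last, the matrix is block upper triangular with an identity
  -- block in the lower right corner.
  set e : (α ⊕ {g // g ∈ Z}) ⊕ {g // g ∉ Z} ≃ α ⊕ G :=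
    (Equiv.sumAssoc α {g // g ∈ Z} {g // g ∉ Z}).trans
      (Equiv.sumCongr (Equiv.refl α) (Equiv.sumCompl (· ∈ Z))) with he
  rw [← Matrix.det_submatrix_equiv_self e]
  set v : α ⊕ {g // g ∈ Z} → ℂ := Sum.elim (fun _ => 1) (fun _ => c) with hv
  set S := M.submatrix (Sum.map id ((↑) : Z → G)) (Sum.map id ((↑) : Z → G)) with hS
  have hblock : N.submatrix e e =
      Matrix.fromBlocks (Matrix.of fun i j => v i * S i j)
        (Matrix.of fun i j => N (e (Sum.inl i)) (e (Sum.inr j))) 0 1 := by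
    ext i j
    rcases i with (a | g) | g
    · have h : Sum.inl a ∉ s := by simp [hs]
      rcases j with (b | g') | g' <;>
        simp [N, he, hv, hS, h, hm', Finset.piecewise]
    · have h : Sum.inr (g : G) ∈ s := by simp [hs]
      rcases j with (b | g') | g' <;>
        simp [N, he, hv, hS, hs, hm, Finset.piecewise]
    · have h : Sum.inr (g : G) ∉ s := by simpa [hs] using g.2
      rcases j with (b | g') | g'
      · simp [N, he, h, hm', Finset.piecewise]
      · have : (g : G) ≠ g' := fun hgg => g.2 (hgg ▸ g'.2)
        simp [N, he, h, hm', Finset.piecewise, this.symm]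
      · simp [N, he, h, hm', Finset.piecewise, Pi.single_apply, Matrix.one_apply,
          eq_comm, Subtype.ext_iff]
  rw [hblock, Matrix.det_fromBlocks_zero₂₁, Matrix.det_one, mul_one, Matrix.det_mul_column]
  congr 1
  rw [Fintype.prod_sum_type]
  simp [hv]

/-- Inclusion-exclusion sums of principal minors are nonnegative when `0 ≤ hM < 1`. -/
lemma IsPosKernel.sum_det_nonneg {κ : ℝ → ℝ → ℂ} (hκ : IsPosKernel κ) {h : ℝ} (hh : 0 ≤ h)
    (x : α → ℝ) (r : G → ℝ) (hr : (1 - (h : ℂ) • gram κ r).PosDef) :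
    0 ≤ ∑ Z : Finset G, (-h) ^ Z.card * detFunctional κ (values x + Z.val.map r) := by
  have hsum := det_fromBlocks_sub (gram κ (Sum.elim x r)) (-(h : ℂ))
  have hZ (Z : Finset G) : (gram κ (Sum.elim x r)).submatrix (Sum.map id ((↑) : Z → G))
      (Sum.map id ((↑) : Z → G)) = gram κ (Sum.elim x (fun z : Z => r z)) := by
    ext i j
    rcases i with a | g <;> rcases j with b | g' <;> rfl
  have hval (Z : Finset G) : values (fun z : Z => r z) = Z.val.map r := by
    simp only [values, Finset.univ_eq_attach, Finset.attach_val]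
    exact Multiset.attach_map_val' _ _
  have hre : ∑ Z : Finset G, (-h) ^ Z.card * detFunctional κ (values x + Z.val.map r) =
      (∑ Z : Finset G, (-(h : ℂ)) ^ Z.card * ((gram κ (Sum.elim x r)).submatrix
        (Sum.map id ((↑) : Z → G)) (Sum.map id ((↑) : Z → G))).det).re := by
    rw [Complex.re_sum]
    refine Finset.sum_congr rfl fun Z _ => ?_
    rw [hZ, ← hval, ← values_sumElim, detFunctional_values, ← Complex.ofReal_neg,
      ← Complex.ofReal_pow, Complex.re_ofReal_mul]
  rw [hre, ← hsum]
  suffices hnn : (0 : ℂ) ≤ _ from (Complex.le_def.1 hnn).1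
  set P := 1 - (h : ℂ) • gram κ r with hP
  have hblock : (1 + -(h : ℂ) • (gram κ (Sum.elim x r)).toBlocks₂₂) = P := by
    ext i j
    simp [hP, gram, Matrix.toBlocks₂₂, sub_eq_add_neg]
  rw [hblock]
  have hu : IsUnit P.det := hr.det_pos.ne'.isUnit
  let _ : Invertible P := Matrix.invertibleOfIsUnitDet P hu
  -- The determinant is det P times that of the Schur complement. The lower left block is -h B*, so
  -- the subtraction becomes the sum A + h B P⁻¹ B* of positive semidefinite matrices.
  rw [Matrix.det_fromBlocks₂₂]
  refine mul_nonneg hr.det_pos.le (Matrix.PosSemidef.det_nonneg ?_)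
  set B := (gram κ (Sum.elim x r)).toBlocks₁₂ with hB
  have hC : (gram κ (Sum.elim x r)).toBlocks₂₁ = B.conjTranspose := by
    have := (hκ _ (Sum.elim x r)).1
    ext i j
    have h := congrFun (congrFun this (Sum.inr i)) (Sum.inl j)
    rw [Matrix.conjTranspose_apply] at h
    simpa [hB, Matrix.toBlocks₂₁, Matrix.toBlocks₁₂] using h.symm
  have hA : (gram κ (Sum.elim x r)).toBlocks₁₁ = gram κ x := rfl
  have heq : (gram κ (Sum.elim x r)).toBlocks₁₁ -
      B * ⅟P * (-(h : ℂ) • (gram κ (Sum.elim x r)).toBlocks₂₁) =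
      gram κ x + h • (B * P⁻¹ * B.conjTranspose) := by
    rw [hC, hA, Matrix.invOf_eq_nonsing_inv, Matrix.mul_smul, neg_smul, sub_neg_eq_add]
    rfl
  rw [heq]
  exact (hκ α x).add ((hr.posSemidef.inv.mul_mul_conjTranspose_same B).smul hh)

end blocks

end FermionProcess

namespace FermionProcess

open scoped ComplexOrder
open Filter Topology

/-- Dominated convergence is applied twice, in each integral and then in the series; the bound
C^card, uniform in N, supplies both majorants. -/
lemma tendsto_sumIntegral {g : ℝ → ℝ} (hg : Integrable g) {F : ℕ → Multiset ℝ → ℝ}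
    {f : Multiset ℝ → ℝ} (hF : ∀ N, MeasurableOnFamilies (F N)) {C : ℝ}
    (hFC : ∀ N s, |F N s| ≤ C ^ s.card)
    (hlim : ∀ s, Tendsto (fun N => F N s) atTop (𝓝 (f s))) (s : Multiset ℝ) :
    Tendsto (fun N => sumIntegral g (F N) s) atTop (𝓝 (sumIntegral g f s)) := by
  have hb (N k : ℕ) (s : Multiset ℝ) (x : Fin k → ℝ) :
      |F N (s + values x)| ≤ 1 * C ^ s.card * C ^ k := by
    refine (hFC N _).trans_eq ?_
    rw [Multiset.card_add, card_values, Fintype.card_fin, pow_add, one_mul]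
  refine tendsto_tsum_of_dominated_convergence
    ((Real.summable_pow_div_factorial (C * ∫ t, |g t|)).mul_left (1 * C ^ s.card)) (fun k => ?_)
    (Eventually.of_forall fun N k => abs_term_le (hF N) hg (hb N) s k)
  refine Tendsto.const_mul _ ?_
  refine tendsto_integral_of_dominated_convergence
    (fun x : Fin k → ℝ => (∏ i, |g (x i)|) * (1 * C ^ s.card * C ^ k)) (fun N => ?_) ?_
    (fun N => Eventually.of_forall fun x => ?_) (Eventually.of_forall fun x => ?_)
  · exact (integrable_prod_mul hg ((hF N).comp_add measurable_id s) (hb N k s)).aestronglyMeasurable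
  · exact (Integrable.fintype_prod (f := fun _ : Fin k => fun t => |g t|)
      fun _ => hg.abs).mul_const _
  · rw [Real.norm_eq_abs, abs_mul, Finset.abs_prod]
    exact mul_le_mul_of_nonneg_left (hb N k s x) (Finset.prod_nonneg fun _ _ => abs_nonneg _)
  · exact (hlim _).const_mul _

/-! ### Discretisation: functionals that depend only on cells -/

section cells

/-- The cell of side `1/n` with number `u`. -/
def cell (n : ℕ) (u : ℤ) : Set ℝ := {x | ⌊(n : ℝ) * x⌋ = u}

variable {n : ℕ} (hn : 0 < n)
include hn

lemma cell_eq (u : ℤ) : cell n u = Set.Ico ((u : ℝ) / n) ((u + 1 : ℝ) / n) := by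
  have hn' : (0 : ℝ) < n := by exact_mod_cast hn
  ext x
  rw [cell, Set.mem_ofPred_eq, Int.floor_eq_iff, Set.mem_Ico, div_le_iff₀ hn', lt_div_iff₀ hn',
    mul_comm x]

lemma measurableSet_cell (u : ℤ) : MeasurableSet (cell n u) := by
  rw [cell_eq hn]
  exact measurableSet_Ico

lemma volume_cell (u : ℤ) : volume (cell n u) = ENNReal.ofReal (1 / n) := by
  rw [cell_eq hn, Real.volume_Ico]
  congr 1
  ring

lemma div_mem_cell (u : ℤ) : (u : ℝ) / n ∈ cell n u := by
  have hn' : (0 : ℝ) < n := by exact_mod_cast hn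
  rw [cell, Set.mem_ofPred_eq, mul_div_cancel₀ _ hn'.ne', Int.floor_intCast]

lemma integrable_neg_cell (u : ℤ) : Integrable (-(cell n u).indicator (1 : ℝ → ℝ)) :=
  (integrable_indicator_one (measurableSet_cell hn u)
    (by rw [volume_cell hn]; exact ENNReal.ofReal_ne_top)).neg

omit hn in
/-- A functional which only depends on the cells of the points and which vanishes when two points
share a cell. -/
structure IsCellFunctional (n : ℕ) (f : Multiset ℝ → ℝ) : Prop where
  congr : ∀ u, ∀ x ∈ cell n u, ∀ y ∈ cell n u, ∀ s, f (s + {x}) = f (s + {y})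
  vanish : ∀ u, ∀ x ∈ cell n u, ∀ y ∈ cell n u, ∀ s, f (s + {x} + {y}) = 0

/-- Two added points would share the cell, so only k = 0 and k = 1 survive. In the latter `f` is
constant on the cell, of length 1/n, and may be evaluated at its left end point. -/
lemma IsCellFunctional.sumIntegral_cell {f : Multiset ℝ → ℝ}
    (hc : IsCellFunctional n f) (u : ℤ) (s : Multiset ℝ) :
    sumIntegral (-(cell n u).indicator 1) f s = f s - 1 / n * f (s + {(u : ℝ) / n}) := by
  rw [sumIntegral, tsum_eq_sum (s := Finset.range 2)]
  · have h1 (x : Fin 1 → ℝ) : (∏ i, (-(cell n u).indicator (1 : ℝ → ℝ)) (x i)) * f (s + values x) =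
        (∏ i, (-(cell n u).indicator (1 : ℝ → ℝ)) (x i)) * f (s + {(u : ℝ) / n}) := by
      by_cases hx : x 0 ∈ cell n u
      · have : values x = {x 0} := by simp [values]
        rw [this, hc.congr u _ hx _ (div_mem_cell hn u)]
      · simp [hx]
    have h2 : ∫ t, (-(cell n u).indicator (1 : ℝ → ℝ)) t = -(1 / n) := by
      simp only [Pi.neg_apply]
      rw [integral_neg, integral_indicator_one (measurableSet_cell hn u), Measure.real,
        volume_cell hn, ENNReal.toReal_ofReal (by positivity)]
    rw [Finset.sum_range_succ, Finset.sum_range_one]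
    simp_rw [h1]
    rw [integral_mul_const, integral_fintype_prod_volume_eq_pow, h2]
    simp [values_empty, Measure.real, volume_pi]
    ring
  · intro k hk
    have hk2 : 2 ≤ k := by
      rw [Finset.mem_range] at hk
      omega
    have h0 (x : Fin k → ℝ) :
        (∏ i, (-(cell n u).indicator (1 : ℝ → ℝ)) (x i)) * f (s + values x) = 0 := by
      by_cases hx : ∀ i, x i ∈ cell n u
      · obtain ⟨m, rfl⟩ := Nat.exists_eq_add_of_le hk2
        have hv : values x = values (fun i : Fin m => x (Fin.natAdd 2 i)) + {x (Fin.castAdd m 0)} +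
            {x (Fin.castAdd m 1)} := by
          rw [← values_comp_equiv finSumFinEquiv x]
          have : x ∘ finSumFinEquiv = Sum.elim (fun i : Fin 2 => x (Fin.castAdd m i))
              (fun i : Fin m => x (Fin.natAdd 2 i)) := by
            funext i
            cases i <;> simp
          rw [this, values_sumElim, add_comm, add_assoc]
          congr 1
        rw [hv, ← add_assoc, ← add_assoc, hc.vanish u _ (hx _) _ (hx _), mul_zero]
      · push Not at hx
        obtain ⟨i, hi⟩ := hx
        rw [Finset.prod_eq_zero (Finset.mem_univ i), zero_mul]
        simp [hi]
    simp only [h0, integral_zero, mul_zero]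

/-- Superposition allows the cells to be removed one at a time. Each removal produces another tame
cell functional, which is why the induction runs over all `f`. -/
lemma IsCellFunctional.sumIntegral_cells (Y : Finset ℤ) : ∀ {f : Multiset ℝ → ℝ},
    Tame f → IsCellFunctional n f → ∀ s,
    sumIntegral (∑ u ∈ Y, -(cell n u).indicator 1) f s =
      ∑ Z ∈ Y.powerset, (-(1 / n : ℝ)) ^ Z.card * f (s + Z.val.map fun u : ℤ => (u : ℝ) / n) := by
  induction Y using Finset.induction_on with
  | empty =>
    intro f hf hc s
    rw [Finset.sum_empty, sumIntegral_zero]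
    simp
  | insert u Y hu ih =>
    intro f hf hc s
    have hcell := integrable_neg_cell hn u
    have hY : Integrable (∑ u ∈ Y, -(cell n u).indicator (1 : ℝ → ℝ)) :=
      integrable_finsetSum' _ fun u _ => integrable_neg_cell hn u
    have hfun : sumIntegral (-(cell n u).indicator 1) f =
        fun s => f s - 1 / n * f (s + {(u : ℝ) / n}) := funext (hc.sumIntegral_cell hn u)
    have hf' := hf.sumIntegral hcell
    rw [hfun] at hf'
    have hc' : IsCellFunctional n fun s => f s - 1 / n * f (s + {(u : ℝ) / n}) := by
      constructor
      · intro v x hx y hy s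
        rw [hc.congr v x hx y hy s, add_right_comm, hc.congr v x hx y hy, add_right_comm]
      · intro v x hx y hy s
        rw [hc.vanish v x hx y hy s, add_right_comm, add_right_comm s, hc.vanish v x hx y hy]
        simp
    rw [Finset.sum_insert hu, add_comm, ← hf.sumIntegral_sumIntegral hY hcell, hfun,
      ih hf' hc' s, Finset.sum_powerset_insert hu, ← Finset.sum_add_distrib]
    refine Finset.sum_congr rfl fun Z hZ => ?_
    have huZ : u ∉ Z := fun h => hu (Finset.mem_powerset.1 hZ h)
    rw [Finset.card_insert_of_notMem huZ, Finset.insert_val_of_notMem huZ, Multiset.map_cons,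
      ← Multiset.singleton_add, add_comm {(u : ℝ) / n}, ← add_assoc]
    ring

end cells

/-! ### Positivity of the Janossy densities on the lattice -/

section lattice

variable {n : ℕ}

/-- The left end point of the cell of `x`. -/
noncomputable def cellFloor (n : ℕ) (x : ℝ) : ℝ := (⌊(n : ℝ) * x⌋ : ℝ) / n

lemma measurable_cellFloor : Measurable (cellFloor n) := by
  unfold cellFloor
  fun_prop

lemma cellFloor_div (hn : 0 < n) (u : ℤ) : cellFloor n ((u : ℝ) / n) = (u : ℝ) / n := by
  have := div_mem_cell hn u
  rw [cell, Set.mem_ofPred_eq] at this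
  rw [cellFloor, this]

/-- The kernel sees a point only through the left end of its cell, and two points of one cell
produce equal rows. -/
lemma isCellFunctional_detFunctional (w : ℝ → ℝ) :
    IsCellFunctional n (detFunctional (fourierKernel (cellFloor n) w)) := by
  have hfl (u : ℤ) (x : ℝ) (hx : x ∈ cell n u) : cellFloor n x = (u : ℝ) / n := by
    rw [cell, Set.mem_ofPred_eq] at hx
    rw [cellFloor, hx]
  constructor
  · intro u x hx y hy s
    obtain ⟨m, z, rfl⟩ := exists_values_eq s
    have hv (x : ℝ) : values z + {x} = values (Sum.elim z (fun _ : Fin 1 => x)) := by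
      rw [values_sumElim]
      simp [values]
    rw [hv, hv, detFunctional_values, detFunctional_values]
    congr 2
    ext a b
    rcases a with a | a <;> rcases b with b | b <;>
      simp [gram, fourierKernel, hfl u x hx, hfl u y hy]
  · intro u x hx y hy s
    obtain ⟨m, z, rfl⟩ := exists_values_eq s
    have hv : values z + {x} + {y} =
        values (Sum.elim z (Sum.elim (fun _ : Fin 1 => x) (fun _ : Fin 1 => y))) := by
      rw [values_sumElim, values_sumElim]
      simp [values, add_assoc]
    refine detFunctional_eq_zero hv.symm (a := Sum.inr (Sum.inl 0)) (b := Sum.inr (Sum.inr 0))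
      (by simp) fun t => ?_
    simp [fourierKernel, hfl u x hx, hfl u y hy]

/-- The interval has length 2πn and the frequency is m/n, so the integral runs over |m| full
periods. -/
lemma integral_exp_lattice (hn : 0 < n) (m : ℤ) (hm : m ≠ 0) :
    ∫ t in (-(Real.pi * n))..(Real.pi * n),
      Complex.exp (-(Complex.I * ((m / n : ℝ) : ℂ) * t)) = 0 := by
  have hn' : (n : ℂ) ≠ 0 := by exact_mod_cast hn.ne'
  have hm' : (m : ℂ) ≠ 0 := by exact_mod_cast hm
  have hc : -(Complex.I * ((m / n : ℝ) : ℂ)) ≠ 0 := by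
    simp [hn', hm']
  have h1 (t : ℝ) : Complex.exp (-(Complex.I * ((m / n : ℝ) : ℂ) * t)) =
      Complex.exp (-(Complex.I * ((m / n : ℝ) : ℂ)) * t) := by
    congr 1
    ring
  simp_rw [h1]
  rw [integral_exp_mul_complex hc]
  have : Complex.exp (-(Complex.I * ((m / n : ℝ) : ℂ)) * ((Real.pi * n : ℝ) : ℂ)) =
      Complex.exp (-(Complex.I * ((m / n : ℝ) : ℂ)) * ((-(Real.pi * n) : ℝ) : ℂ)) := by
    rw [Complex.exp_eq_exp_iff_exists_int]
    refine ⟨-m, ?_⟩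
    push_cast
    field_simp
    ring
  rw [this, sub_self, zero_div]

lemma fourierKernel_lattice (hn : 0 < n) (u v : ℤ) :
    fourierKernel (cellFloor n) ((Set.Ioc (-(Real.pi * n)) (Real.pi * n)).indicator 1)
      ((u : ℝ) / n) ((v : ℝ) / n) = if u = v then (n : ℂ) else 0 := by
  have hn' : (n : ℂ) ≠ 0 := by exact_mod_cast hn.ne'
  have hle : -(Real.pi * n) ≤ Real.pi * n := by
    have : 0 ≤ Real.pi * n := by positivity
    linarith
  have h1 (a : ℝ) : ∫ t : ℝ, Complex.exp (-(Complex.I * (a : ℂ) * t)) *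
      (((Set.Ioc (-(Real.pi * n)) (Real.pi * n)).indicator (1 : ℝ → ℝ) t : ℝ) : ℂ) =
      ∫ t in (-(Real.pi * n))..(Real.pi * n), Complex.exp (-(Complex.I * (a : ℂ) * t)) := by
    rw [intervalIntegral.integral_of_le hle, ← integral_indicator measurableSet_Ioc]
    congr 1
    funext t
    by_cases ht : t ∈ Set.Ioc (-(Real.pi * n)) (Real.pi * n) <;> simp [ht]
  rw [fourierKernel, cellFloor_div hn, cellFloor_div hn, h1]
  split_ifs with h
  · subst h
    simp only [sub_self, Complex.ofReal_zero, mul_zero, zero_mul, neg_zero, Complex.exp_zero,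
      intervalIntegral.integral_const]
    have hpi : (Real.pi : ℂ) ≠ 0 := by exact_mod_cast Real.pi_ne_zero
    simp only [Complex.real_smul]
    push_cast
    field_simp
    ring
  · have h2 : (u : ℝ) / n - (v : ℝ) / n = ((u - v : ℤ) : ℝ) / n := by
      push_cast
      ring
    rw [h2, integral_exp_lattice hn _ (sub_ne_zero.2 h), mul_zero]

/-- For the full band the Gram matrix at distinct lattice points is n times the identity. As the
form is monotone in the symbol, 1/n times the Gram matrix of `w` is at most 1 - ε. -/
lemma posDef_one_sub_gram (hn : 0 < n) {w : ℝ → ℝ} (hw : Integrable w) {ε : ℝ} (hε : 0 < ε)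
    (hw1 : ∀ t, w t ≤ (1 - ε) * (Set.Ioc (-(Real.pi * n)) (Real.pi * n)).indicator 1 t)
    {G : Type} [Fintype G] [DecidableEq G] (u : G → ℤ) (hu : Function.Injective u) :
    (1 - ((1 / n : ℝ) : ℂ) • gram (fourierKernel (cellFloor n) w)
      (fun g => (u g : ℝ) / n)).PosDef := by
  have hn' : (0 : ℝ) < n := by exact_mod_cast hn
  have hi : Integrable ((Set.Ioc (-(Real.pi * n)) (Real.pi * n)).indicator (1 : ℝ → ℝ)) :=
    integrable_indicator_one measurableSet_Ioc (by simp)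
  refine Matrix.PosDef.of_dotProduct_mulVec_pos ?_ fun c hc => ?_
  · refine Matrix.isHermitian_one.sub ?_
    have h := gram_fourierKernel_isHermitian (q := cellFloor n) (w := w)
      (fun g => (u g : ℝ) / n)
    rw [Matrix.IsHermitian, Matrix.conjTranspose_smul, h.eq, Complex.star_def,
      Complex.conj_ofReal]
  · rw [Matrix.sub_mulVec, Matrix.one_mulVec, Matrix.smul_mulVec, dotProduct_sub,
      dotProduct_smul, gram_dotProduct, sum_fourierKernel hw]
    set φ : ℝ → ℝ := fun t =>
      ‖∑ b, c b * Complex.exp (Complex.I * (cellFloor n ((u b : ℝ) / n) : ℂ) * t)‖ ^ 2 with hφ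
    have hcc : star c ⬝ᵥ c = ((∑ b, ‖c b‖ ^ 2 : ℝ) : ℂ) := by
      simp only [dotProduct, Pi.star_apply, Complex.star_def, Complex.conj_mul']
      push_cast
      rfl
    have hlat : 1 / (2 * Real.pi) * ∫ t : ℝ,
        φ t * (Set.Ioc (-(Real.pi * n)) (Real.pi * n)).indicator 1 t = n * ∑ b, ‖c b‖ ^ 2 := by
      have h := sum_fourierKernel (q := cellFloor n) hi (fun g => (u g : ℝ) / n) c
      simp only [fourierKernel_lattice hn, hu.eq_iff, mul_ite, mul_zero, ite_mul, zero_mul,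
        Finset.sum_ite_eq, Finset.mem_univ, if_true] at h
      apply Complex.ofReal_injective
      rw [← h]
      push_cast
      rw [Finset.mul_sum]
      refine Finset.sum_congr rfl fun b _ => ?_
      rw [Complex.star_def, mul_right_comm, Complex.conj_mul', mul_comm]
    have hφc : Continuous φ := by
      simp only [hφ]
      fun_prop
    have hφb (t : ℝ) : ‖φ t‖ ≤ (∑ b, ‖c b‖) ^ 2 := by
      rw [hφ, norm_pow, norm_norm]
      refine pow_le_pow_left₀ (norm_nonneg _) ((norm_sum_le _ _).trans_eq ?_) 2
      simp [norm_exp_I_mul]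
    have hle : 1 / (2 * Real.pi) * ∫ t : ℝ, φ t * w t ≤
        (1 - ε) * (n * ∑ b, ‖c b‖ ^ 2) := by
      have key : ∫ t : ℝ, φ t * w t ≤ (1 - ε) * ∫ t : ℝ,
          φ t * (Set.Ioc (-(Real.pi * n)) (Real.pi * n)).indicator 1 t := by
        rw [← integral_const_mul]
        refine integral_mono ?_ ?_ fun t => ?_
        · exact hw.bdd_mul hφc.aestronglyMeasurable (Eventually.of_forall hφb)
        · exact (hi.bdd_mul hφc.aestronglyMeasurable (Eventually.of_forall hφb)).const_mul _
        · simp only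
          rw [mul_left_comm]
          exact mul_le_mul_of_nonneg_left (hw1 t) (by positivity)
      rw [← hlat, mul_left_comm]
      exact mul_le_mul_of_nonneg_left key (by positivity)
    have hpos : 0 < ∑ b, ‖c b‖ ^ 2 := by
      obtain ⟨b, hb⟩ := Function.ne_iff.1 hc
      refine Finset.sum_pos' (fun _ _ => by positivity) ⟨b, Finset.mem_univ _, ?_⟩
      have : 0 < ‖c b‖ := norm_pos_iff.2 hb
      positivity
    rw [hcc, smul_eq_mul, ← Complex.ofReal_mul, ← Complex.ofReal_sub]
    have : 0 < ∑ b, ‖c b‖ ^ 2 - 1 / n * (1 / (2 * Real.pi) * ∫ t : ℝ, φ t * w t) := by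
      have h2 : 1 / n * (1 / (2 * Real.pi) * ∫ t : ℝ, φ t * w t) ≤
          1 / n * ((1 - ε) * (n * ∑ b, ‖c b‖ ^ 2)) :=
        mul_le_mul_of_nonneg_left hle (by positivity)
      have h3 : 1 / n * ((1 - ε) * (n * ∑ b, ‖c b‖ ^ 2)) = (1 - ε) * ∑ b, ‖c b‖ ^ 2 := by
        field_simp
      nlinarith
    exact Complex.zero_lt_real.2 this

lemma sum_indicator_cell (hn : 0 < n) (m : ℕ) :
    ∑ u ∈ Finset.Ico (-(m * n : ℤ)) (m * n), -(cell n u).indicator (1 : ℝ → ℝ) =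
      -(Set.Ico (-(m : ℝ)) m).indicator 1 := by
  have hn' : (0 : ℝ) < n := by exact_mod_cast hn
  rw [Finset.sum_neg_distrib]
  congr 1
  funext x
  rw [Finset.sum_apply]
  have h1 (u : ℤ) : (cell n u).indicator (1 : ℝ → ℝ) x = if ⌊(n : ℝ) * x⌋ = u then 1 else 0 := by
    by_cases h : ⌊(n : ℝ) * x⌋ = u
    · simp [cell, h]
    · simp [cell, h]
  simp_rw [h1]
  rw [Finset.sum_ite_eq]
  have h2 : ⌊(n : ℝ) * x⌋ ∈ Finset.Ico (-(m * n : ℤ)) (m * n) ↔ x ∈ Set.Ico (-(m : ℝ)) m := by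
    rw [Finset.mem_Ico, Set.mem_Ico, Int.le_floor, Int.floor_lt]
    push_cast
    constructor
    · rintro ⟨h3, h4⟩
      exact ⟨by nlinarith, by nlinarith⟩
    · rintro ⟨h3, h4⟩
      exact ⟨by nlinarith, by nlinarith⟩
  by_cases hx : x ∈ Set.Ico (-(m : ℝ)) m
  · rw [if_pos (h2.2 hx)]
    simp [hx]
  · rw [if_neg (mt h2.1 hx)]
    simp [hx]

lemma sumIntegral_lattice_nonneg (hn : 0 < n) {w : ℝ → ℝ} (hw : Integrable w)
    (hw0 : ∀ t, 0 ≤ w t) {ε : ℝ} (hε : 0 < ε)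
    (hw1 : ∀ t, w t ≤ (1 - ε) * (Set.Ioc (-(Real.pi * n)) (Real.pi * n)).indicator 1 t)
    (m : ℕ) (s : Multiset ℝ) :
    0 ≤ sumIntegral (-(Set.Ico (-(m : ℝ)) m).indicator 1)
      (detFunctional (fourierKernel (cellFloor n) w)) s := by
  have hpos := isPosKernel_fourierKernel (q := cellFloor n) hw hw0
  have htame : Tame (detFunctional (fourierKernel (cellFloor n) w)) :=
    hpos.tame (measurable_fourierKernel measurable_cellFloor hw)
      (C := 1 / (2 * Real.pi) * ∫ t, w t)
      (mul_nonneg (by positivity) (integral_nonneg hw0)) fun x => by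
        rw [fourierKernel_self, Complex.ofReal_re]
  rw [← sum_indicator_cell hn,
    IsCellFunctional.sumIntegral_cells hn _ htame (isCellFunctional_detFunctional w)]
  obtain ⟨k, x, rfl⟩ := exists_values_eq s
  set Y := Finset.Ico (-(m * n : ℤ)) (m * n)
  refine (hpos.sum_det_nonneg (G := Y) (h := 1 / n) (by positivity) x (fun u => (u : ℝ) / n)
    (posDef_one_sub_gram hn hw hε hw1 _ Subtype.val_injective)).trans_eq ?_
  -- Subsets of the index type `Y` correspond to the subsets of `Y` in ℤ.
  refine Finset.sum_bij (fun Z _ => Z.map (Function.Embedding.subtype _)) ?_ ?_ ?_ ?_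
  · intro Z _
    rw [Finset.mem_powerset]
    intro u hu
    obtain ⟨v, -, rfl⟩ := Finset.mem_map.1 hu
    exact v.2
  · intro Z _ Z' _ h
    exact Finset.map_injective _ h
  · intro Z hZ
    refine ⟨Z.subtype (· ∈ Y), Finset.mem_univ _, ?_⟩
    rw [Finset.subtype_map]
    exact Finset.filter_true_of_mem fun u hu => Finset.mem_powerset.1 hZ hu
  · intro Z _
    rw [Finset.card_map, Finset.map_val, Multiset.map_map]
    rfl

end lattice

end FermionProcess

namespace FermionProcess

open Filter Topology

/-! ### Passage to the limit, and consistency of the Janossy densities -/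

section limit

variable {khat : ℝ → ℝ}

/-- Band-limited approximations of a symbol, bounded away from `1`. -/
noncomputable def cutoff (khat : ℝ → ℝ) (n : ℕ) (t : ℝ) : ℝ :=
  (1 - 1 / (n + 1 : ℝ)) * (Set.Ioc (-(Real.pi * n)) (Real.pi * n)).indicator khat t

lemma one_sub_inv_mem (n : ℕ) : 0 ≤ 1 - 1 / (n + 1 : ℝ) ∧ 1 - 1 / (n + 1 : ℝ) ≤ 1 := by
  have h : 1 / (n + 1 : ℝ) ≤ 1 := by
    rw [div_le_one (by positivity)]
    have : (0 : ℝ) ≤ n := Nat.cast_nonneg _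
    linarith
  have h' : 0 ≤ 1 / (n + 1 : ℝ) := by positivity
  exact ⟨by linarith, by linarith⟩

lemma integrable_cutoff (hint : Integrable khat) (n : ℕ) : Integrable (cutoff khat n) :=
  (hint.indicator measurableSet_Ioc).const_mul _

lemma cutoff_nonneg (h0 : ∀ t, 0 ≤ khat t) (n : ℕ) (t : ℝ) : 0 ≤ cutoff khat n t :=
  mul_nonneg (one_sub_inv_mem n).1 (Set.indicator_nonneg (fun t _ => h0 t) t)

lemma cutoff_le (h0 : ∀ t, 0 ≤ khat t) (n : ℕ) (t : ℝ) : cutoff khat n t ≤ khat t := by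
  calc cutoff khat n t ≤ 1 * (Set.Ioc (-(Real.pi * n)) (Real.pi * n)).indicator khat t :=
        mul_le_mul_of_nonneg_right (one_sub_inv_mem n).2 (Set.indicator_nonneg (fun t _ => h0 t) t)
    _ ≤ khat t := by
        rw [one_mul]
        exact Set.indicator_le_self' (fun _ _ => h0 _) t

lemma cutoff_le_indicator (h1 : ∀ t, khat t ≤ 1) (n : ℕ) (t : ℝ) :
    cutoff khat n t ≤ (1 - 1 / (n + 1 : ℝ)) *
      (Set.Ioc (-(Real.pi * n)) (Real.pi * n)).indicator 1 t :=
  mul_le_mul_of_nonneg_left (Set.indicator_le_indicator (h1 t)) (one_sub_inv_mem n).1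

lemma tendsto_cutoff (khat : ℝ → ℝ) (t : ℝ) :
    Tendsto (fun n => cutoff khat n t) atTop (𝓝 (khat t)) := by
  have h1 : Tendsto (fun n : ℕ => (1 - 1 / (n + 1 : ℝ)) * khat t) atTop (𝓝 (khat t)) := by
    have := (tendsto_const_nhds (x := (1 : ℝ))).sub tendsto_one_div_add_atTop_nhds_zero_nat
    simpa using this.mul_const (khat t)
  refine h1.congr' ?_
  have h2 : Tendsto (fun n : ℕ => Real.pi * n) atTop atTop :=
    tendsto_natCast_atTop_atTop.const_mul_atTop Real.pi_pos
  filter_upwards [h2.eventually_gt_atTop |t|] with n hn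
  have : t ∈ Set.Ioc (-(Real.pi * n)) (Real.pi * n) :=
    ⟨(abs_lt.1 hn).1, (abs_lt.1 hn).2.le⟩
  simp [cutoff, this]

lemma tendsto_cellFloor (x : ℝ) : Tendsto (fun n => cellFloor n x) atTop (𝓝 x) := by
  have h1 : Tendsto (fun n : ℕ => x - 1 / (n : ℝ)) atTop (𝓝 x) := by
    simpa using (tendsto_const_nhds (x := x)).sub tendsto_one_div_atTop_nhds_zero_nat
  refine tendsto_of_tendsto_of_tendsto_of_le_of_le' h1 tendsto_const_nhds ?_ ?_
  · filter_upwards [eventually_gt_atTop 0] with n hn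
    have hn' : (0 : ℝ) < n := by exact_mod_cast hn
    rw [cellFloor, le_div_iff₀ hn']
    have := Int.lt_floor_add_one ((n : ℝ) * x)
    have h : (x - 1 / n) * n = n * x - 1 := by field_simp
    rw [h]
    linarith
  · filter_upwards [eventually_gt_atTop 0] with n hn
    have hn' : (0 : ℝ) < n := by exact_mod_cast hn
    rw [cellFloor, div_le_iff₀ hn', mul_comm x]
    exact Int.floor_le _

lemma tendsto_fourierKernel (hint : Integrable khat) (h0 : ∀ t, 0 ≤ khat t) (x y : ℝ) :
    Tendsto (fun n => fourierKernel (cellFloor n) (cutoff khat n) x y) atTop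
      (𝓝 (fourierKernel id khat x y)) := by
  refine Tendsto.const_mul _ ?_
  refine tendsto_integral_of_dominated_convergence khat
    (fun n => (integrable_exp_mul (integrable_cutoff hint n) _).aestronglyMeasurable) hint
    (fun n => Eventually.of_forall fun t => ?_) (Eventually.of_forall fun t => ?_)
  · rw [norm_mul, norm_exp_neg_I_mul, one_mul, Complex.norm_real, Real.norm_eq_abs,
      abs_of_nonneg (cutoff_nonneg h0 n t)]
    exact cutoff_le h0 n t
  · refine Tendsto.mul ?_ ((Complex.continuous_ofReal.tendsto _).comp (tendsto_cutoff khat t))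
    have h : Continuous fun a : ℝ => Complex.exp (-(Complex.I * (a : ℂ) * t)) := by fun_prop
    exact (h.tendsto _).comp ((tendsto_cellFloor x).sub (tendsto_cellFloor y))

lemma tendsto_detFunctional {κ : ℕ → ℝ → ℝ → ℂ} {κ' : ℝ → ℝ → ℂ}
    (h : ∀ x y, Tendsto (fun n => κ n x y) atTop (𝓝 (κ' x y))) (s : Multiset ℝ) :
    Tendsto (fun n => detFunctional (κ n) s) atTop (𝓝 (detFunctional κ' s)) := by
  have hM : Tendsto (fun n => gram (κ n) s.toList.get) atTop (𝓝 (gram κ' s.toList.get)) :=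
    tendsto_pi_nhds.2 fun a => tendsto_pi_nhds.2 fun b => h _ _
  have hc : Continuous fun M : Matrix (Fin s.toList.length) (Fin s.toList.length) ℂ => M.det.re :=
    Complex.continuous_re.comp (Continuous.matrix_det continuous_id)
  exact (hc.tendsto _).comp hM

/-- The Janossy functional of the window `[-m, m)`. -/
noncomputable def janossy (khat : ℝ → ℝ) (m : ℕ) : Multiset ℝ → ℝ :=
  sumIntegral (-(Set.Ico (-(m : ℝ)) m).indicator 1) (detFunctional (fourierKernel id khat))

lemma integrable_window (m : ℕ) :
    Integrable ((Set.Ico (-(m : ℝ)) m).indicator (1 : ℝ → ℝ)) :=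
  integrable_indicator_one measurableSet_Ico (by simp)

lemma tame_detFunctional (hint : Integrable khat) (h0 : ∀ t, 0 ≤ khat t) :
    Tame (detFunctional (fourierKernel id khat)) :=
  (isPosKernel_fourierKernel hint h0).tame (measurable_fourierKernel measurable_id hint)
    (C := 1 / (2 * Real.pi) * ∫ t, khat t)
    (mul_nonneg (by positivity) (integral_nonneg h0)) fun x => by
      rw [fourierKernel_self, Complex.ofReal_re]

lemma tame_janossy (hint : Integrable khat) (h0 : ∀ t, 0 ≤ khat t) (m : ℕ) :
    Tame (janossy khat m) :=
  (tame_detFunctional hint h0).sumIntegral (integrable_window m).neg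

/-- Nonnegativity passes from the lattice to the limit. The cut-off symbols lie below k̂, so the
diagonals, and with them the determinants, obey one bound for all n. The slack 1/(n+1) supplies the
strict positivity required on each lattice. -/
theorem janossy_nonneg (hint : Integrable khat) (h0 : ∀ t, 0 ≤ khat t) (h1 : ∀ t, khat t ≤ 1)
    (m : ℕ) (s : Multiset ℝ) : 0 ≤ janossy khat m s := by
  have hpos (n : ℕ) := isPosKernel_fourierKernel (q := cellFloor n) (integrable_cutoff hint n)
    (cutoff_nonneg h0 n)
  have hlim := tendsto_sumIntegral (integrable_window m).neg
    (F := fun n => detFunctional (fourierKernel (cellFloor n) (cutoff khat n)))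
    (C := 1 / (2 * Real.pi) * ∫ t, khat t)
    (fun n => measurableOnFamilies_detFunctional
      (measurable_fourierKernel measurable_cellFloor (integrable_cutoff hint n)))
    (fun n s => by
      rw [abs_of_nonneg ((hpos n).detFunctional_nonneg s)]
      refine (hpos n).detFunctional_le (fun x => ?_) s
      rw [fourierKernel_self, Complex.ofReal_re]
      exact mul_le_mul_of_nonneg_left
        (integral_mono (integrable_cutoff hint n) hint (cutoff_le h0 n)) (by positivity))
    (tendsto_detFunctional (tendsto_fourierKernel hint h0)) s
  refine ge_of_tendsto hlim ?_
  filter_upwards [eventually_gt_atTop 0] with n hn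
  exact sumIntegral_lattice_nonneg hn (integrable_cutoff hint n) (cutoff_nonneg h0 n)
    (ε := 1 / (n + 1 : ℝ)) (by positivity) (cutoff_le_indicator h1 n) m s

lemma janossy_zero (khat : ℝ → ℝ) : janossy khat 0 = detFunctional (fourierKernel id khat) := by
  funext s
  have : (-(Set.Ico (-((0 : ℕ) : ℝ)) ((0 : ℕ) : ℝ)).indicator (1 : ℝ → ℝ)) = 0 := by
    ext
    simp
  rw [janossy, this, sumIntegral_zero]

lemma janossy_of_not_nodup (m : ℕ) {s : Multiset ℝ} (hs : ¬ s.Nodup) : janossy khat m s = 0 := by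
  have h (t : Multiset ℝ) : detFunctional (fourierKernel id khat) (s + t) = 0 :=
    detFunctional_of_not_nodup fun h => hs (Multiset.nodup_of_le (Multiset.le_add_right s t) h)
  simp [janossy, sumIntegral, h]

/-- The `m`-th shell `[-(m+1), m+1) \ [-m, m)`. -/
def shell (m : ℕ) : Set ℝ := Set.Ico (-((m + 1 : ℕ) : ℝ)) ((m + 1 : ℕ) : ℝ) \ Set.Ico (-(m : ℝ)) m

lemma window_subset (m : ℕ) :
    Set.Ico (-(m : ℝ)) m ⊆ Set.Ico (-((m + 1 : ℕ) : ℝ)) ((m + 1 : ℕ) : ℝ) := by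
  intro x hx
  push_cast
  exact ⟨by linarith [hx.1], by linarith [hx.2]⟩

lemma measurableSet_shell (m : ℕ) : MeasurableSet (shell m) :=
  measurableSet_Ico.diff measurableSet_Ico

lemma volume_shell_ne_top (m : ℕ) : volume (shell m) ≠ ∞ :=
  ne_top_of_le_ne_top (by simp) (measure_mono Set.sdiff_subset)

lemma indicator_window_succ (m : ℕ) :
    (Set.Ico (-((m + 1 : ℕ) : ℝ)) ((m + 1 : ℕ) : ℝ)).indicator (1 : ℝ → ℝ) =
      (Set.Ico (-(m : ℝ)) m).indicator 1 + (shell m).indicator 1 := by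
  funext x
  by_cases hx : x ∈ Set.Ico (-(m : ℝ)) m
  · have hx' := window_subset m hx
    rw [Pi.add_apply, Set.indicator_of_mem hx, Set.indicator_of_mem hx',
      Set.indicator_of_notMem (fun h => h.2 hx), add_zero]
  · by_cases hx' : x ∈ Set.Ico (-((m + 1 : ℕ) : ℝ)) ((m + 1 : ℕ) : ℝ)
    · rw [Pi.add_apply, Set.indicator_of_notMem hx, Set.indicator_of_mem hx',
        Set.indicator_of_mem (show x ∈ shell m from ⟨hx', hx⟩), zero_add]
    · rw [Pi.add_apply, Set.indicator_of_notMem hx, Set.indicator_of_notMem hx',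
        Set.indicator_of_notMem (fun h => hx' h.1), zero_add]

/-- Consistency is the identity of weights 1_shell - 1_{W_{m+1}} = -1_{W_m}, with W_m = [-m, m). -/
lemma sumIntegral_shell_janossy (hint : Integrable khat) (h0 : ∀ t, 0 ≤ khat t) (m : ℕ)
    (s : Multiset ℝ) :
    sumIntegral ((shell m).indicator 1) (janossy khat (m + 1)) s = janossy khat m s := by
  rw [janossy, janossy, (tame_detFunctional hint h0).sumIntegral_sumIntegral
    (integrable_indicator_one (measurableSet_shell m) (volume_shell_ne_top m))
    (integrable_window (m + 1)).neg, indicator_window_succ]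
  congr 1
  abel

/-- The weights 1_W and -1_W cancel: integrating the Janossy densities over the window returns the
correlation functions. -/
lemma sumIntegral_window_janossy (hint : Integrable khat) (h0 : ∀ t, 0 ≤ khat t) (m : ℕ)
    (s : Multiset ℝ) :
    sumIntegral ((Set.Ico (-(m : ℝ)) m).indicator 1) (janossy khat m) s =
      detFunctional (fourierKernel id khat) s := by
  rw [janossy, (tame_detFunctional hint h0).sumIntegral_sumIntegral (integrable_window m)
    (integrable_window m).neg, add_neg_cancel, sumIntegral_zero]

end limit

end FermionProcess

namespace FermionProcess

open ProbabilityTheory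

/-! ### Extension of consistent densities to a law on sequences of finite families -/

/-- Finite sequences of real numbers: a length and an infinite sequence, of which only an initial
segment matters. -/
abbrev State : Type := ℕ × (ℕ → ℝ)

/-- The points of a finite sequence. -/
def State.points (t : State) : Multiset ℝ := values fun i : Fin t.1 => t.2 i

section measurability

lemma values_eq_sum {ι α : Type*} [Fintype ι] (x : ι → α) : values x = ∑ i, {x i} := by
  rw [values, Finset.sum, ← Multiset.sum_map_singleton (Multiset.map x Finset.univ.val),
    Multiset.map_map]
  rfl

lemma values_sigma {ι α : Type*} {κ : ι → Type*} [Fintype ι] [∀ i, Fintype (κ i)]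
    (f : ∀ i, κ i → α) : values (fun p : Σ i, κ i => f p.1 p.2) = ∑ i, values (f i) := by
  rw [values_eq_sum, Fintype.sum_sigma]
  exact Finset.sum_congr rfl fun i _ => (values_eq_sum _).symm

lemma MeasurableOnFamilies.comp_points {β : Type*} [MeasurableSpace β] {F : Multiset ℝ → β}
    (hF : MeasurableOnFamilies F) {Ω : Type*} [MeasurableSpace Ω] {k n : ℕ}
    {p : Ω → Fin k → ℝ} (hp : Measurable p) {z : Fin n → Ω → State} (hz : ∀ i, Measurable (z i)) :
    Measurable fun ω => F (values (p ω) + ∑ i, (z i ω).points) := by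
  have h1 : Measurable fun q : (Fin n → ℕ) × (Fin k → ℝ) × (Fin n → ℕ → ℝ) =>
      F (values q.2.1 + ∑ i, State.points (q.1 i, q.2.2 i)) := by
    -- The vectors of lengths form a countable space; once they are fixed, the union is a family of
    -- fixed size.
    refine measurable_from_prod_countable_right fun N => ?_
    have h2 (q : (Fin k → ℝ) × (Fin n → ℕ → ℝ)) : ∑ i, State.points (N i, q.2 i) =
        values (fun p : Σ i : Fin n, Fin (N i) => q.2 p.1 p.2) :=
      (values_sigma fun i (j : Fin (N i)) => q.2 i j).symm
    simp only [h2]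
    refine hF.comp_values_add measurable_fst (measurable_pi_lambda _ fun a => ?_)
    exact (measurable_pi_apply _).comp ((measurable_pi_apply _).comp measurable_snd)
  refine h1.comp (f := fun ω => (fun i => (z i ω).1, p ω, fun i => (z i ω).2)) ?_
  refine Measurable.prodMk (measurable_pi_lambda _ fun i => (hz i).fst) (hp.prodMk ?_)
  exact measurable_pi_lambda _ fun i => (hz i).snd

lemma MeasurableOnFamilies.comp_sum_points {β : Type*} [MeasurableSpace β] {F : Multiset ℝ → β}
    (hF : MeasurableOnFamilies F) {Ω : Type*} [MeasurableSpace Ω] {n : ℕ}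
    {z : Fin n → Ω → State} (hz : ∀ i, Measurable (z i)) :
    Measurable fun ω => F (∑ i, (z i ω).points) := by
  have := hF.comp_points (measurable_const (a := (Fin.elim0 : Fin 0 → ℝ))) hz
  simpa [values_empty] using this

lemma MeasurableOnFamilies.comp_add_point {β : Type*} [MeasurableSpace β] {F : Multiset ℝ → β}
    (hF : MeasurableOnFamilies F) {Ω : Type*} [MeasurableSpace Ω] {k : ℕ}
    {p : Ω → Fin k → ℝ} (hp : Measurable p) {z : Ω → State} (hz : Measurable z) :
    Measurable fun ω => F (values (p ω) + (z ω).points) := by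
  have := hF.comp_points hp (n := 1) (z := fun _ => z) fun _ => hz
  simpa using this

end measurability

section extension

/-- Transition densities from finite-dimensional densities `p n`; where `p n` vanishes, no points
are added. -/
noncomputable def stepDensity (p : ℕ → Multiset ℝ → ℝ≥0∞) (n : ℕ) (s : Multiset ℝ) (t : State) :
    ℝ≥0∞ :=
  if p n s = 0 then ({t : State | t.1 = 0} : Set State).indicator 1 t
  else (p n s)⁻¹ * p (n + 1) (s + t.points)

variable {p : ℕ → Multiset ℝ → ℝ≥0∞} {σ : ℕ → Measure State}

lemma measurableSet_length_eq_zero : MeasurableSet {t : State | t.1 = 0} :=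
  measurable_fst (measurableSet_singleton 0)

lemma measurable_stepDensity (n : ℕ) {Ω : Type*}
    [MeasurableSpace Ω] {S : Ω → Multiset ℝ} {z : Ω → State} (hz : Measurable z)
    (h1 : Measurable fun ω => p n (S ω))
    (h2 : Measurable fun ω => p (n + 1) (S ω + (z ω).points)) :
    Measurable fun ω => stepDensity p n (S ω) (z ω) := by
  refine Measurable.ite (h1 (measurableSet_singleton 0)) ?_ (h1.inv.mul h2)
  exact (measurable_one.indicator measurableSet_length_eq_zero).comp hz

lemma lintegral_stepDensity (hpt : ∀ n s, p n s ≠ ∞)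
    (hps : ∀ n s, ∫⁻ t, p (n + 1) (s + t.points) ∂σ n = p n s)
    (hσ : ∀ n, σ n {t | t.1 = 0} = 1) (n : ℕ) (s : Multiset ℝ) :
    ∫⁻ t, stepDensity p n s t ∂σ n = 1 := by
  by_cases h : p n s = 0
  · simp only [stepDensity, h, if_true]
    rw [lintegral_indicator_one measurableSet_length_eq_zero, hσ]
  · simp only [stepDensity, h, if_false]
    rw [lintegral_const_mul' _ _ (ENNReal.inv_ne_top.2 h), hps, ENNReal.inv_mul_cancel h (hpt n s)]

/-- Multiplying by `p n s` clears the denominator. Where it vanishes, consistency makes `p (n + 1)`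
vanish almost everywhere on the extensions of `s`, so the arbitrary choice made there is invisible.
-/
lemma lintegral_stepDensity_mul
    (hpt : ∀ n s, p n s ≠ ∞) (hpm : ∀ n, MeasurableOnFamilies (p n))
    (hps : ∀ n s, ∫⁻ t, p (n + 1) (s + t.points) ∂σ n = p n s)
    (F : Multiset ℝ → ℝ≥0∞) (n : ℕ) (s : Multiset ℝ) :
    (∫⁻ t, stepDensity p n s t * F (s + t.points) ∂σ n) * p n s =
      ∫⁻ t, F (s + t.points) * p (n + 1) (s + t.points) ∂σ n := by
  by_cases h : p n s = 0
  · rw [h, mul_zero]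
    have hz := hps n s
    have hm : Measurable fun t : State => p (n + 1) (s + t.points) := by
      obtain ⟨k, x, rfl⟩ := exists_values_eq s
      exact (hpm (n + 1)).comp_add_point measurable_const measurable_id
    rw [h, lintegral_eq_zero_iff hm] at hz
    rw [eq_comm, lintegral_eq_zero_iff' ?_]
    · filter_upwards [hz] with t ht
      simp only [Pi.zero_apply] at ht ⊢
      rw [ht, mul_zero]
    · have : (fun t : State => F (s + t.points) * p (n + 1) (s + t.points)) =ᵐ[σ n] 0 := by
        filter_upwards [hz] with t ht
        simp only [Pi.zero_apply] at ht ⊢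
        rw [ht, mul_zero]
      exact aemeasurable_const.congr this.symm
  · simp only [stepDensity, h, if_false]
    simp_rw [mul_assoc]
    rw [lintegral_const_mul' _ _ (ENNReal.inv_ne_top.2 h), mul_comm, ← mul_assoc,
      ENNReal.mul_inv_cancel h (hpt n s), one_mul]
    simp_rw [mul_comm]

/-- Iterated integration over the first `n` shells. -/
noncomputable def iterIntegral (σ : ℕ → Measure State) : ℕ → (Multiset ℝ → ℝ≥0∞) → ℝ≥0∞
  | 0, F => F 0
  | n + 1, F => iterIntegral σ n fun s => ∫⁻ t, F (s + t.points) ∂σ n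

/-- Extension theorem: consistent densities define a probability measure on sequences. -/
theorem exists_measure_of_densities [∀ n, IsFiniteMeasure (σ n)]
    (hpt : ∀ n s, p n s ≠ ∞) (hpm : ∀ n, MeasurableOnFamilies (p n))
    (hps : ∀ n s, ∫⁻ t, p (n + 1) (s + t.points) ∂σ n = p n s)
    (hσ : ∀ n, σ n {t | t.1 = 0} = 1) (hp0 : p 0 0 = 1) :
    ∃ P : Measure (ℕ → State), IsProbabilityMeasure P ∧
      (∀ n (F : Multiset ℝ → ℝ≥0∞), MeasurableOnFamilies F →
        ∫⁻ t, F (∑ i : Fin n, (t i).points) ∂P = iterIntegral σ n fun s => F s * p n s) ∧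
      ∀ n (N : Set State), MeasurableSet N → σ n N = 0 → ∀ᵐ t ∂P, t n ∉ N := by
  -- Coordinate 0 of the trajectory is a dummy initial state, so shell i sits at coordinate i + 1;
  -- the final map shifts it away.
  let past (n : ℕ) (x : Finset.Iic n → State) : Multiset ℝ :=
    ∑ i : Fin n, (x ⟨i + 1, Finset.mem_Iic.2 i.2⟩).points
  have hpast {F : Multiset ℝ → ℝ≥0∞} (hF : MeasurableOnFamilies F) (n : ℕ) :
      Measurable fun x : Finset.Iic n → State => F (past n x) :=
    hF.comp_sum_points fun i => measurable_pi_apply _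
  have hpast' {F : Multiset ℝ → ℝ≥0∞} (hF : MeasurableOnFamilies F) (n : ℕ) :
      Measurable fun q : (Finset.Iic n → State) × State => F (past n q.1 + q.2.points) := by
    have := hF.comp_sum_points (n := n + 1) (Ω := (Finset.Iic n → State) × State)
      (z := Fin.snoc (α := fun _ => (Finset.Iic n → State) × State → State)
        (fun i : Fin n => fun q : (Finset.Iic n → State) × State =>
          q.1 ⟨i + 1, Finset.mem_Iic.2 i.2⟩) (fun q => q.2)) (fun i => by
        refine Fin.lastCases ?_ (fun i => ?_) i
        · simpa using measurable_snd
        · have : Measurable fun q : (Finset.Iic n → State) × State =>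
              q.1 ⟨i + 1, Finset.mem_Iic.2 i.2⟩ := (measurable_pi_apply _).comp measurable_fst
          simpa using this)
    simpa [Fin.sum_univ_castSucc] using this
  have hd (n : ℕ) : Measurable (Function.uncurry fun (x : Finset.Iic n → State) (t : State) =>
      stepDensity p n (past n x) t) :=
    measurable_stepDensity n measurable_snd ((hpast (hpm n) n).comp measurable_fst)
      (hpast' (hpm (n + 1)) n)
  let κ (n : ℕ) : Kernel (Finset.Iic n → State) State :=
    Kernel.withDensity (Kernel.const _ (σ n)) fun x t => stepDensity p n (past n x) t
  have hκ (n : ℕ) (x : Finset.Iic n → State) :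
      κ n x = (σ n).withDensity (stepDensity p n (past n x)) := by
    rw [Kernel.withDensity_apply _ (hd n), Kernel.const_apply]
  have hmk (n : ℕ) : IsMarkovKernel (κ n) := by
    refine ⟨fun x => ⟨?_⟩⟩
    rw [hκ, withDensity_apply _ MeasurableSet.univ, Measure.restrict_univ,
      lintegral_stepDensity hpt hps hσ]
  let x₀ : Finset.Iic 0 → State := fun _ => (0, fun _ => 0)
  have hlaw (n : ℕ) {g : (Finset.Iic (n + 1) → State) → ℝ≥0∞} (hg : Measurable g) :
      ∫⁻ x, g x ∂(Kernel.partialTraj (X := fun _ => State) κ 0 (n + 1) x₀) =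
      ∫⁻ x, ∫⁻ t, g (IicProdIoc (X := fun _ => State) n (n + 1)
        (x, MeasurableEquiv.piSingleton (X := fun _ => State) n t)) ∂(κ n x)
        ∂(Kernel.partialTraj (X := fun _ => State) κ 0 n x₀) := by
    rw [Kernel.partialTraj_succ_eq_comp (Nat.zero_le n), Kernel.lintegral_comp _ _ _ hg]
    congr 1
    funext x
    have hm : Measurable fun a => g (IicProdIoc (X := fun _ => State) n (n + 1) a) :=
      hg.comp (measurable_IicProdIoc (X := fun _ => State))
    have hm' : Measurable fun b => g (IicProdIoc (X := fun _ => State) n (n + 1) (x, b)) :=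
      hm.comp measurable_prodMk_left
    rw [Kernel.partialTraj_succ_self, Kernel.lintegral_map _ (measurable_IicProdIoc (X := fun _ => State)) _ hg,
      Kernel.lintegral_id_prod hm,
      Kernel.lintegral_map _ (MeasurableEquiv.measurable _) _ hm']
  have hpastsucc (n : ℕ) (x : Finset.Iic n → State) (t : State) :
      past (n + 1) (IicProdIoc (X := fun _ => State) n (n + 1)
        (x, MeasurableEquiv.piSingleton (X := fun _ => State) n t)) = past n x + t.points := by
    simp only [past, Fin.sum_univ_castSucc]
    congr 1
    · refine Finset.sum_congr rfl fun i _ => ?_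
      have : (i : ℕ) + 1 ≤ n := i.2
      simp [IicProdIoc, this]
    · simp [IicProdIoc, MeasurableEquiv.piSingleton]
  -- The accumulated points after n steps have density `p n`. The step from n to n + 1 applies the
  -- induction hypothesis to the conditional expectation of `F` given the past.
  have hmain (n : ℕ) : ∀ F : Multiset ℝ → ℝ≥0∞, MeasurableOnFamilies F →
      ∫⁻ x, F (past n x) ∂(Kernel.partialTraj (X := fun _ => State) κ 0 n x₀) =
        iterIntegral σ n fun s => F s * p n s := by
    induction n with
    | zero =>
      intro F hF
      rw [Kernel.partialTraj_self, Kernel.id_apply, lintegral_dirac' _ (hpast hF 0)]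
      simp [past, iterIntegral, hp0]
    | succ n ih =>
      intro F hF
      rw [hlaw n (hpast hF (n + 1))]
      simp_rw [hpastsucc, hκ]
      have h1 (x : Finset.Iic n → State) : ∫⁻ t, F (past n x + t.points)
          ∂((σ n).withDensity (stepDensity p n (past n x))) =
          ∫⁻ t, stepDensity p n (past n x) t * F (past n x + t.points) ∂σ n :=
        lintegral_withDensity_eq_lintegral_mul _ ((hd n).comp measurable_prodMk_left)
          ((hpast' hF n).comp measurable_prodMk_left)
      simp_rw [h1]
      rw [ih (fun s => ∫⁻ t, stepDensity p n s t * F (s + t.points) ∂σ n), iterIntegral]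
      · congr 1
        funext s
        exact lintegral_stepDensity_mul hpt hpm hps F n s
      · intro k
        refine Measurable.lintegral_prod_right' (f := fun q : (Fin k → ℝ) × State =>
          stepDensity p n (values q.1) q.2 * F (values q.1 + q.2.points)) ?_
        exact (measurable_stepDensity n measurable_snd
          ((hpm n).comp_values measurable_fst)
          ((hpm (n + 1)).comp_add_point measurable_fst measurable_snd)).mul
          (hF.comp_add_point measurable_fst measurable_snd)
  have hshift : Measurable fun (x : ℕ → State) (n : ℕ) => x (n + 1) :=
    measurable_pi_lambda _ fun n => measurable_pi_apply _
  refine ⟨(Kernel.traj (X := fun _ => State) κ 0 x₀).map fun x n => x (n + 1), ?_, ?_, ?_⟩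
  · exact Measure.isProbabilityMeasure_map hshift.aemeasurable
  · intro n F hF
    rw [lintegral_map (hF.comp_sum_points fun i => measurable_pi_apply _) hshift, ← hmain n F hF,
      ← Kernel.traj_map_frestrictLe_apply,
      lintegral_map (hpast hF n) (Preorder.measurable_frestrictLe n)]
    rfl
  · intro n N hN h0
    refine (ae_map_iff (p := fun t : ℕ → State => t n ∉ N) hshift.aemeasurable
      (measurable_pi_apply n hN).compl).2 ?_
    rw [ae_iff]
    simp only [not_not]
    have h1 : MeasurableSet {x : Finset.Iic (n + 1) → State |
        x ⟨n + 1, Finset.mem_Iic.2 le_rfl⟩ ∈ N} := measurable_pi_apply _ hN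
    have h2 : (Kernel.traj (X := fun _ => State) κ 0 x₀) {x | x (n + 1) ∈ N} =
        Kernel.partialTraj (X := fun _ => State) κ 0 (n + 1) x₀
          {x | x ⟨n + 1, Finset.mem_Iic.2 le_rfl⟩ ∈ N} := by
      rw [← Kernel.traj_map_frestrictLe_apply,
        Measure.map_apply (Preorder.measurable_frestrictLe _) h1]
      rfl
    rw [h2, ← lintegral_indicator_one h1, hlaw n (measurable_one.indicator h1)]
    refine (lintegral_congr fun x => ?_).trans lintegral_zero
    have h3 (t : State) : Set.indicator {x : Finset.Iic (n + 1) → State |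
        x ⟨n + 1, Finset.mem_Iic.2 le_rfl⟩ ∈ N} (1 : (Finset.Iic (n + 1) → State) → ℝ≥0∞)
        (IicProdIoc (X := fun _ => State) n (n + 1)
          (x, MeasurableEquiv.piSingleton (X := fun _ => State) n t)) =
        N.indicator 1 t := by
      by_cases ht : t ∈ N <;>
        simp [IicProdIoc, MeasurableEquiv.piSingleton, ht]
    simp_rw [h3]
    rw [lintegral_indicator_one hN, hκ]
    -- Every transition law has a density with respect to `σ n`, so it charges no null set.
    exact withDensity_absolutelyContinuous _ _ h0

end extension

end FermionProcess

namespace FermionProcess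

open ProbabilityTheory

/-! ### The reference measure on finite families in a set -/

section refMeasure

/-- Extension of a finite family by zeros. -/
noncomputable def pad {n : ℕ} (x : Fin n → ℝ) (i : ℕ) : ℝ := if h : i < n then x ⟨i, h⟩ else 0

lemma measurable_pad {n : ℕ} : Measurable (pad : (Fin n → ℝ) → ℕ → ℝ) := by
  refine measurable_pi_lambda _ fun i => ?_
  by_cases h : i < n
  · simpa [pad, h] using measurable_pi_apply _
  · simp [pad, h]

lemma points_pad {n : ℕ} (x : Fin n → ℝ) : State.points (n, pad x) = values x := by
  simp [State.points, pad]

/-- The measure `∑ₙ 1/n! Leb|_C^n` on finite sequences. -/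
noncomputable def refMeasure (C : Set ℝ) : Measure State :=
  Measure.sum fun n : ℕ => ENNReal.ofReal (n.factorial : ℝ)⁻¹ •
    ((volume.restrict (Set.univ.pi fun _ : Fin n => C)).map fun x => (n, pad x))

lemma measurable_mk_pad (n : ℕ) : Measurable fun x : Fin n → ℝ => ((n, pad x) : State) :=
  measurable_const.prodMk measurable_pad

lemma lintegral_refMeasure (C : Set ℝ) {F : State → ℝ≥0∞} (hF : Measurable F) :
    ∫⁻ t, F t ∂refMeasure C = ∑' n : ℕ, ENNReal.ofReal (n.factorial : ℝ)⁻¹ *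
      ∫⁻ x in Set.univ.pi fun _ : Fin n => C, F (n, pad x) := by
  rw [refMeasure, lintegral_sum_measure]
  congr 1
  funext n
  rw [lintegral_smul_measure, lintegral_map hF (measurable_mk_pad n), smul_eq_mul]

variable {C : Set ℝ}

/-- This links the real-valued calculus of `sumIntegral`, where signed weights are essential, to the
lower integrals of the extension theorem; it needs `F` nonnegative. -/
lemma lintegral_refMeasure_ofReal (hC : MeasurableSet C) (hv : volume C ≠ ∞)
    {F : Multiset ℝ → ℝ} (hF : Tame F) (hF0 : ∀ s, 0 ≤ F s) (s : Multiset ℝ) :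
    ∫⁻ t, ENNReal.ofReal (F (s + t.points)) ∂refMeasure C =
      ENNReal.ofReal (sumIntegral (C.indicator 1) F s) := by
  have hi := integrable_indicator_one hC hv
  have hm : Measurable fun t : State => ENNReal.ofReal (F (s + t.points)) := by
    obtain ⟨k, x, rfl⟩ := exists_values_eq s
    exact (hF.measurable.comp_add_point measurable_const measurable_id).ennreal_ofReal
  rw [lintegral_refMeasure C hm, sumIntegral, ENNReal.ofReal_tsum_of_nonneg _ (hF.summable hi s)]
  · congr 1
    funext n
    rw [ENNReal.ofReal_mul (by positivity)]
    congr 1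
    have hp : MeasurableSet (Set.univ.pi fun _ : Fin n => C) :=
      MeasurableSet.univ_pi fun _ => hC
    have heq (x : Fin n → ℝ) : (∏ i, C.indicator (1 : ℝ → ℝ) (x i)) * F (s + values x) =
        (Set.univ.pi fun _ : Fin n => C).indicator (fun x => F (s + values x)) x := by
      by_cases hx : x ∈ Set.univ.pi fun _ : Fin n => C
      · have : ∀ i, C.indicator (1 : ℝ → ℝ) (x i) = 1 := fun i => by
          simp [Set.mem_univ_pi.1 hx i]
        rw [Set.indicator_of_mem hx]
        simp [this]
      · rw [Set.indicator_of_notMem hx]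
        rw [Set.mem_univ_pi] at hx
        push Not at hx
        obtain ⟨i, hi⟩ := hx
        rw [Finset.prod_eq_zero (Finset.mem_univ i) (Set.indicator_of_notMem hi _), zero_mul]
    have hint := hF.integrable hi s (Fin n)
    simp_rw [heq] at hint ⊢
    rw [integral_indicator hp, ofReal_integral_eq_lintegral_ofReal
      ((integrable_indicator_iff hp).1 hint) (Filter.Eventually.of_forall fun x => hF0 _)]
    simp_rw [points_pad]
  · intro n
    refine mul_nonneg (by positivity) (integral_nonneg fun x => mul_nonneg ?_ (hF0 _))
    exact Finset.prod_nonneg fun i _ => Set.indicator_nonneg (fun _ _ => zero_le_one) _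

lemma tame_one : Tame fun _ => 1 :=
  ⟨fun _ => measurable_const, 1, 1, zero_le_one, zero_le_one, fun s => by simp⟩

lemma isFiniteMeasure_refMeasure (hC : MeasurableSet C) (hv : volume C ≠ ∞) :
    IsFiniteMeasure (refMeasure C) := by
  refine ⟨?_⟩
  have := lintegral_refMeasure_ofReal hC hv tame_one (fun _ => zero_le_one) 0
  rw [ENNReal.ofReal_one, lintegral_one] at this
  rw [this]
  exact ENNReal.ofReal_lt_top

lemma refMeasure_length_eq_zero (C : Set ℝ) : refMeasure C {t | t.1 = 0} = 1 := by
  rw [← lintegral_indicator_one measurableSet_length_eq_zero,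
    lintegral_refMeasure C (measurable_one.indicator measurableSet_length_eq_zero),
    tsum_eq_single 0]
  · simp [volume_pi]
  · intro n hn
    simp [hn]

lemma measurableSet_points_subset (hC : MeasurableSet C) :
    MeasurableSet {t : State | ∀ i, i < t.1 → t.2 i ∈ C} := by
  rw [Set.ofPred_forall]
  refine MeasurableSet.iInter fun i => ?_
  have h1 : MeasurableSet {t : State | ¬ i < t.1} :=
    measurable_fst (MeasurableSet.of_discrete (s := {k : ℕ | ¬ i < k}))
  have h2 : MeasurableSet {t : State | t.2 i ∈ C} :=
    ((measurable_pi_apply i).comp measurable_snd) hC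
  have : {t : State | i < t.1 → t.2 i ∈ C} = {t : State | ¬ i < t.1} ∪ {t | t.2 i ∈ C} := by
    ext t
    simp [imp_iff_not_or]
  rw [this]
  exact h1.union h2

lemma refMeasure_points_not_subset (hC : MeasurableSet C) :
    refMeasure C {t : State | ∀ i, i < t.1 → t.2 i ∈ C}ᶜ = 0 := by
  have hm := (measurableSet_points_subset hC).compl
  rw [← lintegral_indicator_one hm, lintegral_refMeasure C (measurable_one.indicator hm),
    ENNReal.tsum_eq_zero]
  intro n
  refine mul_eq_zero_of_right _ ?_
  rw [setLIntegral_congr_fun (g := fun _ => 0) (MeasurableSet.univ_pi fun _ => hC)]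
  · simp
  · intro x hx
    refine Set.indicator_of_notMem ?_ _
    simp only [Set.mem_compl_iff, Set.mem_ofPred_eq, not_not]
    intro i hi
    simpa [pad, hi] using Set.mem_univ_pi.1 hx ⟨i, hi⟩

end refMeasure

/-! ### Measurability of counting functions on configurations -/

section configurations

lemma measurable_configuration {Ω : Type*} [MeasurableSpace Ω] {c : Ω → Configuration ℝ}
    (h : ∀ A : Set ℝ, MeasurableSet A →
      Measurable fun ω => (((c ω).1 ∩ A).encard : ℝ≥0∞)) : Measurable c := by
  rw [measurable_iff_le_map]
  refine iSup_le fun A => iSup_le fun hA => ?_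
  rintro _ ⟨V, -, rfl⟩
  change MeasurableSet (c ⁻¹' ((fun S : Configuration ℝ => (S.1 ∩ A).encard) ⁻¹' V))
  -- Counts take countably many values, so the preimage of any set of values is a countable union of
  -- level sets.
  have : c ⁻¹' ((fun S : Configuration ℝ => (S.1 ∩ A).encard) ⁻¹' V) =
      ⋃ k ∈ V, {ω | (((c ω).1 ∩ A).encard : ℝ≥0∞) = (k : ℝ≥0∞)} := by
    ext ω
    simp
  rw [this]
  exact MeasurableSet.biUnion (Set.to_countable V) fun k _ => h A hA (measurableSet_singleton _)

lemma measurable_encard_inter {A : Set ℝ} (hA : MeasurableSet A) :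
    Measurable fun S : Configuration ℝ => ((S.1 ∩ A).encard : ℝ≥0∞) := by
  have h1 : @Measurable _ _ _ ⊤ fun S : Configuration ℝ => (S.1 ∩ A).encard := by
    rw [measurable_iff_comap_le]
    exact le_iSup₂_of_le A hA le_rfl
  exact (@measurable_from_top _ _ _ ENat.toENNReal).comp h1

lemma window_mono {m n : ℕ} (h : m ≤ n) : Set.Ico (-(m : ℝ)) m ⊆ Set.Ico (-(n : ℝ)) n := by
  have : (m : ℝ) ≤ n := by exact_mod_cast h
  exact Set.Ico_subset_Ico (by linarith) this

lemma exists_mem_window (a : ℝ) : ∃ m : ℕ, a ∈ Set.Ico (-(m : ℝ)) m := by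
  obtain ⟨m, hm⟩ := exists_nat_gt |a|
  exact ⟨m, (abs_lt.1 hm).1.le, (abs_lt.1 hm).2⟩

lemma lt_of_mem_shell_of_mem_window {a : ℝ} {n m : ℕ} (hn : a ∈ shell n)
    (hm : a ∈ Set.Ico (-(m : ℝ)) m) : n < m := by
  by_contra h
  exact hn.2 (window_mono (not_lt.1 h) hm)

lemma iUnion_shell : ⋃ n, shell n = Set.univ := by
  classical
  refine Set.eq_univ_of_forall fun a => ?_
  have h := exists_mem_window a
  have h0 : Nat.find h ≠ 0 := by
    intro h0
    have := Nat.find_spec h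
    rw [h0] at this
    simp at this
  obtain ⟨n, hn⟩ := Nat.exists_eq_succ_of_ne_zero h0
  refine Set.mem_iUnion.2 ⟨n, ?_, Nat.find_min h (by omega)⟩
  have := Nat.find_spec h
  rwa [hn] at this

lemma pairwise_disjoint_shell : Pairwise (Function.onFun Disjoint shell) := by
  have key (m n : ℕ) (h : m < n) : Disjoint (shell m) (shell n) := by
    rw [Set.disjoint_left]
    exact fun a ha hb => hb.2 (window_mono h ha.1)
  intro m n hmn
  rcases lt_or_gt_of_ne hmn with h | h
  · exact key m n h
  · exact (key n m h).symm

lemma Configuration.countable (S : Configuration ℝ) : S.1.Countable := by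
  have : S.1 = ⋃ m : ℕ, S.1 ∩ Set.Icc (-(m : ℝ)) m := by
    rw [← Set.inter_iUnion]
    refine (Set.inter_eq_left.2 fun a _ => ?_).symm
    obtain ⟨m, hm⟩ := exists_mem_window a
    exact Set.mem_iUnion.2 ⟨m, hm.1, hm.2.le⟩
  rw [this]
  exact Set.countable_iUnion fun m => (S.2 _ isCompact_Icc).countable

lemma Configuration.finite_inter_shell (S : Configuration ℝ) (n : ℕ) :
    (S.1 ∩ shell n).Finite := by
  refine (S.2 (Set.Icc (-((n + 1 : ℕ) : ℝ)) ((n + 1 : ℕ) : ℝ)) isCompact_Icc).subset ?_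
  exact Set.inter_subset_inter_right _ fun a ha => ⟨ha.1.1, ha.1.2.le⟩

/-- The counting measures of configurations, as a kernel. -/
noncomputable def countKernel : Kernel (Configuration ℝ) ℝ where
  toFun S := Measure.count.restrict S.1
  measurable' := by
    refine Measure.measurable_of_measurable_coe _ fun A hA => ?_
    have (S : Configuration ℝ) : Measure.count.restrict S.1 A = ((S.1 ∩ A).encard : ℝ≥0∞) := by
      rw [Measure.restrict_apply hA, Set.inter_comm,
        Measure.count_apply ((Configuration.countable S).measurableSet.inter hA)]
    simp_rw [this]
    exact measurable_encard_inter hA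

lemma countKernel_apply (S : Configuration ℝ) {A : Set ℝ} (hA : MeasurableSet A) :
    countKernel S A = ((S.1 ∩ A).encard : ℝ≥0∞) := by
  change Measure.count.restrict S.1 A = _
  rw [Measure.restrict_apply hA, Set.inter_comm,
    Measure.count_apply ((Configuration.countable S).measurableSet.inter hA)]

/-- A locally finite configuration may be infinite. Restricting to one shell, and to the
configurations with exactly k points in it, gives countably many finite kernels with sum
`countKernel`; this is what makes integrals with parameters measurable. -/
instance : IsSFiniteKernel countKernel := by
  classical
  have hset (q : ℕ × ℕ) : MeasurableSet
      {S : Configuration ℝ | ((S.1 ∩ shell q.1).encard : ℝ≥0∞) = q.2} :=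
    measurable_encard_inter (measurableSet_shell q.1) (measurableSet_singleton _)
  let κ (q : ℕ × ℕ) : Kernel (Configuration ℝ) ℝ :=
    Kernel.piecewise (hset q) (countKernel.restrict (measurableSet_shell q.1)) 0
  have hκ (q : ℕ × ℕ) : IsFiniteKernel (κ q) := by
    refine ⟨⟨q.2, ENNReal.natCast_lt_top q.2, fun S => ?_⟩⟩
    rw [Kernel.piecewise_apply]
    split_ifs with h
    · rw [Kernel.restrict_apply, Measure.restrict_apply MeasurableSet.univ, Set.univ_inter,
        countKernel_apply S (measurableSet_shell q.1)]
      exact le_of_eq h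
    · simp
  have hsum : countKernel = Kernel.sum κ := by
    ext S A hA
    rw [Kernel.sum_apply, Measure.sum_apply _ hA, ENNReal.tsum_prod']
    have h1 (m : ℕ) : ∑' k : ℕ, κ (m, k) S A = countKernel S (A ∩ shell m) := by
      have hfin := (Configuration.finite_inter_shell S m).encard_eq_coe_toFinset_card
      rw [tsum_eq_single (Configuration.finite_inter_shell S m).toFinset.card]
      · rw [Kernel.piecewise_apply, if_pos, Kernel.restrict_apply, Measure.restrict_apply hA]
        simp only [Set.mem_ofPred_eq]
        rw [hfin]
        simp
      · intro k hk
        rw [Kernel.piecewise_apply, if_neg]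
        · simp
        · simp only [Set.mem_ofPred_eq]
          rw [hfin]
          simp only [ENat.toENNReal_coe, Nat.cast_inj]
          exact hk.symm
    simp_rw [h1]
    rw [← measure_iUnion, ← Set.inter_iUnion, iUnion_shell, Set.inter_univ]
    · exact fun m n hmn => (pairwise_disjoint_shell hmn).mono Set.inter_subset_right
        Set.inter_subset_right
    · exact fun m => hA.inter (measurableSet_shell m)
  rw [hsum]
  infer_instance

lemma lintegral_countKernel (S : Configuration ℝ) (f : ℝ → ℝ≥0∞) :
    ∫⁻ a, f a ∂countKernel S = ∑' a : S.1, f a := by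
  change ∫⁻ a in S.1, f a ∂Measure.count = _
  rw [lintegral_countable f (Configuration.countable S)]
  simp

lemma tsum_fin_succ_pi {α : Type*} {n : ℕ} (g : (Fin (n + 1) → α) → ℝ≥0∞) :
    ∑' x, g x = ∑' (a : α) (x : Fin n → α), g (Fin.cons a x) := by
  rw [← (Fin.consEquiv fun _ : Fin (n + 1) => α).tsum_eq, ENNReal.tsum_prod']
  rfl

/-- The first point is split off as an integral against `countKernel` and joins the parameters, so
the induction must allow an arbitrary parameter space. -/
lemma measurable_tsum_tuples (n : ℕ) : ∀ {Ω : Type} [MeasurableSpace Ω]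
    {c : Ω → Configuration ℝ} (_ : Measurable c) {f : Ω × (Fin n → ℝ) → ℝ≥0∞} (_ : Measurable f),
    Measurable fun ω => ∑' x : Fin n → (c ω).1, f (ω, fun i => x i) := by
  induction n with
  | zero =>
    intro Ω _ c hc f hf
    have (ω : Ω) : ∑' x : Fin 0 → (c ω).1, f (ω, fun i => x i) = f (ω, Fin.elim0) := by
      rw [tsum_eq_single Fin.elim0 fun x hx => absurd (Subsingleton.elim _ _) hx]
      congr 2
      exact Subsingleton.elim _ _
    simp_rw [this]
    exact hf.comp measurable_prodMk_right
  | succ n ih =>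
    intro Ω _ c hc f hf
    have h1 (ω : Ω) : ∑' x : Fin (n + 1) → (c ω).1, f (ω, fun i => x i) =
        ∫⁻ a, ∑' x : Fin n → (c ω).1, f (ω, Fin.cons a fun i => x i)
          ∂(countKernel.comap c hc ω) := by
      rw [Kernel.comap_apply, lintegral_countKernel,
        tsum_fin_succ_pi fun x : Fin (n + 1) → (c ω).1 => f (ω, fun i => x i)]
      congr 1
      funext a
      congr 1
      funext x
      congr 2
      funext i
      refine Fin.cases ?_ (fun i => ?_) i <;> simp
    simp_rw [h1]
    refine Measurable.lintegral_kernel_prod_right' (κ := countKernel.comap c hc)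
      (f := fun q : Ω × ℝ => ∑' x : Fin n → (c q.1).1, f (q.1, Fin.cons q.2 fun i => x i)) ?_
    refine ih (Ω := Ω × ℝ) (c := fun q => c q.1) (hc.comp measurable_fst)
      (f := fun r => f (r.1.1, Fin.cons r.1.2 r.2)) (hf.comp ?_)
    refine (measurable_fst.comp measurable_fst).prodMk (measurable_pi_lambda _ fun i => ?_)
    refine Fin.cases ?_ (fun i => ?_) i
    · have : Measurable fun q : (Ω × ℝ) × (Fin n → ℝ) => q.1.2 := by fun_prop
      simpa using this
    · have : Measurable fun q : (Ω × ℝ) × (Fin n → ℝ) => q.2 i := by fun_prop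
      simpa using this

lemma measurableSet_injective (n : ℕ) :
    MeasurableSet {x : Fin n → ℝ | Function.Injective x} := by
  have : {x : Fin n → ℝ | Function.Injective x} =
      ⋂ i, ⋂ j, ⋂ (_ : i ≠ j), {x : Fin n → ℝ | x i ≠ x j} := by
    ext x
    simp only [Set.mem_ofPred_eq, Set.mem_iInter]
    exact ⟨fun h i j hij hx => hij (h hx), fun h i j hx => by
      by_contra hij
      exact h i j hij hx⟩
  rw [this]
  refine MeasurableSet.iInter fun i => MeasurableSet.iInter fun j => MeasurableSet.iInter fun _ => ?_
  exact (measurableSet_eq_fun (measurable_pi_apply i) (measurable_pi_apply j)).compl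

lemma measurable_tupleCount {n : ℕ} {B : Set (Fin n → ℝ)} (hB : MeasurableSet B) :
    Measurable fun S : Configuration ℝ => Configuration.tupleCount B S := by
  have h (S : Configuration ℝ) : Configuration.tupleCount B S =
      ∑' x : Fin n → S.1, (B ∩ {x | Function.Injective x}).indicator 1 (fun i => (x i : ℝ)) := by
    have hval : Function.Injective fun (x : Fin n → S.1) (i : Fin n) => (x i : ℝ) :=
      fun x y hxy => funext fun i => Subtype.ext (congrFun hxy i)
    have himg : {x : Fin n → ℝ | x ∈ B ∧ Function.Injective x ∧ ∀ i, x i ∈ S.1} =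
        (fun (x : Fin n → S.1) (i : Fin n) => (x i : ℝ)) ''
          {x | (fun i => (x i : ℝ)) ∈ B ∩ {x | Function.Injective x}} := by
      ext x
      constructor
      · rintro ⟨hB, hx, hS⟩
        exact ⟨fun i => ⟨x i, hS i⟩, ⟨hB, hx⟩, rfl⟩
      · rintro ⟨y, ⟨hB, hy⟩, rfl⟩
        exact ⟨hB, hy, fun i => (y i).2⟩
    rw [Configuration.tupleCount, himg, hval.encard_image, ← ENNReal.tsum_set_one,
      tsum_subtype _ fun _ => (1 : ℝ≥0∞)]
    rfl
  simp_rw [h]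
  exact measurable_tsum_tuples n measurable_id (f := fun q =>
    (B ∩ {x | Function.Injective x}).indicator 1 q.2)
    ((measurable_one.indicator (hB.inter (measurableSet_injective n))).comp measurable_snd)

end configurations

end FermionProcess

namespace FermionProcess

/-! ### The point process and its correlation functions -/

section pointProcess

/-- The set of points of a finite family. -/
def ofMultiset (s : Multiset ℝ) : Configuration ℝ :=
  ⟨{a | a ∈ s}, fun _ _ => (s.finite_toSet).subset Set.inter_subset_left⟩

lemma measurable_encard_ofMultiset {D : Set ℝ} (hD : MeasurableSet D) :
    MeasurableOnFamilies fun s => (((ofMultiset s).1 ∩ D).encard : ℝ≥0∞) := by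
  classical
  intro k
  -- Each distinct value is counted at the first index where it occurs.
  have h (x : Fin k → ℝ) : (((ofMultiset (values x)).1 ∩ D).encard : ℝ≥0∞) =
      ∑ i : Fin k, {x : Fin k → ℝ | x i ∈ D ∧ ∀ j < i, x j ≠ x i}.indicator 1 x := by
    have himg : (ofMultiset (values x)).1 ∩ D = x ''
        (Finset.univ.filter fun i => x i ∈ D ∧ ∀ j < i, x j ≠ x i : Finset (Fin k)) := by
      ext a
      simp only [ofMultiset, Set.mem_inter_iff, Set.mem_ofPred_eq, mem_values, Finset.coe_filter,
        Finset.mem_univ, true_and, Set.mem_image]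
      constructor
      · rintro ⟨hi, ha⟩
        have hne : (Finset.univ.filter fun i => x i = a).Nonempty := by
          obtain ⟨i, hi⟩ := hi
          exact ⟨i, by simpa using hi⟩
        have hmin := Finset.min'_mem _ hne
        simp only [Finset.mem_filter, Finset.mem_univ, true_and] at hmin
        refine ⟨_, ⟨hmin.symm ▸ ha, fun j hj hja => ?_⟩, hmin⟩
        exact absurd (Finset.min'_le _ j (by simpa using hja.trans hmin)) (not_le.2 hj)
      · rintro ⟨i, ⟨hi, -⟩, rfl⟩
        exact ⟨⟨i, rfl⟩, hi⟩
    rw [himg, Set.InjOn.encard_image, Set.encard_coe_eq_coe_finsetCard]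
    · simp [Set.indicator_apply, Finset.sum_boole]
    · intro i hi j hj hij
      simp only [Finset.coe_filter, Finset.mem_univ, true_and, Set.mem_ofPred_eq] at hi hj
      rcases lt_trichotomy i j with h | h | h
      · exact absurd hij (hj.2 i h)
      · exact h
      · exact absurd hij.symm (hi.2 j h)
  simp_rw [h]
  refine Finset.measurable_sum _ fun i _ => measurable_one.indicator ?_
  refine MeasurableSet.inter (s₂ := {x : Fin k → ℝ | ∀ j < i, x j ≠ x i}) (measurable_pi_apply i hD) ?_
  rw [Set.ofPred_forall]
  refine MeasurableSet.iInter fun j => ?_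
  rw [Set.ofPred_forall]
  exact MeasurableSet.iInter fun _ =>
    (measurableSet_eq_fun (measurable_pi_apply j) (measurable_pi_apply i)).compl

lemma tupleCount_ofMultiset {n : ℕ} (B : Set (Fin n → ℝ)) (s : Multiset ℝ) :
    Configuration.tupleCount B (ofMultiset s) = tupleNum B s := by
  have := (finite_tuples B s).cast_ncard_eq
  rw [tupleNum, Configuration.tupleCount]
  change ENat.toENNReal {x : Fin n → ℝ | x ∈ B ∧ Function.Injective x ∧ ∀ i, x i ∈ s}.encard = _
  rw [← this]
  rfl

lemma measurable_tupleNum {n : ℕ} {B : Set (Fin n → ℝ)} (hB : MeasurableSet B) :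
    MeasurableOnFamilies fun s => (tupleNum B s : ℝ≥0∞) := by
  intro k
  simp_rw [← tupleCount_ofMultiset]
  exact (measurable_tupleCount hB).comp
    (measurable_configuration fun A hA => measurable_encard_ofMultiset hA k)

/-- The configuration whose points in the `n`-th shell are those of the `n`-th family. -/
def ofStates (t : ℕ → State) : Configuration ℝ :=
  ⟨⋃ n, (ofMultiset (t n).points).1 ∩ shell n, fun C hC => by
    obtain ⟨r, hr⟩ := hC.isBounded.subset_closedBall 0
    obtain ⟨m, hm⟩ := exists_nat_gt r
    have hCm : C ⊆ Set.Ico (-(m : ℝ)) m := by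
      intro a ha
      have := hr ha
      rw [mem_closedBall_zero_iff, Real.norm_eq_abs] at this
      have := abs_lt.1 (this.trans_lt hm)
      exact ⟨this.1.le, this.2⟩
    -- Intersecting with the shells makes this locally finite for every sequence `t`: only shells
    -- with index below m meet `C`.
    refine (Set.Finite.biUnion (Set.finite_Iio m)
      (t := fun n => (ofMultiset (t n).points).1)
      fun n _ => (t n).points.finite_toSet).subset ?_
    rintro a ⟨ha, haC⟩
    obtain ⟨n, hn, hs⟩ := Set.mem_iUnion.1 ha
    exact Set.mem_biUnion (lt_of_mem_shell_of_mem_window hs (hCm haC)) hn⟩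

lemma measurable_ofStates : Measurable ofStates := by
  refine measurable_configuration fun A hA => ?_
  have h (t : ℕ → State) : (((ofStates t).1 ∩ A).encard : ℝ≥0∞) =
      ∑' n, (((ofMultiset (t n).points).1 ∩ (shell n ∩ A)).encard : ℝ≥0∞) := by
    have hm (n : ℕ) : MeasurableSet ((ofMultiset (t n).points).1 ∩ (shell n ∩ A)) :=
      ((t n).points.finite_toSet.subset Set.inter_subset_left).measurableSet
    have hU : (ofStates t).1 ∩ A = ⋃ n, (ofMultiset (t n).points).1 ∩ (shell n ∩ A) := by
      simp_rw [← Set.inter_assoc]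
      rw [← Set.iUnion_inter]
      rfl
    rw [hU, ← Measure.count_apply (MeasurableSet.iUnion hm), measure_iUnion ?_ hm]
    · exact tsum_congr fun n => Measure.count_apply (hm n)
    · exact fun m n hmn => (pairwise_disjoint_shell hmn).mono
        (fun a ha => ha.2.1) (fun a ha => ha.2.1)
  simp_rw [h]
  refine Measurable.tsum fun n => ?_
  have := (measurable_encard_ofMultiset ((measurableSet_shell n).inter hA)).comp_sum_points
    (n := 1) (z := fun _ (t : ℕ → State) => t n) fun _ => measurable_pi_apply n
  simpa using this

lemma mem_sum_points {m : ℕ} {t : Fin m → State} {a : ℝ} :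
    a ∈ ∑ i, (t i).points ↔ ∃ i, a ∈ (t i).points := by
  simp [Multiset.mem_sum]

lemma ofStates_inter_window {t : ℕ → State}
    (ht : ∀ n i, i < (t n).1 → (t n).2 i ∈ shell n) {m : ℕ} {a : ℝ}
    (ha : a ∈ Set.Ico (-(m : ℝ)) m) :
    a ∈ (ofStates t).1 ↔ a ∈ ∑ i : Fin m, (t i).points := by
  have hs {n : ℕ} (h : a ∈ (t n).points) : a ∈ shell n := by
    obtain ⟨i, rfl⟩ := mem_values.1 h
    exact ht n i i.2
  rw [mem_sum_points]
  constructor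
  · intro h
    obtain ⟨n, hn, hsh⟩ := Set.mem_iUnion.1 h
    exact ⟨⟨n, lt_of_mem_shell_of_mem_window hsh ha⟩, hn⟩
  · rintro ⟨i, hi⟩
    exact Set.mem_iUnion.2 ⟨i, hi, hs hi⟩

/-- The tuples in the cube `[-m, m)ⁿ`. -/
def cube (n m : ℕ) : Set (Fin n → ℝ) := {x | ∀ i, x i ∈ Set.Ico (-(m : ℝ)) m}

lemma measurableSet_cube (n m : ℕ) : MeasurableSet (cube n m) := by
  rw [cube, Set.ofPred_forall]
  exact MeasurableSet.iInter fun i => measurable_pi_apply i measurableSet_Ico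

lemma monotone_cube (n : ℕ) : Monotone (cube n) :=
  fun _ _ h _ hx i => window_mono h (hx i)

lemma iUnion_cube (n : ℕ) : ⋃ m, cube n m = Set.univ := by
  refine Set.eq_univ_of_forall fun x => ?_
  choose m hm using fun i => exists_mem_window (x i)
  exact Set.mem_iUnion.2 ⟨Finset.univ.sup m, fun i =>
    window_mono (Finset.le_sup (Finset.mem_univ i)) (hm i)⟩

lemma tupleCount_ofStates {t : ℕ → State}
    (ht : ∀ n i, i < (t n).1 → (t n).2 i ∈ shell n) {n : ℕ} (B : Set (Fin n → ℝ)) (m : ℕ) :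
    Configuration.tupleCount (B ∩ cube n m) (ofStates t) =
      tupleNum (B ∩ cube n m) (∑ i : Fin m, (t i).points) := by
  rw [← tupleCount_ofMultiset, Configuration.tupleCount, Configuration.tupleCount]
  congr 2
  ext x
  simp only [Set.mem_ofPred_eq]
  refine and_congr_right fun hx => and_congr_right fun _ => forall_congr' fun i => ?_
  exact ofStates_inter_window ht (hx.2 i)

lemma tupleCount_eq_iSup {n : ℕ} (B : Set (Fin n → ℝ)) (S : Configuration ℝ) :
    Configuration.tupleCount B S = ⨆ m, Configuration.tupleCount (B ∩ cube n m) S := by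
  have hc (B : Set (Fin n → ℝ)) : Configuration.tupleCount B S =
      Measure.count (B ∩ {x | Function.Injective x ∧ ∀ i, x i ∈ S.1}) := by
    have hfin : (B ∩ {x : Fin n → ℝ | Function.Injective x ∧ ∀ i, x i ∈ S.1}).Countable := by
      refine (Set.countable_univ_pi fun _ : Fin n => Configuration.countable S).mono ?_
      exact fun x hx i _ => hx.2.2 i
    rw [Measure.count_apply hfin.measurableSet]
    rfl
  simp_rw [hc]
  rw [← Monotone.measure_iUnion, ← Set.iUnion_inter, ← Set.inter_iUnion, iUnion_cube,
    Set.inter_univ]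
  intro k l hkl
  exact Set.inter_subset_inter_left _ (Set.inter_subset_inter_right _ (monotone_cube n hkl))

/-- The window is the disjoint union of the first n shells, so superposition merges the iterated
integrals into one. -/
lemma iterIntegral_refMeasure_shell (n : ℕ) {F : Multiset ℝ → ℝ} (hF : Tame F)
    (hF0 : ∀ s, 0 ≤ F s) :
    iterIntegral (fun n => refMeasure (shell n)) n (fun s => ENNReal.ofReal (F s)) =
      ENNReal.ofReal (sumIntegral ((Set.Ico (-(n : ℝ)) n).indicator 1) F 0) := by
  induction n generalizing F with
  | zero =>
    have : (Set.Ico (-((0 : ℕ) : ℝ)) ((0 : ℕ) : ℝ)).indicator (1 : ℝ → ℝ) = 0 := by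
      ext
      simp
    rw [this, sumIntegral_zero]
    rfl
  | succ n ih =>
    have hi := integrable_indicator_one (measurableSet_shell n) (volume_shell_ne_top n)
    rw [indicator_window_succ, ← hF.sumIntegral_sumIntegral (integrable_window n) hi, ← ih]
    · change iterIntegral _ n (fun s => ∫⁻ t, ENNReal.ofReal (F (s + t.points))
        ∂refMeasure (shell n)) = _
      simp_rw [lintegral_refMeasure_ofReal (measurableSet_shell n) (volume_shell_ne_top n) hF hF0]
    · exact hF.sumIntegral hi
    · intro s
      refine tsum_nonneg fun k => mul_nonneg (by positivity) (integral_nonneg fun x =>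
        mul_nonneg ?_ (hF0 _))
      exact Finset.prod_nonneg fun i _ => Set.indicator_nonneg (fun _ _ => zero_le_one) _

variable {khat : ℝ → ℝ}

theorem exists_correlation (hint : Integrable khat) (h0 : ∀ t, 0 ≤ khat t)
    (h1 : ∀ t, khat t ≤ 1) :
    ∃ P : Measure (Configuration ℝ), IsProbabilityMeasure P ∧
      ∀ (n : ℕ) (B : Set (Fin n → ℝ)), MeasurableSet B →
        ∫⁻ S, Configuration.tupleCount B S ∂P =
          ∫⁻ x in B, ENNReal.ofReal (detFunctional (fourierKernel id khat) (values x)) := by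
  have hfin (n : ℕ) := isFiniteMeasure_refMeasure (measurableSet_shell n) (volume_shell_ne_top n)
  obtain ⟨Q, hQ, hlaw, hnull⟩ := exists_measure_of_densities
    (σ := fun n => refMeasure (shell n)) (p := fun n s => ENNReal.ofReal (janossy khat n s))
    (fun _ _ => ENNReal.ofReal_ne_top)
    (fun n k => ((tame_janossy hint h0 n).measurable k).ennreal_ofReal)
    (fun n s => by
      rw [lintegral_refMeasure_ofReal (measurableSet_shell n) (volume_shell_ne_top n)
        (tame_janossy hint h0 (n + 1)) (janossy_nonneg hint h0 h1 (n + 1)),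
        sumIntegral_shell_janossy hint h0])
    (fun n => refMeasure_length_eq_zero _)
    (by rw [janossy_zero, detFunctional_zero, ENNReal.ofReal_one])
  refine ⟨Q.map ofStates, Measure.isProbabilityMeasure_map measurable_ofStates.aemeasurable, ?_⟩
  have hshell : ∀ᵐ t ∂Q, ∀ n i, i < (t n).1 → (t n).2 i ∈ shell n := by
    rw [ae_all_iff]
    intro n
    filter_upwards [hnull n _ (measurableSet_points_subset (measurableSet_shell n)).compl
      (refMeasure_points_not_subset (measurableSet_shell n))] with t ht
    simpa using ht
  -- Inside a cube only the first m shells matter, so Campbell's formula with the densities `janossy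
  -- khat m` applies. A general `B` follows by monotone convergence in m.
  have hcube (n : ℕ) (B : Set (Fin n → ℝ)) (hB : MeasurableSet B) (m : ℕ) :
      ∫⁻ t, Configuration.tupleCount (B ∩ cube n m) (ofStates t) ∂Q =
        ∫⁻ x in B ∩ cube n m,
          ENNReal.ofReal (detFunctional (fourierKernel id khat) (values x)) := by
    have hBm := hB.inter (measurableSet_cube n m)
    have hJ := tame_janossy hint h0 m
    have hJ0 : ∀ s : Multiset ℝ, ¬ s.Nodup → janossy khat m s = 0 :=
      fun s hs => janossy_of_not_nodup m hs
    have hnn : ∀ s, 0 ≤ (tupleNum (B ∩ cube n m) s : ℝ) * janossy khat m s :=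
      fun s => mul_nonneg (Nat.cast_nonneg _) (janossy_nonneg hint h0 h1 m s)
    have hdet := tame_detFunctional hint h0
    calc ∫⁻ t, Configuration.tupleCount (B ∩ cube n m) (ofStates t) ∂Q
        = ∫⁻ t, (tupleNum (B ∩ cube n m) (∑ i : Fin m, (t i).points) : ℝ≥0∞) ∂Q :=
          lintegral_congr_ae (hshell.mono fun t ht => tupleCount_ofStates ht B m)
      _ = iterIntegral (fun n => refMeasure (shell n)) m fun s =>
            ENNReal.ofReal (tupleNum (B ∩ cube n m) s * janossy khat m s) := by
          rw [hlaw m _ (measurable_tupleNum hBm)]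
          congr 1
          funext s
          rw [ENNReal.ofReal_mul (Nat.cast_nonneg _), ENNReal.ofReal_natCast]
      _ = ENNReal.ofReal (∫ x in B ∩ cube n m,
            detFunctional (fourierKernel id khat) (values x)) := by
          rw [iterIntegral_refMeasure_shell m (hJ.tupleNum_mul hJ0 hBm) hnn,
            sumIntegral_tupleNum_mul hJ hJ0 hBm measurableSet_Ico (by simp) fun x hx => hx.2]
          simp_rw [sumIntegral_window_janossy hint h0]
      _ = _ := by
          refine ofReal_integral_eq_lintegral_ofReal ?_ (Filter.Eventually.of_forall fun x =>
            (isPosKernel_fourierKernel hint h0).detFunctional_nonneg _)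
          have hi := (hdet.integrable (integrable_window m) 0 (Fin n)).integrableOn
            (s := B ∩ cube n m)
          refine hi.congr_fun (fun x hx => ?_) hBm
          have : ∀ i, (Set.Ico (-(m : ℝ)) m).indicator (1 : ℝ → ℝ) (x i) = 1 :=
            fun i => Set.indicator_of_mem (hx.2 i) _
          simp only [this, Finset.prod_const_one, one_mul, zero_add]
  intro n B hB
  rw [lintegral_map (measurable_tupleCount hB) measurable_ofStates]
  simp_rw [tupleCount_eq_iSup B]
  have hmono : Monotone fun m => B ∩ cube n m :=
    fun k l hkl => Set.inter_subset_inter_right _ (monotone_cube n hkl)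
  rw [lintegral_iSup]
  · simp_rw [hcube n B hB]
    have hd : Measurable fun x : Fin n → ℝ =>
        ENNReal.ofReal (detFunctional (fourierKernel id khat) (values x)) :=
      ((tame_detFunctional hint h0).measurable n).ennreal_ofReal
    have hBU : B = ⋃ m, B ∩ cube n m := by
      rw [← Set.inter_iUnion, iUnion_cube, Set.inter_univ]
    conv_rhs => rw [hBU]
    rw [setLIntegral_iUnion_of_directed _ hmono.directed_le]
  · exact fun m => (measurable_tupleCount (hB.inter (measurableSet_cube n m))).comp
      measurable_ofStates
  · intro k l hkl t
    change (ENat.toENNReal _) ≤ ENat.toENNReal _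
    exact ENat.toENNReal_mono (Set.encard_le_encard fun x hx => ⟨hmono hkl hx.1, hx.2⟩)

lemma gram_det_eq_detFunctional (hint : Integrable khat) (h0 : ∀ t, 0 ≤ khat t) {n : ℕ}
    (x : Fin n → ℝ) : kernelDet (fourierKernel id khat) x =
      (detFunctional (fourierKernel id khat) (values x) : ℂ) := by
  have h := Complex.le_def.1 ((isPosKernel_fourierKernel (q := id) hint h0).det_nonneg x)
  rw [detFunctional_values]
  exact Complex.ext rfl h.2.symm

theorem exists_isFermionProcess (hint : Integrable khat) (h0 : ∀ t, 0 ≤ khat t)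
    (h1 : ∀ t, khat t ≤ 1) :
    ∃ P : Measure (Configuration ℝ), IsFermionProcess P volume (fourierKernel id khat) := by
  obtain ⟨P, hP, h⟩ := exists_correlation hint h0 h1
  refine ⟨P, hP, fun n x => (detFunctional (fourierKernel id khat) (values x)).toNNReal,
    fun n => ⟨((tame_detFunctional hint h0).measurable n).real_toNNReal, fun B hB => ?_⟩,
    fun n x => ?_⟩
  · rw [h n B hB]
    rfl
  · rw [gram_det_eq_detFunctional hint h0, Real.coe_toNNReal _
      ((isPosKernel_fourierKernel hint h0).detFunctional_nonneg _)]

theorem macchiNonneg_fourierKernel (hint : Integrable khat) (h0 : ∀ t, 0 ≤ khat t) :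
    MacchiNonneg (fourierKernel id khat) := by
  intro n x
  rw [gram_det_eq_detFunctional hint h0, Complex.ofReal_im, Complex.ofReal_re]
  exact ⟨rfl, (isPosKernel_fourierKernel hint h0).detFunctional_nonneg _⟩

end pointProcess

end FermionProcess

namespace FermionProcess

open FourierTransform

/-! ### Fourier transforms of functions in both L¹ and L² -/

section fourierL2

variable {f g : ℝ → ℂ}

lemma integral_fourier_mul (hf : Integrable f) (hg : Integrable g) :
    ∫ ξ, 𝓕 f ξ * g ξ = ∫ x, f x * 𝓕 g x := by
  have h := VectorFourier.integral_fourierIntegral_smul_eq_flip (L := innerₗ ℝ)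
    Real.continuous_fourierChar continuous_inner hf hg
  rw [flip_innerₗ] at h
  exact h

lemma integral_fourierInv_mul (hf : Integrable f) (hg : Integrable g) :
    ∫ ξ, 𝓕⁻ f ξ * g ξ = ∫ x, f x * 𝓕⁻ g x := by
  have h := integral_fourier_mul hf.comp_neg hg
  rw [← Real.fourierInv_eq_fourier_comp_neg] at h
  rw [h, ← integral_neg_eq_self]
  simp [Real.fourierInv_eq_fourier_neg]

lemma continuous_fourier (hf : Integrable f) : Continuous (𝓕 f) :=
  VectorFourier.fourierIntegral_continuous Real.continuous_fourierChar
    (L := innerₗ ℝ) continuous_inner hf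

lemma continuous_fourierInv (hf : Integrable f) : Continuous (𝓕⁻ f) := by
  rw [Real.fourierInv_eq_fourier_comp_neg]
  exact continuous_fourier hf.comp_neg

lemma norm_fourier_le (f : ℝ → ℂ) (x : ℝ) : ‖𝓕 f x‖ ≤ ∫ y, ‖f y‖ :=
  VectorFourier.norm_fourierIntegral_le_integral_norm _ _ _ _ _

lemma norm_fourierInv_le (f : ℝ → ℂ) (x : ℝ) : ‖𝓕⁻ f x‖ ≤ ∫ y, ‖f y‖ := by
  rw [Real.fourierInv_eq_fourier_neg]
  exact norm_fourier_le f _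

/-- The abstract transform on L² and the integral transform agree as distributions: tested against a
smooth compactly supported function, both move the transform onto it. Two locally integrable
functions with this property are equal almost everywhere. -/
lemma coeFn_fourier_toLp (hf : Integrable f) (h2 : MemLp f 2) :
    (𝓕 (h2.toLp f) : Lp ℂ 2 (volume : Measure ℝ)) =ᵐ[volume] 𝓕 f := by
  refine ae_eq_of_integral_contDiff_smul_eq
    ((Lp.memLp _).locallyIntegrable (by norm_num)) (continuous_fourier hf).locallyIntegrable
    fun u hu hc => ?_
  have hu1 : HasCompactSupport (Complex.ofRealCLM ∘ u) := hc.comp_left rfl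
  have hu2 : ContDiff ℝ (⊤ : ℕ∞) (Complex.ofRealCLM ∘ u) :=
    Complex.ofRealCLM.contDiff.comp hu
  set U : SchwartzMap ℝ ℂ := hu1.toSchwartzMap hu2 with hU
  have hUu (x : ℝ) : U x = (u x : ℂ) := rfl
  have h := congrArg (fun D : TemperedDistribution ℝ ℂ => D U)
    (Lp.fourier_toTemperedDistribution_eq (h2.toLp f))
  simp only [TemperedDistribution.fourier_apply, Lp.toTemperedDistribution_apply, hUu,
    smul_eq_mul] at h
  simp only [Complex.real_smul]
  rw [← h, ← integral_fourier_mul (U.integrable.congr (Filter.Eventually.of_forall hUu)) hf]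
  refine integral_congr_ae ?_
  filter_upwards [h2.coeFn_toLp] with x hx
  rw [hx]
  rfl

lemma coeFn_fourierInv_toLp (hf : Integrable f) (h2 : MemLp f 2) :
    (𝓕⁻ (h2.toLp f) : Lp ℂ 2 (volume : Measure ℝ)) =ᵐ[volume] 𝓕⁻ f := by
  refine ae_eq_of_integral_contDiff_smul_eq
    ((Lp.memLp _).locallyIntegrable (by norm_num)) (continuous_fourierInv hf).locallyIntegrable
    fun u hu hc => ?_
  have hu1 : HasCompactSupport (Complex.ofRealCLM ∘ u) := hc.comp_left rfl
  have hu2 : ContDiff ℝ (⊤ : ℕ∞) (Complex.ofRealCLM ∘ u) :=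
    Complex.ofRealCLM.contDiff.comp hu
  set U : SchwartzMap ℝ ℂ := hu1.toSchwartzMap hu2 with hU
  have hUu (x : ℝ) : U x = (u x : ℂ) := rfl
  have h := congrArg (fun D : TemperedDistribution ℝ ℂ => D U)
    (Lp.fourierInv_toTemperedDistribution_eq (h2.toLp f))
  simp only [TemperedDistribution.fourierInv_apply, Lp.toTemperedDistribution_apply, hUu,
    smul_eq_mul] at h
  simp only [Complex.real_smul]
  rw [← h, ← integral_fourierInv_mul (U.integrable.congr (Filter.Eventually.of_forall hUu)) hf]
  refine integral_congr_ae ?_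
  filter_upwards [h2.coeFn_toLp] with x hx
  rw [hx, SchwartzMap.fourierInv_coe]
  rfl

lemma memLp_fourier (hf : Integrable f) (h2 : MemLp f 2) : MemLp (𝓕 f) 2 :=
  (memLp_congr_ae (coeFn_fourier_toLp hf h2)).1 (Lp.memLp _)

lemma integral_norm_sq_eq (h2 : MemLp f 2) : ∫ x, ‖f x‖ ^ 2 = ‖h2.toLp f‖ ^ 2 := by
  rw [← inner_self_eq_norm_sq (𝕜 := ℂ), L2.inner_def, ← integral_re (L2.integrable_inner _ _)]
  refine integral_congr_ae ?_
  filter_upwards [h2.coeFn_toLp] with x hx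
  rw [hx, inner_self_eq_norm_sq]

/-- Plancherel's identity. -/
lemma integral_norm_sq_fourier (hf : Integrable f) (h2 : MemLp f 2) :
    ∫ x, ‖𝓕 f x‖ ^ 2 = ∫ x, ‖f x‖ ^ 2 := by
  rw [integral_norm_sq_eq h2, integral_norm_sq_eq (memLp_fourier hf h2),
    ← Lp.norm_fourier_eq (h2.toLp f)]
  congr 2
  refine Lp.ext ((MemLp.coeFn_toLp _).trans (coeFn_fourier_toLp hf h2).symm)

/-- The inversion formula for a function whose Fourier transform is integrable. -/
lemma fourierInv_fourier_ae_eq (hf : Integrable f) (h2 : MemLp f 2) {φ : ℝ → ℂ}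
    (hφ : Integrable φ) (h : φ =ᵐ[volume] 𝓕 f) : 𝓕⁻ φ =ᵐ[volume] f := by
  have hφ2 : MemLp φ 2 := (memLp_congr_ae h).2 (memLp_fourier hf h2)
  have h1 : hφ2.toLp φ = 𝓕 (h2.toLp f) :=
    Lp.ext ((MemLp.coeFn_toLp _).trans (h.trans (coeFn_fourier_toLp hf h2).symm))
  have h3 := coeFn_fourierInv_toLp hφ hφ2
  rw [h1, fourierInv_fourier_eq] at h3
  exact h3.symm.trans h2.coeFn_toLp

end fourierL2

/-! ### Band-limited functions and the identity theorem -/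

section bandLimited

lemma fourierInv_real_eq (φ : ℝ → ℂ) (x : ℝ) :
    𝓕⁻ φ x = ∫ s : ℝ, Complex.exp (2 * Real.pi * Complex.I * x * s) * φ s := by
  rw [Real.fourierInv_eq']
  refine integral_congr_ae (Filter.Eventually.of_forall fun s => ?_)
  simp only [smul_eq_mul, RCLike.inner_apply, conj_trivial]
  congr 2
  push_cast
  ring

/-- The Fourier–Laplace transform of a function with bounded support is entire. -/
lemma differentiable_fourierLaplace {φ : ℝ → ℂ} (hφ : Integrable φ) {R : ℝ}
    (hR : ∀ s, R < |s| → φ s = 0) :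
    Differentiable ℂ fun z : ℂ => ∫ s : ℝ, Complex.exp (2 * Real.pi * Complex.I * z * s) * φ s := by
  intro z
  have hexp (z : ℂ) : Continuous fun s : ℝ => Complex.exp (2 * Real.pi * Complex.I * z * s) := by
    fun_prop
  have hb (z : ℂ) (s : ℝ) : ‖Complex.exp (2 * Real.pi * Complex.I * z * s) * φ s‖ ≤
      Real.exp (2 * Real.pi * ‖z‖ * |R|) * ‖φ s‖ := by
    by_cases hs : R < |s|
    · simp [hR s hs]
    · rw [norm_mul]
      refine mul_le_mul_of_nonneg_right ((Complex.norm_exp_le_exp_norm _).trans ?_) (norm_nonneg _)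
      rw [Real.exp_le_exp]
      have : ‖(2 * Real.pi * Complex.I * z * s : ℂ)‖ = 2 * Real.pi * ‖z‖ * |s| := by
        simp [abs_of_pos Real.pi_pos]
      rw [this]
      have : |s| ≤ |R| := (not_lt.1 hs).trans (le_abs_self R)
      gcongr
  have hF (z : ℂ) : AEStronglyMeasurable
      (fun s : ℝ => Complex.exp (2 * Real.pi * Complex.I * z * s) * φ s) :=
    (hexp z).aestronglyMeasurable.mul hφ.aestronglyMeasurable
  refine (hasDerivAt_integral_of_dominated_loc_of_deriv_le
    (F := fun (z : ℂ) (s : ℝ) => Complex.exp (2 * Real.pi * Complex.I * z * s) * φ s)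
    (F' := fun (z : ℂ) (s : ℝ) => 2 * Real.pi * Complex.I * s *
      (Complex.exp (2 * Real.pi * Complex.I * z * s) * φ s))
    (bound := fun s => 2 * Real.pi * |R| * (Real.exp (2 * Real.pi * (‖z‖ + 1) * |R|) * ‖φ s‖))
    (Metric.ball_mem_nhds z one_pos) (Filter.Eventually.of_forall hF)
    ((hφ.norm.const_mul _).mono' (hF z) (Filter.Eventually.of_forall (hb z))) ?_ ?_
    ((hφ.norm.const_mul _).const_mul _) ?_).2.differentiableAt
  · exact (Continuous.aestronglyMeasurable (by fun_prop)).mul (hF z)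
  · refine Filter.Eventually.of_forall fun s y hy => ?_
    by_cases hs : R < |s|
    · simp [hR s hs]
    · have hsR : |s| ≤ |R| := (not_lt.1 hs).trans (le_abs_self R)
      have hy' : ‖y‖ ≤ ‖z‖ + 1 := by
        have := norm_sub_norm_le y z
        rw [Metric.mem_ball, dist_eq_norm] at hy
        linarith
      rw [norm_mul]
      refine mul_le_mul ?_ ((hb y s).trans ?_) (norm_nonneg _) (by positivity)
      · simp only [norm_mul, Complex.norm_ofNat, Complex.norm_real, Real.norm_eq_abs,
          abs_of_pos Real.pi_pos, Complex.norm_I, mul_one]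
        gcongr
      · gcongr
  · refine Filter.Eventually.of_forall fun s y _ => ?_
    have h1 : HasDerivAt (fun y : ℂ => 2 * Real.pi * Complex.I * y * s)
        (2 * Real.pi * Complex.I * s) y := by
      simpa using ((hasDerivAt_id y).const_mul (2 * Real.pi * Complex.I : ℂ)).mul_const (s : ℂ)
    have := (h1.cexp).mul_const (φ s)
    refine this.congr_deriv ?_
    ring

/-- A band-limited function which vanishes on a set of positive measure is zero. -/
lemma fourierInv_eq_zero_of_ae {φ : ℝ → ℂ} (hφ : Integrable φ) {R : ℝ}
    (hR : ∀ s, R < |s| → φ s = 0) {D : Set ℝ} (hD : volume D ≠ 0)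
    (h : ∀ᵐ x ∂volume.restrict D, 𝓕⁻ φ x = 0) (hDm : MeasurableSet D) (x : ℝ) : 𝓕⁻ φ x = 0 := by
  set F : ℂ → ℂ := fun z => ∫ s : ℝ, Complex.exp (2 * Real.pi * Complex.I * z * s) * φ s with hFdef
  have hFx (x : ℝ) : 𝓕⁻ φ x = F x := fourierInv_real_eq φ x
  have hF : AnalyticOnNhd ℂ F Set.univ :=
    (differentiable_fourierLaplace hφ hR).differentiableOn.analyticOnNhd isOpen_univ
  set Z : Set ℝ := D ∩ {x | 𝓕⁻ φ x = 0} with hZ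
  have hZ0 : volume Z ≠ 0 := by
    rw [ae_restrict_iff' hDm] at h
    intro h0
    refine hD (measure_mono_null ?_ (measure_union_null h0 (ae_iff.1 h)))
    intro x hx
    by_cases hx0 : 𝓕⁻ φ x = 0
    · exact Or.inl ⟨hx, hx0⟩
    · exact Or.inr fun h => hx0 (h hx)
  -- A bounded part of the zero set still has positive measure, so it is infinite and accumulates.
  -- The identity theorem then kills the entire extension.
  obtain ⟨m, hm⟩ : ∃ m : ℕ, volume (Z ∩ Set.Icc (-(m : ℝ)) m) ≠ 0 := by
    by_contra! hall
    refine hZ0 (measure_mono_null (fun x hx => ?_) (measure_iUnion_null hall))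
    obtain ⟨m, hm⟩ := exists_mem_window x
    exact Set.mem_iUnion.2 ⟨m, hx, hm.1, hm.2.le⟩
  have hinf : (Z ∩ Set.Icc (-(m : ℝ)) m).Infinite := fun hfin => hm (hfin.measure_zero _)
  obtain ⟨a, -, ha⟩ := hinf.exists_accPt_of_subset_isCompact isCompact_Icc Set.inter_subset_right
  have hfreq : ∃ᶠ z in nhdsWithin (a : ℂ) {(a : ℂ)}ᶜ, F z = 0 := by
    rw [accPt_iff_frequently_nhdsNE] at ha
    have ht : Filter.Tendsto (fun x : ℝ => (x : ℂ)) (nhdsWithin a {a}ᶜ)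
        (nhdsWithin (a : ℂ) {(a : ℂ)}ᶜ) := by
      refine tendsto_nhdsWithin_iff.2
        ⟨Complex.continuous_ofReal.continuousAt.tendsto.mono_left nhdsWithin_le_nhds, ?_⟩
      filter_upwards [self_mem_nhdsWithin] with x hx
      simpa using hx
    exact ht.frequently (ha.mono fun x hx => by rw [← hFx]; exact hx.1.2)
  rw [hFx]
  exact hF.eqOn_zero_of_preconnected_of_frequently_eq_zero isPreconnected_univ (Set.mem_univ _)
    hfreq (Set.mem_univ _)

end bandLimited

end FermionProcess

namespace FermionProcess

open FourierTransform InnerProductSpace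

/-! ### The operator on L²(A): compactness and norm less than one -/

section timeBandLimiting

variable {A : Set ℝ} [IsFiniteMeasure (volume.restrict A)]

lemma norm_exp_two_pi (s x : ℝ) : ‖Complex.exp (2 * Real.pi * Complex.I * x * s)‖ = 1 := by
  have : 2 * Real.pi * Complex.I * x * s = ((2 * Real.pi * x * s : ℝ) : ℂ) * Complex.I := by
    push_cast
    ring
  rw [this, Complex.norm_exp_ofReal_mul_I]

lemma memLp_exp (s : ℝ) : MemLp (fun x : ℝ => Complex.exp (2 * Real.pi * Complex.I * x * s)) 2
    (volume.restrict A) :=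
  MemLp.of_bound (Continuous.aestronglyMeasurable (by fun_prop)) 1
    (Filter.Eventually.of_forall fun x => (norm_exp_two_pi s x).le)

variable (A) in
/-- The function `x ↦ exp(2πisx)` in `L²(A)`. -/
noncomputable def planeWave (s : ℝ) : Lp ℂ 2 (volume.restrict A) := (memLp_exp s).toLp _

lemma integrable_extend (hA : MeasurableSet A) (f : Lp ℂ 2 (volume.restrict A)) :
    Integrable (A.indicator f) :=
  (integrable_indicator_iff hA).2 ((Lp.memLp f).integrable (by norm_num))

omit [IsFiniteMeasure (volume.restrict A)] in
lemma memLp_extend (hA : MeasurableSet A) (f : Lp ℂ 2 (volume.restrict A)) :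
    MemLp (A.indicator f) 2 :=
  (memLp_indicator_iff_restrict hA).2 (Lp.memLp f)

lemma fourier_real_eq' (φ : ℝ → ℂ) (s : ℝ) :
    𝓕 φ s = ∫ x : ℝ, Complex.exp (-(2 * Real.pi * Complex.I * x * s)) * φ x := by
  rw [Real.fourier_real_eq_integral_exp_smul]
  refine integral_congr_ae (Filter.Eventually.of_forall fun x => ?_)
  simp only [smul_eq_mul]
  congr 2
  push_cast
  ring

lemma conj_exp_two_pi (s x : ℝ) : (starRingEnd ℂ) (Complex.exp (2 * Real.pi * Complex.I * x * s)) =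
    Complex.exp (-(2 * Real.pi * Complex.I * x * s)) := by
  rw [← Complex.exp_conj]
  simp [Complex.conj_ofNat]

lemma inner_planeWave (hA : MeasurableSet A) (s : ℝ) (f : Lp ℂ 2 (volume.restrict A)) :
    inner ℂ (planeWave A s) f = 𝓕 (A.indicator f) s := by
  rw [L2.inner_def, fourier_real_eq', ← integral_indicator hA]
  have h : ∀ᵐ x ∂volume, x ∈ A →
      planeWave A s x = Complex.exp (2 * Real.pi * Complex.I * x * s) :=
    (ae_restrict_iff' hA).1 (memLp_exp s).coeFn_toLp
  refine integral_congr_ae ?_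
  filter_upwards [h] with x hx
  by_cases hxA : x ∈ A
  · rw [Set.indicator_of_mem hxA, Set.indicator_of_mem hxA, hx hxA, RCLike.inner_apply,
      conj_exp_two_pi, mul_comm]
  · rw [Set.indicator_of_notMem hxA, Set.indicator_of_notMem hxA, mul_zero]

lemma inner_planeWave' (hA : MeasurableSet A) (s : ℝ) (f : Lp ℂ 2 (volume.restrict A)) :
    inner ℂ f (planeWave A s) = 𝓕⁻ (fun x => (starRingEnd ℂ) (A.indicator f x)) s := by
  rw [← inner_conj_symm, inner_planeWave hA, fourier_real_eq', fourierInv_real_eq, ← integral_conj]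
  refine integral_congr_ae (Filter.Eventually.of_forall fun x => ?_)
  simp only [map_mul]
  rw [← conj_exp_two_pi, Complex.conj_conj]
  congr 2
  ring

/-- The squared distance of the waves s and t is 2 Re(χ(0) - χ(s - t)), where χ is the continuous
Fourier transform of 1_A. Norm continuity supplies the strong measurability needed to integrate
rank-one operators. -/
lemma continuous_planeWave (hA : MeasurableSet A) : Continuous (planeWave A) := by
  have hvol : Integrable (A.indicator fun _ => (1 : ℂ)) :=
    (integrable_indicator_iff hA).2 (integrable_const _)
  have hinner (s t : ℝ) : inner ℂ (planeWave A s) (planeWave A t) =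
      𝓕 (A.indicator fun _ => (1 : ℂ)) (s - t) := by
    rw [inner_planeWave hA, fourier_real_eq', fourier_real_eq']
    have h : ∀ᵐ x ∂volume, x ∈ A →
        planeWave A t x = Complex.exp (2 * Real.pi * Complex.I * x * t) :=
      (ae_restrict_iff' hA).1 (memLp_exp t).coeFn_toLp
    refine integral_congr_ae ?_
    filter_upwards [h] with x hx
    by_cases hxA : x ∈ A
    · rw [Set.indicator_of_mem hxA, Set.indicator_of_mem hxA, hx hxA, ← Complex.exp_add, mul_one]
      congr 1
      push_cast
      ring
    · rw [Set.indicator_of_notMem hxA, Set.indicator_of_notMem hxA, mul_zero, mul_zero]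
  have hnorm (s t : ℝ) : ‖planeWave A s - planeWave A t‖ ^ 2 =
      2 * (𝓕 (A.indicator fun _ => (1 : ℂ)) 0).re -
        2 * (𝓕 (A.indicator fun _ => (1 : ℂ)) (s - t)).re := by
    rw [@norm_sub_sq ℂ, ← inner_self_eq_norm_sq (𝕜 := ℂ), ← inner_self_eq_norm_sq (𝕜 := ℂ),
      hinner, hinner, hinner, sub_self, sub_self]
    simp only [RCLike.re_to_complex]
    ring
  rw [continuous_iff_continuousAt]
  intro t
  rw [ContinuousAt, tendsto_iff_norm_sub_tendsto_zero]
  have h1 : Filter.Tendsto (fun s => ‖planeWave A s - planeWave A t‖ ^ 2) (nhds t) (nhds 0) := by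
    simp_rw [hnorm]
    have hc : Continuous fun s => 2 * (𝓕 (A.indicator fun _ => (1 : ℂ)) 0).re -
        2 * (𝓕 (A.indicator fun _ => (1 : ℂ)) (s - t)).re := by
      have := continuous_fourier hvol
      fun_prop
    simpa using hc.tendsto t
  simpa using h1.sqrt

lemma exists_norm_planeWave_le (A : Set ℝ) [IsFiniteMeasure (volume.restrict A)] :
    ∃ C : ℝ, ∀ s, ‖planeWave A s‖ ≤ C :=
  ⟨_, fun s => Lp.norm_le_of_ae_bound (f := planeWave A s) (p := 2) zero_le_one
    ((memLp_exp s).coeFn_toLp.mono fun x hx => by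
      rw [planeWave, hx]
      exact (norm_exp_two_pi s x).le)⟩

variable {w : ℝ → ℝ}

lemma continuous_rankOne_planeWave (hA : MeasurableSet A) :
    Continuous fun s => rankOne ℂ (planeWave A s) (planeWave A s) :=
  ((ContinuousLinearMap.smulRightL ℂ (Lp ℂ 2 (volume.restrict A))
    (Lp ℂ 2 (volume.restrict A))).continuous.comp
      ((innerSL ℂ).continuous.comp (continuous_planeWave hA))).clm_apply (continuous_planeWave hA)

lemma exists_norm_rankOne_le (A : Set ℝ) [IsFiniteMeasure (volume.restrict A)] :
    ∃ C : ℝ, ∀ s, ‖rankOne ℂ (planeWave A s) (planeWave A s)‖ ≤ C := by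
  obtain ⟨C, hC⟩ := exists_norm_planeWave_le A
  refine ⟨C * C, fun s => ?_⟩
  rw [norm_rankOne]
  exact mul_le_mul (hC s) (hC s) (norm_nonneg _) ((norm_nonneg _).trans (hC s))

lemma integrable_smul_rankOne (hA : MeasurableSet A) (hw : Integrable w) :
    Integrable fun s => (w s : ℂ) • rankOne ℂ (planeWave A s) (planeWave A s) := by
  obtain ⟨C, hC⟩ := exists_norm_rankOne_le A
  exact (hw.ofReal (𝕜 := ℂ)).smul_bdd C (continuous_rankOne_planeWave hA).aestronglyMeasurable
    (Filter.Eventually.of_forall hC)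

variable (A w) in
/-- The compression to `L²(A)` of the Fourier multiplier `w`. -/
noncomputable def compressedMultiplier : Lp ℂ 2 (volume.restrict A) →L[ℂ]
    Lp ℂ 2 (volume.restrict A) :=
  ∫ s, (w s : ℂ) • rankOne ℂ (planeWave A s) (planeWave A s)

lemma isCompactOperator_rankOne {E : Type*} [NormedAddCommGroup E] [InnerProductSpace ℂ E]
    (e : E) : IsCompactOperator (rankOne ℂ e e) := by
  have h : IsCompactOperator (innerSL ℂ e : E →L[ℂ] ℂ) :=
    isCompactOperator_of_locallyCompactSpace_dom (innerSL ℂ e)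
  exact h.clm_comp (ContinuousLinearMap.toSpanSingleton ℂ e)

-- A closed subspace is itself complete, so the integral can be formed inside it and then carried
-- over by the inclusion.
omit [IsFiniteMeasure (volume.restrict A)] in
lemma integral_smul_mem {E : Type*} [NormedAddCommGroup E] [NormedSpace ℂ E] [CompleteSpace E]
    {V : Submodule ℂ E} (hV : IsClosed (V : Set E)) (hw : Integrable w) {f : ℝ → E}
    (hf : Continuous f) {C : ℝ} (hC : ∀ s, ‖f s‖ ≤ C) (hfV : ∀ s, f s ∈ V) :
    ∫ s, (w s : ℂ) • f s ∈ V := by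
  have : CompleteSpace V := hV.completeSpace_coe
  have hG : Integrable fun s => (w s : ℂ) • (⟨f s, hfV s⟩ : V) :=
    (hw.ofReal (𝕜 := ℂ)).smul_bdd C (hf.subtype_mk _).aestronglyMeasurable
      (Filter.Eventually.of_forall hC)
  have h := V.subtypeL.integral_comp_comm hG
  change ∫ s, (w s : ℂ) • f s = _ at h
  rw [h]
  exact (∫ s, (w s : ℂ) • (⟨f s, hfV s⟩ : V)).2

lemma isCompactOperator_compressedMultiplier (hA : MeasurableSet A) (hw : Integrable w) :
    IsCompactOperator (compressedMultiplier A w) := by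
  obtain ⟨C, hC⟩ := exists_norm_rankOne_le A
  exact integral_smul_mem (V := compactOperator (RingHom.id ℂ) (Lp ℂ 2 (volume.restrict A))
    (Lp ℂ 2 (volume.restrict A))) isClosed_setOfPred_isCompactOperator hw
    (continuous_rankOne_planeWave hA) hC fun s => isCompactOperator_rankOne _

lemma inner_compressedMultiplier (hA : MeasurableSet A) (hw : Integrable w)
    (g f : Lp ℂ 2 (volume.restrict A)) :
    inner ℂ g (compressedMultiplier A w f) =
      ∫ s, (w s : ℂ) * (inner ℂ (planeWave A s) f * inner ℂ g (planeWave A s)) := by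
  have hi := integrable_smul_rankOne hA hw
  rw [compressedMultiplier, ContinuousLinearMap.integral_apply hi,
    ← integral_inner (hi.apply_continuousLinearMap f)]
  refine integral_congr_ae (Filter.Eventually.of_forall fun s => ?_)
  simp only [smul_apply, rankOne_apply, inner_smul_right]

lemma isSelfAdjoint_compressedMultiplier (hA : MeasurableSet A) (hw : Integrable w) :
    IsSelfAdjoint (compressedMultiplier A w) := by
  rw [ContinuousLinearMap.isSelfAdjoint_iff_isSymmetric]
  intro f g
  change inner ℂ (compressedMultiplier A w f) g = inner ℂ f (compressedMultiplier A w g)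
  rw [← inner_conj_symm, inner_compressedMultiplier hA hw, inner_compressedMultiplier hA hw,
    ← integral_conj]
  refine integral_congr_ae (Filter.Eventually.of_forall fun s => ?_)
  simp only [map_mul, Complex.conj_ofReal, inner_conj_symm]
  ring

lemma integrable_multiplier_mul (hw : Integrable w) {f : ℝ → ℂ} (hf : Integrable f) :
    Integrable fun s => (w s : ℂ) * 𝓕 f s :=
  hw.ofReal.mul_bdd (c := ∫ y, ‖f y‖) (continuous_fourier hf).aestronglyMeasurable
    (Filter.Eventually.of_forall (norm_fourier_le f))

/-- Paired with an arbitrary `g`, both sides agree by the multiplication formula, which moves the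
inverse transform from one factor to the other. -/
lemma compressedMultiplier_ae_eq (hA : MeasurableSet A) (hw : Integrable w)
    (f : Lp ℂ 2 (volume.restrict A)) :
    compressedMultiplier A w f =ᵐ[volume.restrict A]
      𝓕⁻ fun s => (w s : ℂ) * 𝓕 (A.indicator f) s := by
  have hwf := integrable_multiplier_mul hw (integrable_extend hA f)
  have hmem : MemLp (𝓕⁻ fun s => (w s : ℂ) * 𝓕 (A.indicator f) s) 2 (volume.restrict A) :=
    MemLp.of_bound (continuous_fourierInv hwf).aestronglyMeasurable _
      (Filter.Eventually.of_forall (norm_fourierInv_le _))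
  suffices h : compressedMultiplier A w f = hmem.toLp _ by
    rw [h]
    exact hmem.coeFn_toLp
  refine ext_inner_left ℂ fun g => ?_
  have hg : Integrable fun x => (starRingEnd ℂ) (A.indicator g x) :=
    (Complex.conjCLE.toContinuousLinearMap.integrable_comp (integrable_extend hA g) :)
  rw [inner_compressedMultiplier hA hw, L2.inner_def, ← integral_indicator hA]
  simp_rw [inner_planeWave' hA, inner_planeWave hA]
  have h1 := integral_fourierInv_mul hg hwf
  calc _ = ∫ s, 𝓕⁻ (fun x => (starRingEnd ℂ) (A.indicator g x)) s *
        ((w s : ℂ) * 𝓕 (A.indicator f) s) := by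
        refine integral_congr_ae (Filter.Eventually.of_forall fun s => ?_)
        ring
    _ = _ := h1
    _ = _ := by
        refine integral_congr_ae ?_
        filter_upwards [(ae_restrict_iff' hA).1 hmem.coeFn_toLp] with x hx
        by_cases hxA : x ∈ A
        · rw [Set.indicator_of_mem hxA, Set.indicator_of_mem hxA, hx hxA, RCLike.inner_apply,
            mul_comm]
        · rw [Set.indicator_of_notMem hxA, Set.indicator_of_notMem hxA, map_zero, zero_mul]

lemma integral_kernel_mul (hw : Integrable w) {f : ℝ → ℂ} (hf : Integrable f) (x : ℝ) :
    ∫ y, 𝓕⁻ (fun s => (w s : ℂ)) (x - y) * f y = 𝓕⁻ (fun s => (w s : ℂ) * 𝓕 f s) x := by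
  have hv : Integrable fun s : ℝ =>
      Complex.exp (2 * Real.pi * Complex.I * x * s) * (w s : ℂ) :=
    hw.ofReal.bdd_mul (c := 1) (Continuous.aestronglyMeasurable (by fun_prop))
      (Filter.Eventually.of_forall fun s => (norm_exp_two_pi s x).le)
  have h := integral_fourier_mul hv hf
  rw [fourierInv_real_eq]
  calc _ = ∫ y, 𝓕 (fun s : ℝ => Complex.exp (2 * Real.pi * Complex.I * x * s) * (w s : ℂ)) y *
        f y := by
        refine integral_congr_ae (Filter.Eventually.of_forall fun y => ?_)
        simp only
        rw [fourierInv_real_eq, fourier_real_eq']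
        congr 2
        funext s
        rw [← mul_assoc, ← Complex.exp_add]
        congr 2
        push_cast
        ring
    _ = _ := h
    _ = _ := by
        refine integral_congr_ae (Filter.Eventually.of_forall fun y => ?_)
        simp only
        ring

lemma isIntegralOperatorOn_compressedMultiplier (hA : MeasurableSet A) (hw : Integrable w) :
    IsIntegralOperatorOn volume (fun x y => 𝓕⁻ (fun s => (w s : ℂ)) (x - y)) A
      (compressedMultiplier A w) := by
  intro f
  have hf : Integrable f (volume.restrict A) := (Lp.memLp f).integrable (by norm_num)
  filter_upwards [compressedMultiplier_ae_eq hA hw f] with x hx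
  constructor
  · refine hf.bdd_mul (c := ∫ y, ‖(w y : ℂ)‖) ?_
      (Filter.Eventually.of_forall fun y => norm_fourierInv_le _ _)
    have := continuous_fourierInv (f := fun s => (w s : ℂ)) hw.ofReal
    exact Continuous.aestronglyMeasurable (by fun_prop)
  · rw [hx, ← integral_kernel_mul hw (integrable_extend hA f), ← integral_indicator hA]
    refine integral_congr_ae (Filter.Eventually.of_forall fun y => ?_)
    by_cases hy : y ∈ A <;> simp [hy]

/-- A compact self-adjoint operator of norm at least 1 has an eigenvector attaining its norm. Here
such an eigenvector would be both band-limited and supported in a set of finite measure, hence zero.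
-/
theorem norm_compressedMultiplier_lt_one (hA : MeasurableSet A) (hw : Integrable w)
    (hw0 : ∀ s, 0 ≤ w s) (hw1 : ∀ s, w s ≤ 1) {R : ℝ} (hR : ∀ s, R < |s| → w s < 1) :
    ‖compressedMultiplier A w‖ < 1 := by
  by_contra! hge
  set T := compressedMultiplier A w with hT
  have hsa := isSelfAdjoint_compressedMultiplier hA hw
  have hne : Nontrivial (Lp ℂ 2 (volume.restrict A)) := by
    by_contra hn
    rw [not_nontrivial_iff_subsingleton] at hn
    have : T = 0 := Subsingleton.elim _ _
    rw [this, norm_zero] at hge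
    linarith
  -- Self-adjointness makes the norm equal to the spectral radius, which is attained at a spectral
  -- value; compactness makes this nonzero value an eigenvalue.
  obtain ⟨c, hc, hcn⟩ := spectrum.exists_nnnorm_eq_spectralRadius T
  rw [T.spectralRadius_eq_nnnorm hsa, ENNReal.coe_inj] at hcn
  have hc1 : 1 ≤ ‖c‖ := by
    rw [← coe_nnnorm, hcn]
    exact hge
  have hc0 : c ≠ 0 := by
    rw [← norm_pos_iff]
    linarith
  obtain ⟨f, hf⟩ := ((isCompactOperator_compressedMultiplier hA hw).hasEigenvalue_iff_mem_spectrum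
    hc0).2 hc |>.exists_hasEigenvector
  have hTf : T f = c • f := hf.apply_eq_smul
  have hf0 : f ≠ 0 := hf.2
  set F := A.indicator f with hFdef
  have hFi : Integrable F := integrable_extend hA f
  have hF2 : MemLp F 2 := memLp_extend hA f
  have hφ2 := memLp_fourier hFi hF2
  have hφi : Integrable fun s => ‖𝓕 F s‖ ^ 2 := hφ2.integrable_norm_pow (by norm_num)
  have hwφ : Integrable fun s => w s * ‖𝓕 F s‖ ^ 2 :=
    hφi.bdd_mul (c := 1) hw.aestronglyMeasurable (Filter.Eventually.of_forall fun s => by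
      rw [Real.norm_eq_abs, abs_of_nonneg (hw0 s)]
      exact hw1 s)
  have hnormF : ∫ x, ‖F x‖ ^ 2 = ‖f‖ ^ 2 := by
    rw [← inner_self_eq_norm_sq (𝕜 := ℂ), L2.inner_def, ← integral_re (L2.integrable_inner _ _),
      ← integral_indicator hA]
    refine integral_congr_ae (Filter.Eventually.of_forall fun x => ?_)
    by_cases hx : x ∈ A
    · simp only [hFdef, Set.indicator_of_mem hx, inner_self_eq_norm_sq]
    · simp [hFdef, Set.indicator_of_notMem hx]
  have hquad : inner ℂ f (T f) = ((∫ s, w s * ‖𝓕 F s‖ ^ 2 : ℝ) : ℂ) := by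
    rw [inner_compressedMultiplier hA hw, ← integral_complex_ofReal]
    refine integral_congr_ae (Filter.Eventually.of_forall fun s => ?_)
    simp only
    rw [← inner_conj_symm f, inner_planeWave hA, Complex.mul_conj, Complex.normSq_eq_norm_sq]
    push_cast
    rfl
  have hle : ∫ s, ‖𝓕 F s‖ ^ 2 ≤ ∫ s, w s * ‖𝓕 F s‖ ^ 2 := by
    rw [integral_norm_sq_fourier hFi hF2, hnormF]
    have h1 : ‖inner ℂ f (T f)‖ = ‖c‖ * ‖f‖ ^ 2 := by
      rw [hTf, inner_smul_right, norm_mul, inner_self_eq_norm_sq_to_K]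
      simp
    rw [hquad, Complex.norm_real, Real.norm_eq_abs, abs_of_nonneg (integral_nonneg fun s =>
      mul_nonneg (hw0 s) (by positivity))] at h1
    rw [h1]
    nlinarith [sq_nonneg ‖f‖]
  -- The integrand is nonnegative, and its integral is at most 0 by `hle`. Hence the transform
  -- vanishes almost everywhere where w < 1, in particular for |s| > R.
  have hzero : ∀ᵐ s, (1 - w s) * ‖𝓕 F s‖ ^ 2 = 0 := by
    have hnn : 0 ≤ fun s => (1 - w s) * ‖𝓕 F s‖ ^ 2 := fun s =>
      mul_nonneg (sub_nonneg.2 (hw1 s)) (by positivity)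
    have hsub : (fun s => (1 - w s) * ‖𝓕 F s‖ ^ 2) =
        fun s => ‖𝓕 F s‖ ^ 2 - w s * ‖𝓕 F s‖ ^ 2 := by
      funext s
      ring
    refine (integral_eq_zero_iff_of_nonneg hnn (hsub ▸ hφi.sub hwφ)).1 (le_antisymm ?_
      (integral_nonneg hnn))
    rw [hsub, integral_sub hφi hwφ]
    linarith
  set φ : ℝ → ℂ := {s | |s| ≤ R}.indicator (𝓕 F) with hφdef
  have hφ : φ =ᵐ[volume] 𝓕 F := by
    filter_upwards [hzero] with s hs
    by_cases hsR : |s| ≤ R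
    · exact Set.indicator_of_mem (s := {s | |s| ≤ R}) hsR _
    · rw [hφdef, Set.indicator_of_notMem (s := {s | |s| ≤ R}) hsR]
      have h1 : 1 - w s ≠ 0 := by
        have := hR s (not_le.1 hsR)
        intro h
        linarith
      have := (mul_eq_zero.1 hs).resolve_left h1
      rw [sq_eq_zero_iff, norm_eq_zero] at this
      exact this.symm
  have hball : {s : ℝ | |s| ≤ R} = Set.Icc (-R) R := by
    ext s
    simp [abs_le]
  have hφint : Integrable φ := by
    rw [hφdef, hball, integrable_indicator_iff measurableSet_Icc]
    exact (continuous_fourier hFi).continuousOn.integrableOn_compact isCompact_Icc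
  have hinv := fourierInv_fourier_ae_eq hFi hF2 hφint hφ
  have hcompl : volume Aᶜ ≠ 0 := by
    intro h0
    have h1 : volume A < ∞ := by
      have := measure_lt_top (volume.restrict A) Set.univ
      rwa [Measure.restrict_apply_univ] at this
    have h2 := measure_union_le (μ := (volume : Measure ℝ)) A Aᶜ
    rw [Set.union_compl_self, h0, add_zero, Real.volume_univ] at h2
    exact absurd h2 (not_le.2 h1)
  have hvanish : ∀ x, 𝓕⁻ φ x = 0 := by
    refine fourierInv_eq_zero_of_ae hφint (R := R) (fun s hs => ?_) hcompl ?_ hA.compl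
    · exact Set.indicator_of_notMem (s := {s | |s| ≤ R}) (not_le.2 hs) _
    · rw [ae_restrict_iff' hA.compl]
      filter_upwards [hinv] with x hx hxA
      rw [hx]
      exact Set.indicator_of_notMem hxA _
  refine hf0 ?_
  rw [← norm_eq_zero, ← sq_eq_zero_iff, ← hnormF]
  rw [integral_congr_ae (g := fun _ => (0 : ℝ))]
  · simp
  · filter_upwards [hinv] with x hx
    rw [← hx, hvanish x]
    simp

end timeBandLimiting

end FermionProcess

namespace FermionProcess

open FourierTransform

/-! ### The kernel of the theorem as an inverse Fourier transform -/

section macchi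

variable {khat : ℝ → ℝ}

/-- The substitution t = -2πs absorbs both the factor 1/2π and the opposite sign in the exponent. -/
lemma fourierKernel_eq_fourierInv (khat : ℝ → ℝ) (x y : ℝ) :
    fourierKernel id khat x y = 𝓕⁻ (fun s => (khat (-(2 * Real.pi) * s) : ℂ)) (x - y) := by
  have h := Measure.integral_comp_mul_left
    (fun t : ℝ => Complex.exp (-(Complex.I * ((x - y : ℝ) : ℂ) * t)) * (khat t : ℂ))
    (-(2 * Real.pi))
  rw [inv_neg, abs_neg, abs_of_pos (by positivity), Complex.real_smul] at h
  rw [fourierInv_real_eq, fourierKernel]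
  push_cast at h
  rw [one_div, mul_inv]
  simp only [id]
  push_cast
  rw [mul_inv] at h
  rw [← h]
  refine integral_congr_ae (Filter.Eventually.of_forall fun s => ?_)
  simp only
  congr 2
  ring

theorem macchiNormLtOne_fourierKernel (hint : Integrable khat) (h0 : ∀ t, 0 ≤ khat t)
    (h1 : ∀ t, khat t ≤ 1) {R : ℝ} (hR : ∀ t, R < |t| → khat t < 1) :
    MacchiNormLtOne volume (fourierKernel id khat) := by
  rintro A ⟨hA, hdiag⟩
  have hdet (x : ℝ) : kernelDet (fourierKernel id khat) (fun _ : Fin 1 => x) =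
      ((1 / (2 * Real.pi) * ∫ t, khat t : ℝ) : ℂ) := by
    rw [kernelDet, Matrix.det_fin_one]
    exact fourierKernel_self x
  simp_rw [hdet] at hdiag
  -- If the constant diagonal value is 0, every Borel set is a test set, possibly of infinite
  -- measure, but then the kernel is identically 0. Otherwise integrability of a nonzero constant
  -- forces finite measure.
  by_cases hz : ∫ t, khat t = 0
  · have hk0 := (integral_eq_zero_iff_of_nonneg h0 hint).1 hz
    have hK (x y : ℝ) : fourierKernel id khat x y = 0 := by
      rw [fourierKernel, integral_congr_ae (g := fun _ => 0)]
      · simp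
      · filter_upwards [hk0] with t ht
        simp [ht]
    refine ⟨0, fun f => ?_, by simp⟩
    filter_upwards [Lp.coeFn_zero ℂ 2 (volume.restrict A)] with x hx
    simp only [hK, zero_mul, integral_zero]
    exact ⟨integrableOn_zero, hx⟩
  · have hvol : volume A < ∞ := by
      rcases (integrableOn_const_iff enorm_ne_top).1 hdiag with h | h
      · exfalso
        rw [enorm_eq_zero, Complex.ofReal_eq_zero] at h
        exact hz ((mul_eq_zero.1 h).resolve_left (by positivity))
      · exact h
    have : IsFiniteMeasure (volume.restrict A) := isFiniteMeasure_restrict.2 hvol.ne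
    have h2 : -(2 * Real.pi) ≠ 0 := by
      have := Real.pi_pos
      linarith
    have hw : Integrable fun s => khat (-(2 * Real.pi) * s) := hint.comp_mul_left' h2
    refine ⟨compressedMultiplier A fun s => khat (-(2 * Real.pi) * s), ?_,
      norm_compressedMultiplier_lt_one hA hw (fun s => h0 _) (fun s => h1 _)
        (R := R / (2 * Real.pi)) fun s hs => hR _ ?_⟩
    · have hK : fourierKernel id khat =
          fun x y => 𝓕⁻ (fun s => (khat (-(2 * Real.pi) * s) : ℂ)) (x - y) :=
        funext fun x => funext fun y => fourierKernel_eq_fourierInv khat x y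
      rw [hK]
      exact isIntegralOperatorOn_compressedMultiplier hA hw
    · rw [div_lt_iff₀ (by positivity)] at hs
      rw [abs_mul, abs_neg, abs_of_pos (by positivity : 0 < 2 * Real.pi)]
      linarith

end macchi

end FermionProcess

theorem proposition4p1 (khat : ℝ → ℝ) (hint : Integrable khat volume)
    (h0 : ∀ y, 0 ≤ khat y) (h1 : ∀ y, khat y ≤ 1)
    (hlarge : ∃ R : ℝ, ∀ y, R < |y| → khat y < 1)
    (k : ℝ → ℂ)
    (hk : ∀ x : ℝ, k x =
      (1 / (2 * (Real.pi : ℂ))) * ∫ y : ℝ, Complex.exp (-(Complex.I * x * y)) * (khat y : ℂ)) :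
    MacchiNonneg (fun x y : ℝ => k (x - y)) ∧
      MacchiNormLtOne volume (fun x y : ℝ => k (x - y)) ∧
      ∃ P : Measure (Configuration ℝ), IsFermionProcess P volume (fun x y : ℝ => k (x - y)) := by
  have hK : (fun x y : ℝ => k (x - y)) = FermionProcess.fourierKernel id khat :=
    funext fun x => funext fun y => hk (x - y)
  obtain ⟨R, hR⟩ := hlarge
  rw [hK]
  exact ⟨FermionProcess.macchiNonneg_fourierKernel hint h0,
    FermionProcess.macchiNormLtOne_fourierKernel hint h0 h1 hR,
    FermionProcess.exists_isFermionProcess hint h0 h1⟩
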